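/- Let $C_n\subseteq\mathbb{R}^2$ ($n\geqslant 1$) be the circle of radius $\frac1n$ centered at $(\frac1n,0)$, let $\mathbb{H}=\bigcup_{n\geqslant 1}C_n$ be the Hawaiian Earring, and let $\ell_n:[0,1]\to C_n$, $\ell_n(t)=\frac1n(1-\cos 2\pi t,\ \sin 2\pi t)$. For each $n\geqslant 1$ let $P_n$ be a pair of pants, i.e. a closed disk $D_n\subseteq\mathbb{R}^2$ from which the interiors of two disjoint closed disks $D_{n,1},D_{n,2}$ contained in the interior of $D_n$ have been removed, and let $\alpha_n,\beta_n,\gamma_n$ be parametrizations of $\partial D_n,\partial D_{n,1},\partial D_{n,2}$, respectively, with clockwise orientation. (To be definite, identify $\mathbb{R}^2$ with $\mathbb{C}$, let $D_n$ be the disk of radius $4$ centered at $0$ and let $D_{n,1},D_{n,2}$ be the disks of radius $1$ centered at $-2$ and $2$; put $\alpha_n(t)=-4e^{-2\pi i t}$, $\beta_n(t)=-2-e^{-2\pi i t}$ and $\gamma_n(t)=2-e^{-2\pi i t}$.) The Hawaiian Pants $\mathbb{P}$ is the adjunction space $\mathbb{P}=\mathbb{H}\cup_f\coprod_{n\geqslant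 1}P_n$, with the quotient topology, where $f:\coprod_{n\geqslant 1}\partial P_n\to\mathbb{H}$ is the map whose restrictions $f_n=f|_{\partial P_n}$ satisfy $f_n\circ\alpha_n=\ell_n$, $f_n\circ\beta_n=\ell_{2n}$ and $f_n\circ\gamma_n=\ell_{2n+1}$. A path-connected space $X$ is called homotopically path Hausdorff if for every two paths $\alpha,\beta:[0,1]\to X$ with $\alpha(0)=\beta(0)$ and $\alpha(1)=\beta(1)$ such that $\alpha\cdot\beta^-$ is not null-homotopic (where $\beta^-(t)=\beta(1-t)$), there are a partition $0=t_0<t_1<\cdots<t_n=1$ and open subsets $U_1,\dots,U_n$ of $X$ with $\alpha([t_{i-1},t_i])\subseteq U_i$ for all $1\leqslant i\leqslant n$ such that, for every path $\gamma:[0,1]\to X$ with $\gamma([t_{i-1},t_i])\subseteq U_i$ for all $1\leqslant i\leqslant n$ and $\gamma(t_i)=\alpha(t_i)$ for all $0\leqslant i\leqslant n$, the loop $\gamma\cdot\beta^-$ is not null-homotopic. Theorem. The space $\mathbb{P}$ is path-connected and homotopically path Hausdorff. Moreover, for every $x\in\mathbb{P}$, the fundamental group $\pi_1(\mathbb{P},x)$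 is $T_1$ in the quotient topology induced by the compact-open topology on the loop space $\Omega(\mathbb{P},x)$. -/

import Mathlib

/-- The circle `C_n` in the plane `ℂ = ℝ²` with centre `(1/n, 0)` and radius `1/n`. -/
def earringCircle (n : ℕ+) : Set ℂ :=
  Metric.sphere ((n : ℂ)⁻¹) ((n : ℝ)⁻¹)

/-- The Hawaiian Earring, the union of the circles `C_n`, `n ≥ 1`, as a subset of the plane. -/
def hawaiianEarring : Set ℂ :=
  ⋃ n : ℕ+, earringCircle n

/-- The similarity `u ↦ 1/n + u/n` from the unit circle onto `C_n`. Composed with the clockwise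
unit loop `t ↦ -exp (-2πit)` it is the loop `ℓ_n (t) = (1/n) (1 - cos 2πt, sin 2πt)`. -/
noncomputable def toEarring (n : ℕ+) (u : Circle) : hawaiianEarring :=
  ⟨(n : ℂ)⁻¹ + (n : ℂ)⁻¹ * (u : ℂ), Set.mem_iUnion.2 ⟨n, by
    simp [earringCircle, Circle.norm_coe u]⟩⟩

/-- The pair of pants: a closed disk from whose interior two open disks, whose closures are
disjoint, are removed. -/
def pairOfPants : Set ℂ :=
  Metric.closedBall 0 4 \ (Metric.ball (-2) 1 ∪ Metric.ball 2 1)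

/-- The parametrization `u ↦ 4u` of the outer boundary circle of the pair of pants. -/
noncomputable def outerBoundary (u : Circle) : pairOfPants :=
  ⟨4 * (u : ℂ), by
    have hu : ‖(u : ℂ)‖ = 1 := Circle.norm_coe u
    refine ⟨by simp [hu], ?_⟩
    have h4 : ‖4 * (u : ℂ)‖ = 4 := by simp [hu]
    rintro (h | h)
    · rw [Metric.mem_ball, dist_eq_norm] at h
      have h1 := norm_sub_norm_le (4 * (u : ℂ)) (-2)
      rw [h4, norm_neg, Complex.norm_ofNat] at h1
      linarith
    · rw [Metric.mem_ball, dist_eq_norm] at h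
      have h1 := norm_sub_norm_le (4 * (u : ℂ)) 2
      rw [h4, Complex.norm_ofNat] at h1
      linarith⟩

/-- The parametrization `u ↦ -2 + u` of the first inner boundary circle. -/
noncomputable def innerBoundary₁ (u : Circle) : pairOfPants :=
  ⟨-2 + (u : ℂ), by
    have hu : ‖(u : ℂ)‖ = 1 := Circle.norm_coe u
    refine ⟨?_, ?_⟩
    · rw [mem_closedBall_zero_iff]
      have h1 := norm_add_le (-2 : ℂ) (u : ℂ)
      rw [hu, norm_neg, Complex.norm_ofNat] at h1
      linarith
    · rintro (h | h)
      · rw [Metric.mem_ball, dist_eq_norm] at h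
        simp [hu] at h
      · rw [Metric.mem_ball, dist_eq_norm] at h
        have h1 := norm_sub_norm_le (4 : ℂ) (u : ℂ)
        rw [hu, Complex.norm_ofNat, ← norm_neg] at h1
        have h2 : -(4 - (u : ℂ)) = -2 + (u : ℂ) - 2 := by ring
        rw [h2] at h1
        linarith⟩

/-- The parametrization `u ↦ 2 + u` of the second inner boundary circle. -/
noncomputable def innerBoundary₂ (u : Circle) : pairOfPants :=
  ⟨2 + (u : ℂ), by
    have hu : ‖(u : ℂ)‖ = 1 := Circle.norm_coe u
    refine ⟨?_, ?_⟩
    · rw [mem_closedBall_zero_iff]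
      have h1 := norm_add_le (2 : ℂ) (u : ℂ)
      rw [hu, Complex.norm_ofNat] at h1
      linarith
    · rintro (h | h)
      · rw [Metric.mem_ball, dist_eq_norm] at h
        have h1 := norm_sub_norm_le (4 : ℂ) (-(u : ℂ))
        rw [norm_neg, hu, Complex.norm_ofNat] at h1
        have h2 : 4 - -(u : ℂ) = 2 + (u : ℂ) - -2 := by ring
        rw [h2] at h1
        linarith
      · rw [Metric.mem_ball, dist_eq_norm] at h
        simp [hu] at h⟩

/-- The disjoint union of the Hawaiian Earring and of pairs of pants `P_n`, `n ≥ 1`. -/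
abbrev PantsPieces : Type :=
  hawaiianEarring ⊕ (Σ _ : ℕ+, pairOfPants)

/-- The gluing relation: the outer boundary of `P_n` is attached to `C_n`, its inner boundary
circles to `C_{2n}` and `C_{2n+1}`, all three with the same (clockwise) orientation. -/
inductive PantsGlue : PantsPieces → PantsPieces → Prop
  | outer (n : ℕ+) (u : Circle) :
      PantsGlue (Sum.inr ⟨n, outerBoundary u⟩) (Sum.inl (toEarring n u))
  | inner₁ (n : ℕ+) (u : Circle) :
      PantsGlue (Sum.inr ⟨n, innerBoundary₁ u⟩) (Sum.inl (toEarring (2 * n) u))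
  | inner₂ (n : ℕ+) (u : Circle) :
      PantsGlue (Sum.inr ⟨n, innerBoundary₂ u⟩) (Sum.inl (toEarring (2 * n + 1) u))

/-- The Hawaiian Pants: the adjunction space, that is, the quotient of the disjoint union of its
pieces by the equivalence relation generated by the gluing, with the quotient topology. -/
abbrev HawaiianPants : Type :=
  Quot PantsGlue

/-- A path-connected space `X` is homotopically path Hausdorff if for every two paths `α`, `β` with
common endpoints such that `α · β⁻` is not null-homotopic, there are a partition
`0 = t_0 < ⋯ < t_n = 1` and open sets `U_1, …, U_n` with `α [t_{i-1}, t_i] ⊆ U_i` such that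
`γ · β⁻` is not null-homotopic for any path `γ` with `γ [t_{i-1}, t_i] ⊆ U_i` for all `i` and
`γ t_i = α t_i` for all `i`. -/
def HomotopicallyPathHausdorff (X : Type*) [TopologicalSpace X] : Prop :=
  PathConnectedSpace X ∧
    ∀ (x y : X) (α β : Path x y), ¬ (α.trans β.symm).Homotopic (Path.refl x) →
      ∃ (n : ℕ) (t : Fin (n + 1) → unitInterval) (U : Fin n → Set X),
        StrictMono t ∧ t 0 = 0 ∧ t (Fin.last n) = 1 ∧
        (∀ i, IsOpen (U i)) ∧
        (∀ i : Fin n, α '' Set.Icc (t i.castSucc) (t i.succ) ⊆ U i) ∧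
        ∀ γ : Path x y,
          (∀ i : Fin n, γ '' Set.Icc (t i.castSucc) (t i.succ) ⊆ U i) →
          (∀ i : Fin (n + 1), γ (t i) = α (t i)) →
          ¬ (γ.trans β.symm).Homotopic (Path.refl x)

/-- The quotient topology on the fundamental group `π₁(X, x)`: the finest topology for which the
map `γ ↦ [γ]` from the loop space at `x`, with the compact-open topology, is continuous. -/
abbrev fundamentalGroupQuotientTopology (X : Type*) [TopologicalSpace X] (x : X) :
    TopologicalSpace (FundamentalGroup X x) :=
  TopologicalSpace.coinduced
    (fun γ : Path x x => FundamentalGroup.fromPath (Path.Homotopic.Quotient.mk γ))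
    inferInstance

/-! ### Closed homotopy classes in path spaces. -/

open Set Topology Filter unitInterval

/-! Both assertions follow from one fact: the null-homotopic loops at the common point of the
circles form a closed set in the compact-open topology. By conjugation the paths homotopic to a
given path are then closed among the paths with the same endpoints. An open set around a path
contains all paths subordinate to a suitable partition, which gives the homotopic path Hausdorff
property, and closed homotopy classes are exactly closed points of the quotient topology.

To prove closedness, the Hawaiian Pants is identified with the bottom of a tower: `Tower N` is the
space in which the first `N` pairs of pants have been collapsed to graphs. Collapsing pants number
`N` replaces the circle `(N, 0)` by the word `a b y b⁻¹ x a⁻¹`, where `x`, `y` are the two inner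
circles and `a`, `b` are new circles that come from arcs joining the boundary components. Each
collapse has a left homotopy inverse, so it loses no homotopy classes
(`Tower.homotopic_refl_of_collapse`). A compact set meets the pants outside their collars in only
finitely many members, so finitely many collapses move it into an open neighbourhood of the wedge of
circles that deforms to the wedge (`Tower.exists_forall_collapseIter_mem`).

Loops in the wedge, which has the topology of a Hawaiian earring, are controlled by words. For a
finite set `S` of circles, path lifting in a covering with free-group fibre gives a holonomy that is
locally constant in families and homotopy invariant. Conversely, a loop whose holonomies vanish for
all large `S` is null-homotopic (`CircleCoords.homotopic_refl_of_hol`): weighted distances from the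
root along its lifts to trees have a limit along an ultrafilter, this limit codes a real tree
through which the loop factors, and the tree contracts to its root.

The inclusion of the wedge into a level of the tower is injective on fundamental groups
(`Tower.homotopic_refl_of_wedgePath`): a null-homotopy lives in the collar neighbourhood after
finitely many collapses, so the collapsed loop has trivial words, and the substitution `n ↦ a b y
b⁻¹ x a⁻¹` is injective on words without `a`, `b` (`FreeGroup.eq_one_of_subst_eq_one`).

Now let `α` be essential. After finitely many collapses and the retraction to the wedge, some finite
holonomy of `α` is nontrivial. It stays the same for all loops near `α`, while null-homotopic ones
would have trivial holonomy by the injectivity just described. Hence a neighbourhood of `α` contains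
only essential loops. -/

theorem Path.homotopic_iff_trans_symm_homotopic_refl {X : Type*} [TopologicalSpace X] {x y : X}
    (γ β : Path x y) : γ.Homotopic β ↔ (γ.trans β.symm).Homotopic (Path.refl x) := by
  simp only [← Path.Homotopic.Quotient.eq, Path.Homotopic.Quotient.mk_trans,
    Path.Homotopic.Quotient.mk_symm, Path.Homotopic.Quotient.mk_refl]
  constructor
  · intro h
    rw [h, Path.Homotopic.Quotient.trans_symm]
  · intro h
    have := congrArg (fun q => q.trans (Path.Homotopic.Quotient.mk β)) h
    simpa [Path.Homotopic.Quotient.trans_assoc] using this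

/-- If the null-homotopic loops at `p` form a closed set, then so do the paths with prescribed
endpoints that are homotopic to a given one. -/
theorem isClosed_setOf_path_homotopic {X : Type*} [TopologicalSpace X] [PathConnectedSpace X]
    {p : X} (hp : IsClosed {γ : Path p p | γ.Homotopic (Path.refl p)}) {x y : X} (β : Path x y) :
    IsClosed {γ : Path x y | (γ.trans β.symm).Homotopic (Path.refl x)} := by
  -- Null-homotopy is invariant under conjugation by `δ`, and `γ ↦ δ · (γ · β⁻) · δ⁻` is continuous
  -- into the loops at `p`.
  let δ : Path p x := (PathConnectedSpace.joined p x).somePath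
  have hc : Continuous fun γ : Path x y => δ.trans ((γ.trans β.symm).trans δ.symm) :=
    Continuous.path_trans continuous_const
      (Continuous.path_trans (Continuous.path_trans continuous_id continuous_const)
        continuous_const)
  convert hp.preimage hc using 1
  ext γ
  simp only [mem_ofPred_eq, mem_preimage, ← Path.Homotopic.Quotient.eq,
    Path.Homotopic.Quotient.mk_trans, Path.Homotopic.Quotient.mk_symm,
    Path.Homotopic.Quotient.mk_refl]
  set d := Path.Homotopic.Quotient.mk δ
  constructor
  · intro h
    rw [h]; simp
  · intro h
    have := congrArg (fun q => (d.symm.trans q).trans d) h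
    simpa [Path.Homotopic.Quotient.trans_assoc, ← Path.Homotopic.Quotient.trans_assoc d.symm d]
      using this

/-- A neighbourhood of a path in the compact-open topology contains all the paths that stay in
suitable open sets on the pieces of a suitable partition. -/
theorem exists_partition_of_isOpen {X : Type*} [TopologicalSpace X] {x y : X}
    {O : Set (Path x y)} (hO : IsOpen O) {α : Path x y} (hα : α ∈ O) :
    ∃ (n : ℕ) (t : Fin (n + 1) → unitInterval) (U : Fin n → Set X),
      StrictMono t ∧ t 0 = 0 ∧ t (Fin.last n) = 1 ∧ (∀ i, IsOpen (U i)) ∧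
      (∀ i : Fin n, α '' Icc (t i.castSucc) (t i.succ) ⊆ U i) ∧
      ∀ γ : Path x y, (∀ i : Fin n, γ '' Icc (t i.castSucc) (t i.succ) ⊆ U i) → γ ∈ O := by
  obtain ⟨V, hV, rfl⟩ := isOpen_induced_iff.1 hO
  have hb := TopologicalSpace.isTopologicalBasis_of_subbasis
    (ContinuousMap.compactOpen_eq (X := I) (Y := X))
  obtain ⟨_, ⟨s, ⟨hsf, hss⟩, rfl⟩, hαs, hsV⟩ := hb.exists_subset_of_mem_open hα hV
  have hs' : ∀ f : s, ∃ K : Set I, IsCompact K ∧ ∃ U : Set X, IsOpen U ∧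
      (f : Set C(I, X)) = {g : C(I, X) | MapsTo g K U} := by
    rintro ⟨f, hf⟩
    obtain ⟨K, hK, U, hU, h⟩ := hss hf
    exact ⟨K, hK, U, hU, h.symm⟩
  choose K hK U hU hf using hs'
  have : Finite s := hsf
  have hmaps : ∀ f : s, MapsTo α (K f) (U f) := by
    intro f
    have := hαs f f.2
    rw [hf f] at this
    exact this
  -- `W a` collects the constraints active at time `a`. On `N a` no further constraint becomes
  -- active, because the compact sets `K f` that miss `a` are removed. Hence a path that stays in `W
  -- a` on a piece inside `N a` meets every constraint there, and a partition finer than a Lebesgue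
  -- number of this cover suffices.
  let W : I → Set X := fun a => ⋂ f : s, {z | a ∈ K f → z ∈ U f}
  have hW : ∀ a, IsOpen (W a) := by
    intro a
    refine isOpen_iInter_of_finite fun f => ?_
    by_cases h : a ∈ K f
    · simpa [h] using hU f
    · simp [h]
  let N : I → Set I := fun a => (⋂ f : s, {b | b ∈ K f → a ∈ K f}) ∩ α ⁻¹' W a
  have hN : ∀ a, IsOpen (N a) := by
    intro a
    refine (isOpen_iInter_of_finite fun f => ?_).inter ((hW a).preimage α.continuous)
    by_cases h : a ∈ K f
    · simp [h]
    · simp only [h, imp_false]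
      exact (hK f).isClosed.isOpen_compl
  have hcov : (univ : Set I) ⊆ ⋃ a, N a := by
    intro a _
    refine mem_iUnion.2 ⟨a, mem_iInter.2 fun f h => h, mem_iInter.2 fun f h => hmaps f h⟩
  obtain ⟨δ, hδ, hball⟩ := lebesgue_number_lemma_of_metric isCompact_univ hN hcov
  obtain ⟨m, hm⟩ := exists_nat_one_div_lt hδ
  have hm0 : (0 : ℝ) < (m + 1 : ℕ) := by positivity
  let t : Fin (m + 1 + 1) → I := fun i => ⟨(i : ℕ) / (m + 1 : ℕ), by positivity, by
    rw [div_le_one hm0]; exact_mod_cast Nat.lt_succ_iff.1 i.2⟩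
  choose c hc using fun i : Fin (m + 1) => hball (t i.castSucc) (mem_univ _)
  have hIcc : ∀ i : Fin (m + 1), Icc (t i.castSucc) (t i.succ) ⊆ N (c i) := by
    intro i z hz
    refine hc i ?_
    have h1 : ((t i.castSucc : I) : ℝ) ≤ z := hz.1
    have h2 : (z : ℝ) ≤ (t i.succ : I) := hz.2
    have h3 : ((t i.succ : I) : ℝ) = (t i.castSucc : I) + 1 / ((m : ℝ) + 1) := by
      simp only [t, Fin.val_succ, Fin.val_castSucc]
      push_cast
      ring
    rw [Metric.mem_ball, Subtype.dist_eq, Real.dist_eq, abs_lt]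
    constructor <;> linarith
  refine ⟨m + 1, t, fun i => W (c i), ?_, ?_, ?_, fun i => hW _, ?_, ?_⟩
  · intro i j hij
    rw [← Subtype.coe_lt_coe]
    simp only [t]
    gcongr
    exact_mod_cast hij
  · ext; simp [t]
  · ext
    simp only [t, Fin.val_last]
    exact div_self hm0.ne'
  · rintro i _ ⟨z, hz, rfl⟩
    exact (hIcc i hz).2
  · intro γ hγ
    refine hsV fun f hfs => ?_
    suffices MapsTo γ (K ⟨f, hfs⟩) (U ⟨f, hfs⟩) by
      have h := hf ⟨f, hfs⟩
      rw [show f = _ from h]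
      exact this
    intro z hz
    have : ∃ i : Fin (m + 1), z ∈ Icc (t i.castSucc) (t i.succ) := by
      have hz0 : 0 ≤ (z : ℝ) := z.2.1
      have hz1 : (z : ℝ) ≤ 1 := z.2.2
      rcases eq_or_lt_of_le hz1 with h | h
      · refine ⟨Fin.last m, ?_, ?_⟩ <;> rw [← Subtype.coe_le_coe, h]
        · exact (t _).2.2
        · simp only [t, Fin.val_succ, Fin.val_last]
          rw [div_self hm0.ne']
      · have hfl : ⌊(z : ℝ) * (m + 1 : ℕ)⌋₊ < m + 1 := by
          rw [Nat.floor_lt (by positivity)]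
          nlinarith
        refine ⟨⟨_, hfl⟩, ?_, ?_⟩ <;> rw [← Subtype.coe_le_coe]
        · simp only [t, Fin.val_castSucc]
          rw [div_le_iff₀ hm0]
          exact Nat.floor_le (by positivity)
        · simp only [t, Fin.val_succ]
          rw [le_div_iff₀ hm0]
          exact_mod_cast (Nat.lt_floor_add_one _).le
    obtain ⟨i, hi⟩ := this
    have h1 := mem_iInter.1 (hIcc i hi).1 ⟨f, hfs⟩ hz
    exact mem_iInter.1 (hγ i (mem_image_of_mem _ hi)) ⟨f, hfs⟩ h1

/-- If the null-homotopic loops at some point of a path-connected space form a closed set, then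
the space is homotopically path Hausdorff and its fundamental groups are `T₁`. -/
theorem homotopicallyPathHausdorff_and_t1Space {X : Type*} [TopologicalSpace X]
    [PathConnectedSpace X] {p : X} (hp : IsClosed {γ : Path p p | γ.Homotopic (Path.refl p)}) :
    HomotopicallyPathHausdorff X ∧
      ∀ x : X, @T1Space (FundamentalGroup X x) (fundamentalGroupQuotientTopology X x) := by
  refine ⟨⟨inferInstance, fun x y α β hαβ => ?_⟩, fun x => ?_⟩
  · obtain ⟨n, t, U, h1, h2, h3, h4, h5, h6⟩ := exists_partition_of_isOpen
      (isClosed_setOf_path_homotopic hp β).isOpen_compl hαβ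
    exact ⟨n, t, U, h1, h2, h3, h4, h5, fun γ hγ _ => h6 γ hγ⟩
  · let := fundamentalGroupQuotientTopology X x
    refine ⟨fun g => ?_⟩
    obtain ⟨β, rfl⟩ := Path.Homotopic.Quotient.mk_surjective g
    -- A point is closed in the quotient topology exactly when its homotopy class is closed in the
    -- loop space.
    rw [isClosed_coinduced]
    convert isClosed_setOf_path_homotopic hp β using 1
    ext γ
    rw [mem_ofPred_eq, ← Path.homotopic_iff_trans_symm_homotopic_refl,
      ← Path.Homotopic.Quotient.eq]
    rfl

/-! ### Real trees coded by height functions. -/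

/-- `HeightClose h ε a b` says that the distance of `a` and `b` in the tree coded by the height
function `h` is at most `ε`. -/
def HeightClose (h : I → ℝ) (ε : ℝ) (a b : I) : Prop :=
  ∀ u, h a + h b - 2 * h (max (min a b) (min u (max a b))) ≤ ε

/-- The tree distance is `h a + h b - 2 min h`, with the minimum over the interval between `a` and
`b`. Clamping `u` in the definition makes it range over a fixed set, so that closeness is visibly a
closed condition on `b`. -/
theorem heightClose_iff {h : I → ℝ} {ε : ℝ} {a b : I} :
    HeightClose h ε a b ↔ ∀ u ∈ uIcc a b, h a + h b - 2 * h u ≤ ε := by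
  refine ⟨fun H u hu => ?_, fun H u => H _ ⟨le_max_left _ _, ?_⟩⟩
  · have := H u
    rwa [min_eq_left hu.2, max_eq_right hu.1] at this
  · exact max_le (min_le_max) (min_le_right _ _)

/-- Continuity with respect to the tree distance, by compactness: otherwise the points that are `1 /
(n + 1)`-close to `a` and mapped outside `V` form decreasing nonempty compact sets. A common point
has tree distance zero from `a`, hence the same image as `a`, which lies in `V`. -/
theorem exists_heightClose_imp_mem {X : Type*} [TopologicalSpace X] {α : I → X}
    (hαc : Continuous α) {h : I → ℝ} (hc : Continuous h)
    (hα : ∀ s t, s ≤ t → h s = h t → (∀ u ∈ Icc s t, h s ≤ h u) → α s = α t)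
    (a : I) {V : Set X} (hV : IsOpen V) (ha : α a ∈ V) :
    ∃ ε > 0, ∀ b, HeightClose h ε a b → α b ∈ V := by
  by_contra! hcon
  let K : ℕ → Set I := fun n => α ⁻¹' Vᶜ ∩ {b | HeightClose h (1 / ((n : ℝ) + 1)) a b}
  have hKc : ∀ n, IsClosed (K n) := by
    intro n
    refine (hV.isClosed_compl.preimage hαc).inter ?_
    simp only [HeightClose, ofPred_forall]
    exact isClosed_iInter fun u => isClosed_le (by fun_prop) continuous_const
  have hne : (⋂ n, K n).Nonempty := by
    refine IsCompact.nonempty_iInter_of_sequence_nonempty_isCompact_isClosed K ?_ ?_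
      (hKc 0).isCompact hKc
    · rintro n b ⟨hb, hb'⟩
      refine ⟨hb, fun u => (hb' u).trans ?_⟩
      apply one_div_le_one_div_of_le (by positivity)
      push_cast; linarith
    · intro n
      obtain ⟨b, hb, hb'⟩ := hcon (1 / ((n : ℝ) + 1)) (by positivity)
      exact ⟨b, hb', hb⟩
  obtain ⟨b, hb⟩ := hne
  have hb' := fun n => mem_iInter.1 hb n
  have h0 : ∀ u ∈ uIcc a b, h a + h b ≤ 2 * h u := by
    intro u hu
    refine le_of_forall_pos_le_add fun ε hε => ?_
    obtain ⟨n, hn⟩ := exists_nat_one_div_lt hε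
    have := heightClose_iff.1 (hb' n).2 u hu
    linarith
  have e1 := h0 a left_mem_uIcc
  have e2 := h0 b right_mem_uIcc
  have key : α a = α b := by
    rcases le_total a b with hab | hab
    · refine hα a b hab (by linarith) fun u hu => ?_
      have := h0 u (by rwa [uIcc_of_le hab])
      linarith
    · refine (hα b a hab (by linarith) fun u hu => ?_).symm
      have := h0 u (by rwa [uIcc_of_ge hab])
      linarith
  exact (hb' 0).1 (key ▸ ha)

/-- The last time up to `t` at which the height is at most `r` represents the ancestor of `t` in the
tree at height `min r (h t)`: the path does not go below that height afterwards. -/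
theorem exists_last_le {h : I → ℝ} (hc : Continuous h) (h0 : h 0 = 0) {r : ℝ} (hr : 0 ≤ r)
    (t : I) :
    ∃ a ≤ t, h a = min r (h t) ∧ (∀ u ∈ Icc a t, h a ≤ h u) ∧ (t = 0 → a = 0) ∧
      (h t ≤ r → a = t) := by
  have hK : IsCompact {u | u ≤ t ∧ h u ≤ r} :=
    ((isClosed_le continuous_id continuous_const).inter
      (isClosed_le hc continuous_const)).isCompact
  obtain ⟨a, ⟨hat, har⟩, hmax⟩ := hK.exists_isGreatest ⟨0, bot_le, h0.trans_le hr⟩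
  by_cases ht : h t ≤ r
  · obtain rfl : a = t := le_antisymm hat (hmax ⟨le_rfl, ht⟩)
    refine ⟨a, le_rfl, (min_eq_right ht).symm, fun u hu => ?_, id, fun _ => rfl⟩
    rw [le_antisymm hu.1 hu.2]
  · push Not at ht
    have hra : h a = r := by
      obtain ⟨u, hu, hur⟩ := intermediate_value_Icc hat hc.continuousOn ⟨har, ht.le⟩
      rw [le_antisymm (hmax ⟨hu.2, hur.le⟩) hu.1] at hur
      exact hur
    refine ⟨a, hat, by rw [min_eq_left ht.le, hra], fun u hu => ?_, fun h' => ?_,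
      fun h' => absurd h' ht.not_ge⟩
    · by_contra! hlt
      have := le_antisymm (hmax ⟨hu.2, hlt.le.trans har⟩) hu.1
      rw [this] at hlt
      exact lt_irrefl _ hlt
    · rw [h'] at hat; exact le_antisymm hat bot_le

/-- Half of the estimate that truncating the tree does not increase distances much. For `u` between
the ancestors `a` and `a'`, either `u ≤ t`, and the path stays above the height of `a`, or `u` lies
between `t` and `t'`, and their closeness applies. -/
theorem height_add_sub_le {h : I → ℝ} {r r' ε : ℝ} {t t' a a' : I}
    (ha : h a = min r (h t)) (hat : ∀ u ∈ Icc a t, h a ≤ h u)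
    (ha' : h a' = min r' (h t')) (hat' : a' ≤ t')
    (hr : r' - r ≤ ε) (ht : h t' - h t ≤ ε) (htt : HeightClose h ε t t')
    {u : I} (hu : u ∈ Icc a a') : h a + h a' - 2 * h u ≤ ε := by
  rcases le_total u t with hut | hut
  · have h1 := hat u ⟨hu.1, hut⟩
    have h2 : h a' - h a ≤ ε := by
      rw [ha, ha']
      rcases min_choice r (h t) with e | e <;> rw [e]
      · linarith [min_le_left r' (h t')]
      · linarith [min_le_right r' (h t')]
    linarith
  · have h1 := heightClose_iff.1 htt u (by
      rw [uIcc_of_le (hut.trans (hu.2.trans hat'))]; exact ⟨hut, hu.2.trans hat'⟩)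
    have h2 : h a ≤ h t := ha ▸ min_le_right _ _
    have h3 : h a' ≤ h t' := ha' ▸ min_le_right _ _
    linarith

/-- A loop that factors through the tree coded by a height function is null-homotopic. -/
theorem Path.homotopic_refl_of_height {X : Type*} [TopologicalSpace X] {p : X} (α : Path p p)
    {h : I → ℝ} (hc : Continuous h) (h0 : h 0 = 0) (h1 : h 1 = 0) (hnn : ∀ t, 0 ≤ h t)
    (hα : ∀ s t, s ≤ t → h s = h t → (∀ u ∈ Icc s t, h s ≤ h u) → α s = α t) :
    α.Homotopic (Path.refl p) := by
  obtain ⟨R, hR⟩ : ∃ R, ∀ t, h t ≤ R := by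
    obtain ⟨R, hR⟩ := (isCompact_range hc).bddAbove
    exact ⟨R, fun t => hR (mem_range_self t)⟩
  have hR0 : 0 ≤ R := h0 ▸ hR 0
  have hr0 : ∀ s : I, 0 ≤ R * (1 - (s : ℝ)) := fun s =>
    mul_nonneg hR0 (sub_nonneg.2 s.2.2)
  -- At stage `s` every point of the tree is replaced by its ancestor at height at most `R (1 - s)`.
  -- The map `τ` itself may jump; only its composite with `α` is continuous, because jumps identify
  -- points at small tree distance.
  choose τ hτt hτh hτm hτ0 hτe using fun q : I × I => exists_last_le hc h0 (hr0 q.1) q.2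
  have hcont : Continuous fun q => α (τ q) := by
    rw [continuous_iff_continuousAt]
    rintro ⟨s, t⟩
    rw [ContinuousAt, tendsto_nhds]
    intro V hV haV
    obtain ⟨ε, hε, hεV⟩ := exists_heightClose_imp_mem α.continuous hc hα _ hV haV
    have hε4 : 0 < ε / 4 := by positivity
    obtain ⟨δ, hδ, hδh⟩ := Metric.continuous_iff.1 hc t (ε / 4) hε4
    have e1 : ∀ᶠ q : I × I in 𝓝 (s, t), dist q.2 t < δ :=
      (continuous_snd.dist continuous_const).continuousAt.eventually_lt_const (by simpa using hδ)
    have e2 : ∀ᶠ q : I × I in 𝓝 (s, t), |R * (1 - (q.1 : ℝ)) - R * (1 - (s : ℝ))| < ε := by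
      have : Continuous fun q : I × I => |R * (1 - (q.1 : ℝ)) - R * (1 - (s : ℝ))| := by fun_prop
      exact this.continuousAt.eventually_lt_const (by simpa using hε)
    filter_upwards [e1, e2] with q hq1 hq2
    refine hεV _ ?_
    -- The bound `ε / 4` makes both heights exceed any height in between by a total of at most `3ε /
    -- 4`, so `t` and the second component of `q` are `ε`-close in the tree.
    have hu : ∀ u ∈ uIcc t q.2, |h u - h t| < ε / 4 := by
      intro u hu
      refine hδh u (lt_of_le_of_lt ?_ hq1)
      rw [Subtype.dist_eq, Subtype.dist_eq, Real.dist_eq, Real.dist_eq]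
      exact abs_sub_left_of_mem_uIcc (by
        rcases le_total t q.2 with h' | h'
        · rw [uIcc_of_le h'] at hu
          rw [uIcc_of_le (Subtype.coe_le_coe.2 h')]
          exact hu
        · rw [uIcc_of_ge h'] at hu
          rw [uIcc_of_ge (Subtype.coe_le_coe.2 h')]
          exact hu)
    have hq := abs_lt.1 (hu q.2 right_mem_uIcc)
    have hcl : HeightClose h ε t q.2 := heightClose_iff.2 fun u hu' => by
      have := abs_lt.1 (hu u hu')
      linarith
    have hcl' : HeightClose h ε q.2 t := heightClose_iff.2 fun u hu' => by
      have := abs_lt.1 (hu u (by rwa [uIcc_comm]))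
      linarith
    have hq2' := abs_lt.1 hq2
    rw [heightClose_iff]
    intro u hu
    rcases le_total (τ (s, t)) (τ q) with h' | h'
    · rw [uIcc_of_le h'] at hu
      exact height_add_sub_le (hτh (s, t)) (hτm (s, t)) (hτh q)
        (hτt q) hq2'.2.le (by linarith) hcl hu
    · rw [uIcc_of_ge h'] at hu
      rw [add_comm (h _)]
      exact height_add_sub_le (hτh q) (hτm q) (hτh (s, t))
        (hτt (s, t)) (by simp only; linarith) (by simp only; linarith) hcl' hu
  refine ⟨{ toFun := fun q => α (τ q), continuous_toFun := hcont,
            map_zero_left := fun t => ?_, map_one_left := fun t => ?_, prop' := ?_ }⟩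
  · rw [hτe (0, t) (by simpa using hR t)]; rfl
  · have hh : h (τ (1, t)) = 0 := by
      rw [hτh]; simpa using hnn t
    rw [← hα 0 (τ (1, t)) bot_le (by rw [h0, hh]) (fun u _ => h0 ▸ hnn u)]
    simp
  · rintro s t (rfl | rfl)
    · change α (τ (s, 0)) = α 0
      rw [hτ0 (s, 0) rfl]
    · change α (τ (s, 1)) = α 1
      rw [hτe (s, 1) (by simpa [h1] using hr0 s)]

/-! ### Circle coordinates, a covering with free-group fibre, and holonomy. -/

/-- A family of circle-valued coordinates on `X` of which at most one differs from the base
point `-1` of the circle at each point of `X`, as on a Hawaiian earring. -/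
structure CircleCoords (X J : Type*) [TopologicalSpace X] where
  /-- the coordinates -/
  coord : J → X → Circle
  continuous_coord : ∀ j, Continuous (coord j)
  eq_or_eq : ∀ x i j, i ≠ j → coord i x = -1 ∨ coord j x = -1

theorem Circle.eq_one_or_eq_neg_one_of_im_eq_zero {u : Circle} (h : (u : ℂ).im = 0) :
    u = 1 ∨ u = -1 := by
  have h1 := Circle.normSq_coe u
  rw [Complex.normSq_apply, h] at h1
  have h2 : ((u : ℂ).re - 1) * ((u : ℂ).re + 1) = 0 := by linarith
  rcases mul_eq_zero.1 h2 with h3 | h3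
  · left; ext; apply Complex.ext <;> simp <;> linarith
  · right; ext; apply Complex.ext <;> simp <;> linarith

@[simp] theorem Circle.coe_neg_one' : ((-1 : Circle) : ℂ) = -1 := rfl

theorem Circle.neg_one_ne_one : (-1 : Circle) ≠ 1 := by
  intro h
  have := congrArg (fun u : Circle => (u : ℂ).re) h
  norm_num at this

theorem Circle.continuous_im : Continuous fun u : Circle => (u : ℂ).im :=
  Complex.continuous_im.comp continuous_subtype_val

theorem Circle.continuous_re : Continuous fun u : Circle => (u : ℂ).re :=
  Complex.continuous_re.comp continuous_subtype_val

namespace CircleCoords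

variable {X J : Type*} [TopologicalSpace X] (c : CircleCoords X J) (S : Finset J)

/-- The base points are those all of whose coordinates are trivial. -/
def IsBase (x : X) : Prop := ∀ j, c.coord j x = -1

/-- The set of points whose coordinates in `S` are not the midpoint of their circle. -/
def awayMid : Set X := {x | ∀ j ∈ S, c.coord j x ≠ 1}

/-- The set of points that lie in the interior of one of the circles in `S`. -/
def inside : Set X := {x | ∃ j ∈ S, c.coord j x ≠ -1}

open Classical in
/-- The generator of the circle in `S` whose lower (second) half contains `x`, or `1`. -/
noncomputable def jump (x : X) : FreeGroup J :=
  if h : ∃ j ∈ S, ((c.coord j x : Circle) : ℂ).im < 0 then FreeGroup.of h.choose else 1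

variable {c S}

theorem coord_eq_of_ne {x : X} {i j : J} (h : c.coord i x ≠ -1) (hij : j ≠ i) :
    c.coord j x = -1 :=
  (c.eq_or_eq x i j hij.symm).resolve_left h

theorem ne_of_im_neg {x : X} {j : J} (h : ((c.coord j x : Circle) : ℂ).im < 0) :
    c.coord j x ≠ -1 := by
  intro h'; rw [h'] at h; simp at h

theorem jump_of_neg {x : X} {j : J} (hj : j ∈ S) (h : ((c.coord j x : Circle) : ℂ).im < 0) :
    c.jump S x = FreeGroup.of j := by
  have h' : ∃ j ∈ S, ((c.coord j x : Circle) : ℂ).im < 0 := ⟨j, hj, h⟩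
  rw [jump, dif_pos h']
  congr 1
  by_contra hne
  exact ne_of_im_neg h'.choose_spec.2 (coord_eq_of_ne (ne_of_im_neg h) hne)

theorem jump_of_forall {x : X} (h : ∀ j ∈ S, 0 ≤ ((c.coord j x : Circle) : ℂ).im) :
    c.jump S x = 1 := by
  rw [jump, dif_neg]
  push Not
  exact h

theorem jump_of_nonneg {x : X} {j : J} (h : c.coord j x ≠ -1)
    (h0 : 0 ≤ ((c.coord j x : Circle) : ℂ).im) : c.jump S x = 1 := by
  refine jump_of_forall fun i _ => ?_
  by_cases hij : i = j
  · rwa [hij]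
  · rw [coord_eq_of_ne h hij]; simp

theorem jump_of_notMem_inside {x : X} (h : x ∉ c.inside S) : c.jump S x = 1 := by
  refine jump_of_forall fun i hi => ?_
  have : c.coord i x = -1 := by
    by_contra h'
    exact h ⟨i, hi, h'⟩
  rw [this]; simp

theorem IsBase.notMem_inside {x : X} (h : c.IsBase x) : x ∉ c.inside S := by
  rintro ⟨j, _, hj⟩
  exact hj (h j)

theorem IsBase.jump {x : X} (h : c.IsBase x) : c.jump S x = 1 :=
  jump_of_notMem_inside h.notMem_inside

theorem mem_awayMid_of_notMem_inside {x : X} (h : x ∉ c.inside S) : x ∈ c.awayMid S := by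
  intro j hj h1
  refine h ⟨j, hj, ?_⟩
  rw [h1]
  exact Circle.neg_one_ne_one.symm

theorem IsBase.mem_awayMid {x : X} (h : c.IsBase x) : x ∈ c.awayMid S :=
  mem_awayMid_of_notMem_inside h.notMem_inside

variable (c S)

theorem isOpen_awayMid : IsOpen (c.awayMid S) := by
  have : c.awayMid S = ⋂ j ∈ S, {x | c.coord j x ≠ 1} := by ext; simp [awayMid]
  rw [this]
  exact isOpen_biInter_finset fun j _ => isOpen_ne_fun (c.continuous_coord j) continuous_const

theorem isOpen_inside : IsOpen (c.inside S) := by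
  have : c.inside S = ⋃ j ∈ S, {x | c.coord j x ≠ -1} := by ext; simp [inside]
  rw [this]
  exact isOpen_biUnion fun j _ => isOpen_ne_fun (c.continuous_coord j) continuous_const

variable {c S}

theorem eventually_im_pos {x : X} {j : J} (h : 0 < ((c.coord j x : Circle) : ℂ).im) :
    ∀ᶠ y in 𝓝 x, 0 < ((c.coord j y : Circle) : ℂ).im :=
  (Circle.continuous_im.comp (c.continuous_coord j)).continuousAt.eventually_const_lt h

theorem eventually_im_neg {x : X} {j : J} (h : ((c.coord j x : Circle) : ℂ).im < 0) :
    ∀ᶠ y in 𝓝 x, ((c.coord j y : Circle) : ℂ).im < 0 :=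
  (Circle.continuous_im.comp (c.continuous_coord j)).continuousAt.eventually_lt_const h

/-- A circle passes from its first half to its second only at `1` and `-1`, and both points are
excluded on the overlap of the two open sets. Hence `jump` can serve as the transition function of a
covering. -/
theorem eventually_jump_eq {x : X} (h0 : x ∈ c.awayMid S) (h1 : x ∈ c.inside S) :
    ∀ᶠ y in 𝓝 x, c.jump S y = c.jump S x := by
  obtain ⟨j, hj, hjx⟩ := h1
  rcases lt_trichotomy ((c.coord j x : Circle) : ℂ).im 0 with h | h | h
  · filter_upwards [eventually_im_neg h] with y hy
    rw [jump_of_neg hj h, jump_of_neg hj hy]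
  · rcases Circle.eq_one_or_eq_neg_one_of_im_eq_zero h with h' | h'
    · exact absurd h' (h0 j hj)
    · exact absurd h' hjx
  · filter_upwards [eventually_im_pos h] with y hy
    have : c.coord j y ≠ -1 := by
      intro h'; rw [h'] at hy; simp at hy
    rw [jump_of_nonneg hjx h.le, jump_of_nonneg this hy.le]

/-- `g` describes a lift of `f` to the covering of `X` with fibre the free group on `J` in which
the circle `j ∈ S` lifts to a path from each `v` to `v * j`, and the other circles lift to loops:
`g y` is the initial vertex of the edge that contains the lift of `f y`. -/
def Horizontal (c : CircleCoords X J) (S : Finset J) {Y : Type*} [TopologicalSpace Y]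
    (f : Y → X) (g : Y → FreeGroup J) : Prop :=
  ∀ y, (f y ∈ c.awayMid S → ∀ᶠ z in 𝓝 y, g z * c.jump S (f z) = g y * c.jump S (f y)) ∧
    (f y ∈ c.inside S → ∀ᶠ z in 𝓝 y, g z = g y)

open Classical in
/-- The covering of `X` described in `Horizontal`, as a fibre bundle. -/
noncomputable def bundleCore (c : CircleCoords X J) (S : Finset J)
    [TopologicalSpace (FreeGroup J)] [DiscreteTopology (FreeGroup J)] :
    FiberBundleCore Bool X (FreeGroup J) where
  baseSet i := if i then c.inside S else c.awayMid S
  isOpen_baseSet i := by cases i <;> simp [isOpen_awayMid, isOpen_inside]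
  indexAt x := decide (x ∈ c.inside S)
  mem_baseSet_at x := by
    by_cases h : x ∈ c.inside S
    · simp [h]
    · simpa [h] using mem_awayMid_of_notMem_inside h
  -- The chart `true` labels a point over a circle by the initial vertex of its edge, the chart
  -- `false` by the nearest vertex; the latter label is the former times `jump`.
  coordChange i j x v :=
    v * (if i then 1 else (c.jump S x)⁻¹) * (if j then 1 else c.jump S x)
  coordChange_self i x _ v := by cases i <;> simp
  continuousOn_coordChange i j := by
    have key : ContinuousOn (fun p : X × FreeGroup J => c.jump S p.1)
        ((c.awayMid S ∩ c.inside S) ×ˢ univ) := by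
      rintro ⟨x, v⟩ ⟨⟨h0, h1⟩, -⟩
      refine ContinuousAt.continuousWithinAt ?_
      refine ContinuousAt.comp (g := c.jump S) (f := Prod.fst) ?_ continuousAt_fst
      rw [ContinuousAt, nhds_discrete (FreeGroup J), tendsto_pure]
      exact eventually_jump_eq h0 h1
    have hm : Continuous fun p : FreeGroup J × FreeGroup J => p.1 * p.2 :=
      continuous_of_discreteTopology
    have hm' : Continuous fun p : FreeGroup J × FreeGroup J => p.1 * p.2⁻¹ :=
      continuous_of_discreteTopology
    cases i <;> cases j
    · simpa using continuous_snd.continuousOn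
    · simp only [Bool.false_eq_true, if_false, if_true, mul_one]
      exact hm'.comp_continuousOn (continuous_snd.continuousOn.prodMk key)
    · simp only [Bool.false_eq_true, if_false, if_true, mul_one]
      exact hm.comp_continuousOn (continuous_snd.continuousOn.prodMk (by rwa [inter_comm]))
    · simpa using continuous_snd.continuousOn
  coordChange_comp i j k x _ v := by
    cases i <;> cases j <;> cases k <;> simp

/-- The fibre is discrete, so a continuous map has locally constant labels in each of the two
charts; these are the two conditions of `Horizontal`. The fibre coordinate is the label of the chart
`true`, also off the interiors of the circles, since `jump` is trivial there. -/
theorem horizontal_of_continuous [TopologicalSpace (FreeGroup J)]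
    [DiscreteTopology (FreeGroup J)] {Y : Type*} [TopologicalSpace Y]
    {L : Y → (c.bundleCore S).TotalSpace} (hL : Continuous L) :
    c.Horizontal S (fun y => (L y).1) (fun y => (L y).2) := by
  have key : ∀ (i : Bool) (y : Y), (L y).1 ∈ (c.bundleCore S).baseSet i →
      ∀ᶠ z in 𝓝 y, ((c.bundleCore S).localTriv i (L z)).2 =
        ((c.bundleCore S).localTriv i (L y)).2 := by
    intro i y hy
    have h1 : ContinuousAt ((c.bundleCore S).localTriv i) (L y) :=
      ((c.bundleCore S).localTriv i).continuousAt
        (((c.bundleCore S).mem_localTriv_source i (L y)).2 hy)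
    have h2 : ContinuousAt (fun z => ((c.bundleCore S).localTriv i (L z)).2) y :=
      continuousAt_snd.comp (h1.comp hL.continuousAt)
    rwa [ContinuousAt, nhds_discrete (FreeGroup J), tendsto_pure] at h2
  have hfalse : ∀ z, ((c.bundleCore S).localTriv false (L z)).2 =
      (show FreeGroup J from (L z).2) * c.jump S (L z).1 := by
    intro z
    rw [FiberBundleCore.localTriv_apply]
    by_cases h : (L z).1 ∈ c.inside S
    · simp [bundleCore, h]
    · simp [bundleCore, h, jump_of_notMem_inside h]
      exact (mul_one (M := FreeGroup J) _).symm
  have htrue : ∀ z, (L z).1 ∈ c.inside S →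
      ((c.bundleCore S).localTriv true (L z)).2 = (L z).2 := by
    intro z h
    rw [FiberBundleCore.localTriv_apply]
    simp [bundleCore, h]
    rfl
  have hproj : Continuous fun y => (L y).1 := (c.bundleCore S).continuous_proj.comp hL
  refine fun y => ⟨fun hy => ?_, fun hy => ?_⟩
  · filter_upwards [key false y hy] with z hz
    rwa [hfalse, hfalse] at hz
  · filter_upwards [key true y hy,
      hproj.continuousAt.eventually_mem ((c.isOpen_inside S).mem_nhds hy)] with z hz hz'
    rwa [htrue z hz', htrue y hy] at hz

/-- Existence of horizontal lifts of families of paths with a common starting point. -/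
theorem exists_horizontal {A : Type*} [TopologicalSpace A] {f : I × A → X} (hf : Continuous f)
    {p : X} (hfp : ∀ a, f (0, a) = p) :
    ∃ g, c.Horizontal S f g ∧ ∀ a, g (0, a) = 1 := by
  let : TopologicalSpace (FreeGroup J) := ⊥
  have : DiscreteTopology (FreeGroup J) := ⟨rfl⟩
  let Z := c.bundleCore S
  have cov : IsCoveringMap Z.proj := FiberBundle.isCoveringMap
  let e : Z.TotalSpace := ⟨p, (1 : FreeGroup J)⟩
  let L := cov.liftHomotopy ⟨f, hf⟩ (.const A e) hfp
  have hL : ∀ y, (L y).1 = f y := fun y =>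
    congrFun (cov.liftHomotopy_lifts ⟨f, hf⟩ (.const A e) hfp) y
  refine ⟨fun y => (L y).2, ?_, fun a => ?_⟩
  · have h := horizontal_of_continuous L.continuous
    simpa only [hL] using h
  · have h : L (0, a) = e := cov.liftHomotopy_zero ⟨f, hf⟩ (.const A e) hfp a
    change (show FreeGroup J from (L (0, a)).2) = 1
    rw [h]

/-- Transition functions multiply on the right, so two lifts of one map differ by a locally constant
left factor: a deck transformation. -/
theorem Horizontal.eventually_mul_inv_eq {Y : Type*} [TopologicalSpace Y] {f : Y → X}
    {g g' : Y → FreeGroup J} (hg : c.Horizontal S f g) (hg' : c.Horizontal S f g') (y : Y) :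
    ∀ᶠ z in 𝓝 y, g' z * (g z)⁻¹ = g' y * (g y)⁻¹ := by
  by_cases h : f y ∈ c.inside S
  · filter_upwards [(hg y).2 h, (hg' y).2 h] with z h1 h2
    rw [h1, h2]
  · have h0 := mem_awayMid_of_notMem_inside h
    filter_upwards [(hg y).1 h0, (hg' y).1 h0] with z h1 h2
    calc g' z * (g z)⁻¹ = (g' z * c.jump S (f z)) * (g z * c.jump S (f z))⁻¹ := by group
      _ = g' y * (g y)⁻¹ := by rw [h1, h2]; group

theorem Horizontal.eq_of_eq {Y : Type*} [TopologicalSpace Y] [PreconnectedSpace Y] {f : Y → X}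
    {g g' : Y → FreeGroup J} (hg : c.Horizontal S f g) (hg' : c.Horizontal S f g')
    {y : Y} (hy : g y = g' y) : g = g' := by
  have hlc : IsLocallyConstant fun z => g' z * (g z)⁻¹ :=
    (IsLocallyConstant.iff_eventually_eq _).2 (hg.eventually_mul_inv_eq hg')
  funext z
  have := hlc.apply_eq_of_preconnectedSpace z y
  rw [hy, mul_inv_cancel, mul_inv_eq_one] at this
  exact this.symm

theorem Horizontal.comp {Y Z : Type*} [TopologicalSpace Y] [TopologicalSpace Z] {f : Y → X}
    {g : Y → FreeGroup J} (hg : c.Horizontal S f g) {k : Z → Y} (hk : Continuous k) :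
    c.Horizontal S (fun z => f (k z)) (fun z => g (k z)) := fun z =>
  ⟨fun h => hk.continuousAt.eventually ((hg (k z)).1 h),
    fun h => hk.continuousAt.eventually ((hg (k z)).2 h)⟩

variable (c S) in
open Classical in
/-- The holonomy of a loop at a base point: the word of its crossings of the circles in `S`. -/
noncomputable def hol (f : I → X) : FreeGroup J :=
  -- For continuous `f` the default value does not occur, by `exists_horizontal_path`; the choice of
  -- `g` is irrelevant by uniqueness of lifts.
  if h : ∃ g, c.Horizontal S f g ∧ g 0 = 1 then h.choose 1 else 1

theorem Horizontal.hol_eq {f : I → X} {g : I → FreeGroup J} (hg : c.Horizontal S f g)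
    (h0 : g 0 = 1) : c.hol S f = g 1 := by
  have h : ∃ g, c.Horizontal S f g ∧ g 0 = 1 := ⟨g, hg, h0⟩
  rw [hol, dif_pos h]
  exact congrFun (h.choose_spec.1.eq_of_eq hg (y := 0) (h.choose_spec.2.trans h0.symm)) 1

theorem exists_horizontal_path {f : I → X} (hf : Continuous f) :
    ∃ g, c.Horizontal S f g ∧ g 0 = 1 := by
  obtain ⟨g, hg, hg0⟩ := exists_horizontal (S := S) (A := Unit)
    (f := fun q : I × Unit => f q.1) (p := f 0) (hf.comp continuous_fst) (fun _ => rfl)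
  exact ⟨fun t => g (t, ()), hg.comp (k := fun t : I => (t, ())) (by fun_prop), hg0 ()⟩

/-- One lift of the whole family restricts to a lift of each member. At time `1` the family sits at
a base point, where `jump` is trivial, so the final label is locally constant in the parameter. The
parameter space is arbitrary so that it can be a set of loops. -/
theorem eventually_hol_eq {A : Type*} [TopologicalSpace A] {f : I × A → X} (hf : Continuous f)
    {p : X} (hp : c.IsBase p) (hf0 : ∀ a, f (0, a) = p) (hf1 : ∀ a, f (1, a) = p) (a : A) :
    ∀ᶠ b in 𝓝 a, c.hol S (fun t => f (t, b)) = c.hol S (fun t => f (t, a)) := by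
  obtain ⟨g, hg, hg0⟩ := exists_horizontal (S := S) hf hf0
  have hhol : ∀ b, c.hol S (fun t => f (t, b)) = g (1, b) := fun b =>
    Horizontal.hol_eq (hg.comp (k := fun t : I => (t, b)) (by fun_prop)) (hg0 b)
  have h1 : f (1, a) ∈ c.awayMid S := by rw [hf1]; exact hp.mem_awayMid
  have h2 : ContinuousAt (fun b : A => ((1 : I), b)) a := by fun_prop
  filter_upwards [h2.eventually ((hg (1, a)).1 h1)] with b hb
  rw [hhol, hhol]
  simpa only [hf1, hp.jump, mul_one] using hb

theorem hol_const (p : X) : c.hol S (fun _ => p) = 1 := by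
  have : c.Horizontal S (fun _ : I => p) (fun _ => 1) := fun y =>
    ⟨fun _ => .of_forall fun _ => rfl, fun _ => .of_forall fun _ => rfl⟩
  exact this.hol_eq rfl

theorem hol_eq_of_homotopic {p : X} (hp : c.IsBase p) {α β : Path p p} (h : α.Homotopic β) :
    c.hol S α = c.hol S β := by
  obtain ⟨F⟩ := h
  have hlc : IsLocallyConstant fun s : I => c.hol S (fun t => F (s, t)) := by
    refine (IsLocallyConstant.iff_eventually_eq _).2 fun s => ?_
    exact eventually_hol_eq (f := fun q : I × I => F (q.2, q.1)) (by fun_prop) hp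
      (fun a => by simp) (fun a => by simp) s
  have := hlc.apply_eq_of_preconnectedSpace 0 1
  simpa using this

theorem hol_eq_one_of_homotopic {p : X} (hp : c.IsBase p) {α : Path p p}
    (h : α.Homotopic (Path.refl p)) : c.hol S α = 1 :=
  (hol_eq_of_homotopic hp h).trans (hol_const p)

end CircleCoords

/-! ### Reduced words and their weights. -/

/-- Multiplying by a generator either appends a letter to the reduced word or deletes one. -/
theorem FreeGroup.toWord_mul_of {J : Type*} [DecidableEq J] (g : FreeGroup J) (j : J) :
    (g * FreeGroup.of j).toWord = g.toWord ++ [(j, true)] ∨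
      g.toWord = (g * FreeGroup.of j).toWord ++ [(j, false)] := by
  have hred : FreeGroup.IsReduced g.toWord := FreeGroup.isReduced_toWord
  rcases List.eq_nil_or_concat g.toWord with h | ⟨W, l, h⟩
  · left
    rw [FreeGroup.toWord_eq_nil_iff] at h
    simp [h]
  · rw [List.concat_eq_append] at h
    by_cases hl : l = (j, false)
    · right
      have hW : FreeGroup.IsReduced W := by
        rw [h] at hred
        exact hred.infix (List.prefix_append _ _).isInfix
      have hg : g * FreeGroup.of j = FreeGroup.mk W := by
        rw [← FreeGroup.mk_toWord (x := g), h, hl, FreeGroup.of, FreeGroup.mul_mk]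
        refine Quot.sound ?_
        rw [List.append_assoc]
        have := FreeGroup.Red.Step.not (L₁ := W) (L₂ := []) (x := j) (b := false)
        simpa using this
      rw [hg, FreeGroup.toWord_mk, hW.reduce_eq, h, hl]
    · left
      rw [FreeGroup.toWord_mul, FreeGroup.toWord_of]
      refine FreeGroup.IsReduced.reduce_eq ?_
      rw [FreeGroup.IsReduced, List.isChain_append]
      refine ⟨hred, List.isChain_singleton _, ?_⟩
      intro x hx y hy h1
      rw [h] at hx
      simp only [List.getLast?_append, List.getLast?_singleton, Option.some_or,
        Option.mem_def, Option.some.injEq, List.head?_cons] at hx hy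
      subst hx hy
      obtain ⟨i, b⟩ := l
      cases b
      · exact absurd (by simpa using h1) hl
      · rfl

/-- The length of a word whose letters have the weights `w`. -/
def wordWeight {J : Type*} (w : J → ℝ) (L : List (J × Bool)) : ℝ :=
  (L.map fun l => w l.1).sum

@[simp] theorem wordWeight_nil {J : Type*} (w : J → ℝ) : wordWeight w [] = 0 := rfl

theorem wordWeight_append_singleton {J : Type*} (w : J → ℝ) (L : List (J × Bool))
    (l : J × Bool) : wordWeight w (L ++ [l]) = wordWeight w L + w l.1 := by
  simp [wordWeight]

theorem wordWeight_nonneg {J : Type*} {w : J → ℝ} (hw : ∀ j, 0 ≤ w j) (L : List (J × Bool)) :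
    0 ≤ wordWeight w L := by
  refine List.sum_nonneg ?_
  simp only [List.mem_map]
  rintro _ ⟨l, _, rfl⟩
  exact hw _

theorem wordWeight_le_of_prefix {J : Type*} {w : J → ℝ} (hw : ∀ j, 0 ≤ w j)
    {L L' : List (J × Bool)} (h : L <+: L') : wordWeight w L ≤ wordWeight w L' := by
  obtain ⟨M, rfl⟩ := h
  have := wordWeight_nonneg hw M
  simp only [wordWeight, List.map_append, List.sum_append] at this ⊢
  linarith

theorem wordWeight_sum {J : Type*} [DecidableEq J] (S : Finset J) (w : J → ℝ)
    (L : List (J × Bool)) :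
    wordWeight (fun j => if j ∈ S then w j else 0) L =
      ∑ j ∈ S, w j * wordWeight (fun i => if i = j then 1 else 0) L := by
  induction L with
  | nil => simp
  | cons l L ih =>
    simp only [wordWeight, List.map_cons, List.sum_cons, mul_add, Finset.sum_add_distrib] at ih ⊢
    rw [ih]
    simp

/-! ### Depth and position on the unit circle. -/

/-- Half the normalised distance from the base point `-1` of the circle. -/
noncomputable def circleDepth (u : Circle) : ℝ := (1 + (u : ℂ).re) / 4

/-- The position on the unit circle, traversed clockwise from `-1`, as a number in `[0, 1)`. -/
noncomputable def circlePos (u : Circle) : ℝ :=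
  if 0 ≤ (u : ℂ).im then circleDepth u else 1 - circleDepth u

theorem continuous_circleDepth : Continuous circleDepth :=
  (continuous_const.add Circle.continuous_re).div_const _

theorem Circle.re_sq_add_im_sq (u : Circle) : (u : ℂ).re ^ 2 + (u : ℂ).im ^ 2 = 1 := by
  have h1 := Circle.normSq_coe u
  rw [Complex.normSq_apply] at h1
  linarith

theorem Circle.eq_neg_one_of_re {u : Circle} (h : (u : ℂ).re = -1) : u = -1 := by
  have h1 := u.re_sq_add_im_sq
  rw [h] at h1
  have h2 : (u : ℂ).im = 0 := by nlinarith
  ext; apply Complex.ext <;> simp [h, h2]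

@[simp] theorem circleDepth_neg_one : circleDepth (-1) = 0 := by simp [circleDepth]
@[simp] theorem circlePos_neg_one : circlePos (-1) = 0 := by simp [circlePos]

theorem circleDepth_nonneg (u : Circle) : 0 ≤ circleDepth u := by
  have := u.re_sq_add_im_sq
  rw [circleDepth]
  nlinarith [sq_nonneg ((u : ℂ).im)]

theorem circleDepth_le (u : Circle) : circleDepth u ≤ 1 / 2 := by
  have := u.re_sq_add_im_sq
  rw [circleDepth]
  nlinarith [sq_nonneg ((u : ℂ).im)]

theorem circleDepth_pos {u : Circle} (hu : u ≠ -1) : 0 < circleDepth u := by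
  refine (circleDepth_nonneg u).lt_of_ne fun h => hu (Circle.eq_neg_one_of_re ?_)
  rw [circleDepth] at h
  linarith

theorem circlePos_pos {u : Circle} (hu : u ≠ -1) : 0 < circlePos u := by
  have := circleDepth_pos hu
  have := circleDepth_le u
  rw [circlePos]; split_ifs <;> linarith

theorem circlePos_lt_one (u : Circle) : circlePos u < 1 := by
  have h2 := circleDepth_le u
  rw [circlePos]; split_ifs with h
  · linarith
  · have : u ≠ -1 := by rintro rfl; simp at h
    have := circleDepth_pos this
    linarith

theorem circleDepth_le_circlePos (u : Circle) : circleDepth u ≤ circlePos u := by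
  have := circleDepth_le u
  rw [circlePos]; split_ifs <;> linarith

theorem circleDepth_le_one_sub_circlePos (u : Circle) : circleDepth u ≤ 1 - circlePos u := by
  have := circleDepth_le u
  rw [circlePos]; split_ifs <;> linarith

theorem circlePos_injective : Function.Injective circlePos := by
  intro u v h
  have hu := u.re_sq_add_im_sq
  have hv := v.re_sq_add_im_sq
  have h1 := circleDepth_le u
  have h2 := circleDepth_le v
  have key : (u : ℂ).re = (v : ℂ).re ∧ 0 ≤ (u : ℂ).im * (v : ℂ).im := by
    simp only [circlePos, circleDepth] at h h1 h2
    split_ifs at h with a b b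
    · exact ⟨by linarith, mul_nonneg a b⟩
    · have e1 : (u : ℂ).re = 1 := by linarith
      have e2 : (v : ℂ).re = 1 := by linarith
      exact ⟨e1.trans e2.symm, by nlinarith⟩
    · have e1 : (u : ℂ).re = 1 := by linarith
      have e2 : (v : ℂ).re = 1 := by linarith
      exact ⟨e1.trans e2.symm, by nlinarith⟩
    · exact ⟨by linarith, mul_nonneg_of_nonpos_of_nonpos (not_le.1 a).le (not_le.1 b).le⟩
  have him : (u : ℂ).im = (v : ℂ).im := by
    have h3 : (u : ℂ).im ^ 2 = (v : ℂ).im ^ 2 := by rw [key.1] at hu; linarith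
    rcases sq_eq_sq_iff_eq_or_eq_neg.1 h3 with h4 | h4
    · exact h4
    · have h5 := key.2
      rw [h4] at h5 ⊢
      nlinarith
  ext; exact Complex.ext key.1 him

theorem continuousAt_circlePos {u : Circle} (hu : u ≠ -1) : ContinuousAt circlePos u := by
  rcases lt_trichotomy (u : ℂ).im 0 with h | h | h
  · refine ((continuous_const (y := (1 : ℝ))).sub continuous_circleDepth).continuousAt.congr ?_
    filter_upwards [Circle.continuous_im.continuousAt.eventually_lt_const h] with v hv
    rw [circlePos, if_neg hv.not_ge]; rfl
  · have h1 : u = 1 := (Circle.eq_one_or_eq_neg_one_of_im_eq_zero h).resolve_right hu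
    have h2 : circlePos u = 1 / 2 := by
      rw [h1]; norm_num [circlePos, circleDepth]
    have h3 : Tendsto circleDepth (𝓝 u) (𝓝 (1 / 2)) := by
      have := continuous_circleDepth.continuousAt (x := u)
      rwa [ContinuousAt, show circleDepth u = 1 / 2 by rw [h1]; norm_num [circleDepth]] at this
    have h4 : Tendsto (fun v => 1 - circleDepth v) (𝓝 u) (𝓝 (1 / 2)) := by
      have := (tendsto_const_nhds (x := (1 : ℝ))).sub h3
      norm_num at this ⊢
      exact this
    rw [ContinuousAt, h2]
    unfold circlePos
    exact Tendsto.if' h3 h4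
  · refine continuous_circleDepth.continuousAt.congr ?_
    filter_upwards [Circle.continuous_im.continuousAt.eventually_const_lt h] with v hv
    rw [circlePos, if_pos hv.le]

/-! ### Interpolated functions on the tree of the free group. -/

namespace CircleCoords

variable {X J : Type*} [TopologicalSpace X] {c : CircleCoords X J} {S : Finset J}

/-- The extension of a function on the vertices of the tree `FreeGroup J` to the edges, at the
point that lies over `x` on the edge with initial vertex `g`. -/
noncomputable def interp (c : CircleCoords X J) (S : Finset J) (F : FreeGroup J → ℝ) (x : X)
    (g : FreeGroup J) : ℝ :=
  F g + ∑ j ∈ S, circlePos (c.coord j x) * (F (g * FreeGroup.of j) - F g)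

theorem interp_of_mem {x : X} {j : J} (hj : j ∈ S) (h : c.coord j x ≠ -1)
    (F : FreeGroup J → ℝ) (g : FreeGroup J) :
    c.interp S F x g = F g + circlePos (c.coord j x) * (F (g * FreeGroup.of j) - F g) := by
  rw [interp, Finset.sum_eq_single_of_mem j hj]
  intro i _ hij
  rw [coord_eq_of_ne h hij, circlePos_neg_one, zero_mul]

theorem interp_of_notMem {x : X} (h : x ∉ c.inside S) (F : FreeGroup J → ℝ) (g : FreeGroup J) :
    c.interp S F x g = F g := by
  rw [interp, Finset.sum_eq_zero, add_zero]
  intro i hi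
  have : c.coord i x = -1 := by
    by_contra h'
    exact h ⟨i, hi, h'⟩
  rw [this, circlePos_neg_one, zero_mul]

theorem exists_neg_or_jump (x : X) :
    (∃ j ∈ S, ((c.coord j x : Circle) : ℂ).im < 0) ∨
      ((∀ j ∈ S, 0 ≤ ((c.coord j x : Circle) : ℂ).im) ∧ c.jump S x = 1) := by
  by_cases h : ∃ j ∈ S, ((c.coord j x : Circle) : ℂ).im < 0
  · exact Or.inl h
  · push Not at h
    exact Or.inr ⟨h, jump_of_forall h⟩

/-- A point near the vertex `g₀` lies in the first half of an edge leaving `g₀` or in the second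
half of an edge entering it, and the interpolated value deviates from `F g₀` by its depth times the
difference along that edge. The sum over `S` covers all edges at once and gives a bound that is
continuous and vanishes at the vertex. -/
theorem abs_interp_sub_le {x : X} {g g₀ : FreeGroup J} (hg : g * c.jump S x = g₀)
    (F : FreeGroup J → ℝ) :
    |c.interp S F x g - F g₀| ≤ ∑ j ∈ S, circleDepth (c.coord j x) *
      (|F (g₀ * FreeGroup.of j) - F g₀| + |F (g₀ * (FreeGroup.of j)⁻¹) - F g₀|) := by
  rcases exists_neg_or_jump (c := c) (S := S) x with ⟨j, hj, hneg⟩ | ⟨hnn, hjump⟩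
  · have hne := ne_of_im_neg hneg
    rw [jump_of_neg hj hneg] at hg
    have hg' : g = g₀ * (FreeGroup.of j)⁻¹ := by rw [← hg]; group
    have h1 : c.interp S F x g - F g₀ =
        circleDepth (c.coord j x) * (F (g₀ * (FreeGroup.of j)⁻¹) - F g₀) := by
      rw [interp_of_mem hj hne, hg, ← hg', circlePos, if_neg hneg.not_ge]
      ring
    rw [h1, abs_mul, abs_of_nonneg (circleDepth_nonneg _)]
    refine le_trans ?_ (Finset.single_le_sum (f := fun j => circleDepth (c.coord j x) *
      (|F (g₀ * FreeGroup.of j) - F g₀| + |F (g₀ * (FreeGroup.of j)⁻¹) - F g₀|))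
      (fun i _ => mul_nonneg (circleDepth_nonneg _) (by positivity)) hj)
    exact mul_le_mul_of_nonneg_left (le_add_of_nonneg_left (abs_nonneg _)) (circleDepth_nonneg _)
  · rw [hjump, mul_one] at hg
    subst hg
    rw [interp, add_sub_cancel_left]
    refine (Finset.abs_sum_le_sum_abs _ _).trans (Finset.sum_le_sum fun i hi => ?_)
    rw [abs_mul, circlePos, if_pos (hnn i hi), abs_of_nonneg (circleDepth_nonneg _)]
    exact mul_le_mul_of_nonneg_left (le_add_of_nonneg_right (abs_nonneg _)) (circleDepth_nonneg _)

/-- In the interior of a circle in `S` the label is locally constant and the position is continuous.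
Elsewhere the position jumps between `0` and `1`, and `abs_interp_sub_le` squeezes the values to
that at the vertex. -/
theorem Horizontal.continuous_interp {Y : Type*} [TopologicalSpace Y] {f : Y → X}
    (hf : Continuous f) {g : Y → FreeGroup J} (hg : c.Horizontal S f g) (F : FreeGroup J → ℝ) :
    Continuous fun y => c.interp S F (f y) (g y) := by
  rw [continuous_iff_continuousAt]
  intro y
  by_cases h : f y ∈ c.inside S
  · obtain ⟨j, hj, hjy⟩ := id h
    have h1 : ContinuousAt (fun z => F (g y) + circlePos (c.coord j (f z)) *
        (F (g y * FreeGroup.of j) - F (g y))) y := by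
      refine continuousAt_const.add (ContinuousAt.mul ?_ continuousAt_const)
      exact ContinuousAt.comp (f := fun z => c.coord j (f z)) (continuousAt_circlePos hjy)
        ((c.continuous_coord j).comp hf).continuousAt
    refine h1.congr ?_
    filter_upwards [(hg y).2 h, ((c.continuous_coord j).comp hf).continuousAt.eventually_ne hjy]
      with z hz hz'
    rw [interp_of_mem hj hz', hz]
  · have h0 := mem_awayMid_of_notMem_inside h
    have hj : c.jump S (f y) = 1 := jump_of_notMem_inside h
    rw [ContinuousAt, interp_of_notMem h, tendsto_iff_dist_tendsto_zero]
    refine squeeze_zero' (.of_forall fun _ => dist_nonneg)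
      (g := fun z => ∑ j ∈ S, circleDepth (c.coord j (f z)) * (|F (g y * FreeGroup.of j) - F (g y)|
        + |F (g y * (FreeGroup.of j)⁻¹) - F (g y)|)) ?_ ?_
    · filter_upwards [(hg y).1 h0] with z hz
      rw [hj, mul_one] at hz
      exact abs_interp_sub_le hz F
    · have h1 : Continuous fun z => ∑ j ∈ S, circleDepth (c.coord j (f z)) *
          (|F (g y * FreeGroup.of j) - F (g y)|
            + |F (g y * (FreeGroup.of j)⁻¹) - F (g y)|) :=
        continuous_finsetSum _ fun j _ =>
          (continuous_circleDepth.comp ((c.continuous_coord j).comp hf)).mul continuous_const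
      have h2 := h1.tendsto y
      rwa [Finset.sum_eq_zero (s := S)] at h2
      intro j hj
      have : c.coord j (f y) = -1 := by
        by_contra h'
        exact h ⟨j, hj, h'⟩
      rw [this, circleDepth_neg_one, zero_mul]

variable [DecidableEq J]

/-- In terms of reduced words, an edge joins a word to the same word with one more letter. -/
theorem exists_interp_eq {x : X} {j : J} (hj : j ∈ S) (h : c.coord j x ≠ -1)
    (g : FreeGroup J) : ∃ (Z : List (J × Bool)) (b : Bool),
      ∀ F : List (J × Bool) → ℝ, c.interp S (fun g => F g.toWord) x g =
        F Z + (if b then circlePos (c.coord j x) else 1 - circlePos (c.coord j x)) *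
          (F (Z ++ [(j, b)]) - F Z) := by
  rcases FreeGroup.toWord_mul_of g j with h1 | h1
  · refine ⟨g.toWord, true, fun F => ?_⟩
    rw [interp_of_mem hj h, ← h1, if_pos rfl]
  · refine ⟨(g * FreeGroup.of j).toWord, false, fun F => ?_⟩
    rw [interp_of_mem hj h, ← h1, if_neg (by simp)]
    ring

open Classical in
/-- The function on the tree `FreeGroup J` that measures which part of the edge with final
vertex the word `v` lies on the geodesic from the root. -/
noncomputable def edgeFun (v : List (J × Bool)) (L : List (J × Bool)) : ℝ :=
  if v <+: L then 1 else 0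

/-- The geodesic from the root to a point covers none of the edge from `v` to `v ++ [l]`, all of it,
or a proper part. In the last case the point lies on that edge, so height and position can be read
off from the part covered. -/
theorem edgeFun_trichotomy {w : J → ℝ} (hw : ∀ j, 0 ≤ w j) (v : List (J × Bool)) (l : J × Bool)
    (x : X) (g : FreeGroup J) :
    let φ := c.interp S (fun g => edgeFun (v ++ [l]) g.toWord) x g
    let H := c.interp S (fun g => wordWeight w g.toWord) x g
    φ = 0 ∨ (φ = 1 ∧ wordWeight w v + w l.1 ≤ H) ∨
      (0 < φ ∧ φ < 1 ∧ H = wordWeight w v + w l.1 * φ ∧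
        φ = if l.2 then circlePos (c.coord l.1 x) else 1 - circlePos (c.coord l.1 x)) := by
  intro φ H
  have hlen : ∀ L : List (J × Bool), v ++ [l] <+: L →
      wordWeight w v + w l.1 ≤ wordWeight w L := fun L hL => by
    rw [← wordWeight_append_singleton]
    exact wordWeight_le_of_prefix hw hL
  by_cases hx : x ∈ c.inside S
  · obtain ⟨j, hj, hjx⟩ := hx
    obtain ⟨Z, b, hF⟩ := exists_interp_eq hj hjx g
    have hφ : φ = _ := hF (edgeFun (v ++ [l]))
    have hH : H = _ := hF (wordWeight w)
    set r := if b then circlePos (c.coord j x) else 1 - circlePos (c.coord j x) with hr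
    have hr0 : 0 < r := by
      rw [hr]; split_ifs
      · exact circlePos_pos hjx
      · linarith [circlePos_lt_one (c.coord j x)]
    have hr1 : r < 1 := by
      rw [hr]; split_ifs
      · exact circlePos_lt_one _
      · linarith [circlePos_pos hjx]
    rw [wordWeight_append_singleton] at hH
    by_cases hv : v ++ [l] = Z ++ [(j, b)]
    · right; right
      have hnot : ¬ v ++ [l] <+: Z := fun h => by
        have := h.length_le
        rw [hv] at this
        simp at this
      obtain ⟨rfl, h2⟩ := List.append_inj' hv rfl
      obtain rfl : l = (j, b) := by simpa using h2
      have hφ' : φ = r := by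
        rw [hφ, edgeFun, edgeFun, if_neg hnot, if_pos (List.prefix_refl _)]; ring
      rw [hφ']
      refine ⟨hr0, hr1, ?_, hr⟩
      rw [hH]; simp only; ring
    · have hiff : v ++ [l] <+: Z ++ [(j, b)] ↔ v ++ [l] <+: Z := by
        rw [List.prefix_concat_iff, or_iff_right hv]
      have hφ' : φ = edgeFun (v ++ [l]) Z := by
        rw [hφ, edgeFun, edgeFun]
        simp only [hiff]
        ring
      by_cases hZ : v ++ [l] <+: Z
      · right; left
        rw [hφ', edgeFun, if_pos hZ]
        refine ⟨rfl, ?_⟩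
        have := hlen Z hZ
        have := mul_nonneg hr0.le (hw j)
        rw [hH]
        simp only [add_sub_cancel_left]
        linarith
      · left
        rw [hφ', edgeFun, if_neg hZ]
  · have hφ : φ = _ := interp_of_notMem hx _ g
    have hH : H = _ := interp_of_notMem hx _ g
    rw [hφ, hH, edgeFun]
    by_cases h : v ++ [l] <+: g.toWord
    · rw [if_pos h]
      exact Or.inr (Or.inl ⟨rfl, hlen _ h⟩)
    · rw [if_neg h]
      exact Or.inl rfl

/-- If the positions of a path on the circle `j` at two times are different, then its lift to the
tree has to descend in between. -/
theorem Horizontal.exists_interp_add_le {f : I → X} (hf : Continuous f) {g : I → FreeGroup J}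
    (hg : c.Horizontal S f g) {w : J → ℝ} (hw : ∀ j, 0 ≤ w j) {j : J} (hj : j ∈ S) {s t : I}
    (hs : c.coord j (f s) ≠ -1) :
    ∃ u ∈ uIcc s t, c.interp S (fun g => wordWeight w g.toWord) (f u) (g u) +
        w j * (min |circlePos (c.coord j (f s)) - circlePos (c.coord j (f t))|
          (circleDepth (c.coord j (f s))) / 2) ≤
      max (c.interp S (fun g => wordWeight w g.toWord) (f s) (g s))
        (c.interp S (fun g => wordWeight w g.toWord) (f t) (g t)) := by
  set H : I → ℝ := fun u => c.interp S (fun g => wordWeight w g.toWord) (f u) (g u) with hH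
  set κ := min |circlePos (c.coord j (f s)) - circlePos (c.coord j (f t))|
          (circleDepth (c.coord j (f s))) with hκ
  -- The edge from `Z` to `Z ++ [(j, b)]` is the one that contains the lift at time `s`; `φ` records
  -- progress along it.
  obtain ⟨Z, b, hF⟩ := exists_interp_eq hj hs (g s)
  set φ : I → ℝ := fun u =>
    c.interp S (fun g => edgeFun (Z ++ [(j, b)]) g.toWord) (f u) (g u) with hφ
  have hφc : Continuous φ := hg.continuous_interp hf _
  have tri := fun u : I => edgeFun_trichotomy (c := c) (S := S) hw Z (j, b) (f u) (g u)
  have hφs : φ s = if b then circlePos (c.coord j (f s)) else 1 - circlePos (c.coord j (f s)) := by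
    have h1 : ¬ Z ++ [(j, b)] <+: Z := fun h => by simpa using h.length_le
    have := hF (edgeFun (Z ++ [(j, b)]))
    rw [edgeFun, edgeFun, if_neg h1, if_pos (List.prefix_refl _)] at this
    rw [hφ]; simp only; rw [this]; ring
  have hd1 := circleDepth_le_circlePos (c.coord j (f s))
  have hd2 := circleDepth_le_one_sub_circlePos (c.coord j (f s))
  have hpos := circleDepth_pos hs
  -- If the lift at time `t` is on the same edge, the difference of `φ` is the difference of
  -- positions. Otherwise `φ t` is `0` or `1`, and `φ s` is at least the depth away from both.
  have hsep : κ ≤ |φ s - φ t| := by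
    rcases tri t with h | ⟨h, -⟩ | ⟨-, -, -, h⟩
    · change φ t = 0 at h
      refine (min_le_right _ _).trans ?_
      rw [h, hφs, sub_zero]
      split_ifs
      · exact hd1.trans (le_abs_self _)
      · exact hd2.trans (le_abs_self _)
    · change φ t = 1 at h
      refine (min_le_right _ _).trans ?_
      rw [h, hφs]
      split_ifs
      · refine le_trans ?_ (neg_le_abs _); linarith
      · refine le_trans ?_ (neg_le_abs _); linarith
    · change φ t = _ at h
      refine (min_le_left _ _).trans ?_
      rw [h, hφs]
      simp only
      split_ifs
      · exact le_rfl
      · rw [abs_sub_comm]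
        apply le_of_eq; congr 1; ring
  -- Between the two times `φ` takes the mean value, which lies strictly between `0` and `1`. At
  -- such a time the height is exactly that of the point on the edge, whereas at `a` it is at least
  -- as large as progress `φ a` requires. Using the mean costs the factor `1 / 2`.
  have main : ∀ a a' : I, φ a' < φ a → ∃ u ∈ uIcc a a', H u + w j * ((φ a - φ a') / 2) ≤ H a := by
    intro a a' haa
    have h0 : 0 ≤ φ a' := by
      rcases tri a' with h | ⟨h, -⟩ | ⟨h, -⟩
      · exact h.ge
      · exact zero_le_one.trans h.ge
      · exact h.le
    have h1 : φ a ≤ 1 := by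
      rcases tri a with h | ⟨h, -⟩ | ⟨-, h, -⟩
      · exact h.le.trans zero_le_one
      · exact h.le
      · exact h.le
    obtain ⟨u, hu, hφu⟩ := intermediate_value_uIcc (a := a) (b := a') hφc.continuousOn
      (show (φ a + φ a') / 2 ∈ uIcc (φ a) (φ a') by
        rw [uIcc_of_ge haa.le]; constructor <;> linarith)
    refine ⟨u, hu, ?_⟩
    have hHu : H u = wordWeight w Z + w j * φ u := by
      rcases tri u with h | ⟨h, -⟩ | ⟨-, -, h, -⟩
      · change φ u = 0 at h; linarith
      · change φ u = 1 at h; linarith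
      · exact h
    have hHa : wordWeight w Z + w j * φ a ≤ H a := by
      rcases tri a with h | ⟨h, h'⟩ | ⟨-, -, h, -⟩
      · change φ a = 0 at h; linarith
      · change φ a = 1 at h
        rw [h, mul_one]; exact h'
      · exact h.ge
    rw [hHu, hφu]
    linarith
  have hκ0 : 0 ≤ κ := le_min (abs_nonneg _) hpos.le
  rcases lt_trichotomy (φ s) (φ t) with h | h | h
  · obtain ⟨u, hu, hu'⟩ := main t s h
    refine ⟨u, uIcc_comm t s ▸ hu, le_trans ?_ (hu'.trans (le_max_right _ _))⟩
    rw [abs_sub_comm, abs_of_pos (sub_pos.2 h)] at hsep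
    have := mul_le_mul_of_nonneg_left (show κ / 2 ≤ (φ t - φ s) / 2 by linarith) (hw j)
    change H u + _ ≤ _
    linarith
  · refine ⟨s, left_mem_uIcc, le_trans ?_ (le_max_left _ _)⟩
    rw [h, sub_self, abs_zero] at hsep
    rw [le_antisymm hsep hκ0]; simp
  · obtain ⟨u, hu, hu'⟩ := main s t h
    refine ⟨u, hu, le_trans ?_ (hu'.trans (le_max_left _ _))⟩
    rw [abs_of_pos (sub_pos.2 h)] at hsep
    have := mul_le_mul_of_nonneg_left (show κ / 2 ≤ (φ s - φ t) / 2 by linarith) (hw j)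
    change H u + _ ≤ _
    linarith

end CircleCoords

/-! ### Letter counts along lifts, and loops with trivial words. -/

theorem unitInterval.exists_isPreconnected_subset {U : Set I} {t : I} (hU : U ∈ 𝓝 t) :
    ∃ V ∈ 𝓝 t, V ⊆ U ∧ IsPreconnected V := by
  obtain ⟨δ, hδ, hb⟩ := Metric.mem_nhds_iff.1 hU
  refine ⟨Metric.ball t δ, Metric.ball_mem_nhds t hδ, hb, ?_⟩
  refine Set.OrdConnected.isPreconnected ⟨fun x hx y hy z hz => ?_⟩
  rw [Metric.mem_ball, Subtype.dist_eq, Real.dist_eq, abs_lt] at hx hy ⊢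
  have h1 : (x : ℝ) ≤ z := hz.1
  have h2 : (z : ℝ) ≤ y := hz.2
  constructor <;> linarith

theorem IsPreconnected.apply_eq_of_eventually {Y Z : Type*} [TopologicalSpace Y] {V : Set Y}
    (hV : IsPreconnected V) {m : Y → Z} (hm : ∀ y ∈ V, ∀ᶠ z in 𝓝 y, m z = m y) {y y' : Y}
    (hy : y ∈ V) (hy' : y' ∈ V) : m y = m y' := by
  have : PreconnectedSpace V := Subtype.preconnectedSpace hV
  have hlc : IsLocallyConstant fun z : V => m z :=
    (IsLocallyConstant.iff_eventually_eq _).2 fun z =>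
      continuousAt_subtype_val.eventually (hm z z.2)
  exact hlc.apply_eq_of_preconnectedSpace ⟨y, hy⟩ ⟨y', hy'⟩

namespace CircleCoords

variable {X J : Type*} [TopologicalSpace X] {c : CircleCoords X J} {S : Finset J}
  [DecidableEq J]

/-- The number of occurrences of the letter `j` in a reduced word. -/
def letterCount (j : J) (g : FreeGroup J) : ℝ :=
  wordWeight (fun i => if i = j then 1 else 0) g.toWord

theorem letterCount_one (j : J) : letterCount j (1 : FreeGroup J) = 0 := by
  simp [letterCount]

theorem letterCount_nonneg (j : J) (g : FreeGroup J) : 0 ≤ letterCount j g :=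
  wordWeight_nonneg (fun i => by split_ifs <;> norm_num) _

theorem abs_letterCount_mul_of_sub (j i : J) (g : FreeGroup J) :
    |letterCount j (g * FreeGroup.of i) - letterCount j g| = if i = j then 1 else 0 := by
  rw [letterCount, letterCount]
  rcases FreeGroup.toWord_mul_of g i with h | h <;> rw [h, wordWeight_append_singleton] <;>
    split_ifs with hij <;> simp

theorem letterCount_mul_of {j i : J} (hij : i ≠ j) (g : FreeGroup J) :
    letterCount j (g * FreeGroup.of i) = letterCount j g := by
  have := abs_letterCount_mul_of_sub j i g
  rw [if_neg hij, abs_eq_zero, sub_eq_zero] at this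
  exact this

theorem abs_letterCount_mul_of_self (j : J) (g : FreeGroup J) :
    |letterCount j (g * FreeGroup.of j) - letterCount j g| = 1 := by
  rw [abs_letterCount_mul_of_sub, if_pos rfl]

/-- The letter count at the vertex that is next along the circle `j`. -/
noncomputable def nearCount (c : CircleCoords X J) (j : J) (x : X) (g : FreeGroup J) : ℝ :=
  letterCount j (if ((c.coord j x : Circle) : ℂ).im < 0 then g * FreeGroup.of j else g)

theorem nearCount_eq_letterCount_mul_jump {j : J} (hj : j ∈ S) (x : X) (g : FreeGroup J) :
    nearCount c j x g = letterCount j (g * c.jump S x) := by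
  rw [nearCount]
  split_ifs with h
  · rw [jump_of_neg hj h]
  · rcases exists_neg_or_jump (c := c) (S := S) x with ⟨i, hi, hneg⟩ | ⟨-, hjump⟩
    · rw [jump_of_neg hi hneg, letterCount_mul_of]
      rintro rfl
      exact h hneg
    · rw [hjump, mul_one]

/-- The nearest vertex changes only at the midpoint of a circle. At the midpoint of a circle other
than `j` the change is by a different letter, which does not affect the number of letters `j`. -/
theorem Horizontal.eventually_nearCount_eq {Y : Type*} [TopologicalSpace Y] {f : Y → X}
    (hf : Continuous f) {g : Y → FreeGroup J} (hg : c.Horizontal S f g) {j : J} (hj : j ∈ S)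
    {y : Y} (hy : c.coord j (f y) ≠ 1) :
    ∀ᶠ z in 𝓝 y, nearCount c j (f z) (g z) = nearCount c j (f y) (g y) := by
  by_cases h0 : f y ∈ c.awayMid S
  · filter_upwards [(hg y).1 h0] with z hz
    rw [nearCount_eq_letterCount_mul_jump hj, nearCount_eq_letterCount_mul_jump hj, hz]
  · have : ∃ i ∈ S, c.coord i (f y) = 1 := by
      by_contra! h
      exact h0 h
    obtain ⟨i, hi, hiy⟩ := this
    have hne : c.coord i (f y) ≠ -1 := by rw [hiy]; exact Circle.neg_one_ne_one.symm
    have hij : j ≠ i := by rintro rfl; exact hy hiy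
    filter_upwards [(hg y).2 ⟨i, hi, hne⟩,
      ((c.continuous_coord i).comp hf).continuousAt.eventually_ne hne] with z hz hz'
    rw [nearCount, nearCount, hz, coord_eq_of_ne hne hij, coord_eq_of_ne hz' hij]

theorem abs_interp_letterCount_sub_nearCount_le {j : J} (x : X) (g : FreeGroup J) (hj : j ∈ S) :
    |c.interp S (letterCount j) x g - nearCount c j x g| ≤ circleDepth (c.coord j x) := by
  by_cases h : c.coord j x = -1
  · have hn : nearCount c j x g = letterCount j g := by rw [nearCount, h]; simp
    have hi : c.interp S (letterCount j) x g = letterCount j g := by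
      rw [interp, Finset.sum_eq_zero, add_zero]
      intro i _
      by_cases hij : i = j
      · rw [hij, h, circlePos_neg_one, zero_mul]
      · rw [letterCount_mul_of hij, sub_self, mul_zero]
    rw [hn, hi, sub_self, abs_zero]
    exact circleDepth_nonneg _
  · rw [interp_of_mem hj h, nearCount, circlePos]
    have h1 := abs_letterCount_mul_of_self j g
    split_ifs with h2 h3 h3
    · exact absurd h3 h2.not_gt
    · rw [add_sub_cancel_left, abs_mul, h1, mul_one, abs_of_nonneg (circleDepth_nonneg _)]
    · have : letterCount j g + (1 - circleDepth (c.coord j x)) *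
          (letterCount j (g * FreeGroup.of j) - letterCount j g) -
          letterCount j (g * FreeGroup.of j) = -(circleDepth (c.coord j x) *
            (letterCount j (g * FreeGroup.of j) - letterCount j g)) := by ring
      rw [this, abs_neg, abs_mul, h1, mul_one, abs_of_nonneg (circleDepth_nonneg _)]
    · exact absurd (not_le.1 h2) h3

/-- The letter counts along lifts of a path to the trees for the various `S` are
equicontinuous. -/
theorem eventually_abs_interp_letterCount_sub_le {f : I → X} (hf : Continuous f) (j : J) (t : I)
    {ε : ℝ} (hε : 0 < ε) : ∀ᶠ s in 𝓝 t, ∀ (S : Finset J), j ∈ S → ∀ g : I → FreeGroup J,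
      c.Horizontal S f g → |c.interp S (letterCount j) (f s) (g s) -
        c.interp S (letterCount j) (f t) (g t)| ≤ ε := by
  have hcj : Continuous fun s => c.coord j (f s) := (c.continuous_coord j).comp hf
  -- In both cases the neighbourhood `V` is chosen by the coordinate `j` of `f` alone, hence
  -- independently of `S` and `g`. Connectedness of `V` is what turns local constancy, whose
  -- neighbourhoods depend on `S`, into constancy on `V`: of the count at the nearest vertex in the
  -- first case, of the label in the second.
  by_cases h : c.coord j (f t) = -1
  · have hev : ∀ᶠ s in 𝓝 t, c.coord j (f s) ≠ 1 ∧ circleDepth (c.coord j (f s)) < ε := by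
      refine (hcj.continuousAt.eventually_ne ?_).and
        ((continuous_circleDepth.comp hcj).continuousAt.eventually_lt_const ?_)
      · rw [h]; exact Circle.neg_one_ne_one
      · simpa [h] using hε
    obtain ⟨V, hV, hVU, hVc⟩ := unitInterval.exists_isPreconnected_subset hev
    filter_upwards [hV] with s hs S hj g hg
    have hm : nearCount c j (f s) (g s) = nearCount c j (f t) (g t) :=
      hVc.apply_eq_of_eventually (m := fun s => nearCount c j (f s) (g s))
        (fun y hy => hg.eventually_nearCount_eq hf hj (hVU hy).1) hs (mem_of_mem_nhds hV)
    have h1 := abs_interp_letterCount_sub_nearCount_le (c := c) (f s) (g s) hj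
    have h2 := abs_interp_letterCount_sub_nearCount_le (c := c) (f t) (g t) hj
    rw [h, circleDepth_neg_one] at h2
    have h3 := abs_nonpos_iff.1 h2
    rw [sub_eq_zero] at h3
    rw [h3, ← hm]
    exact h1.trans (hVU hs).2.le
  · have hev : ∀ᶠ s in 𝓝 t, c.coord j (f s) ≠ -1 ∧
        |circlePos (c.coord j (f s)) - circlePos (c.coord j (f t))| < ε := by
      refine (hcj.continuousAt.eventually_ne h).and ?_
      have h1 : ContinuousAt (fun s => circlePos (c.coord j (f s))) t :=
        ContinuousAt.comp (f := fun s => c.coord j (f s)) (continuousAt_circlePos h)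
          hcj.continuousAt
      have h2 := (h1.sub (continuousAt_const (y := circlePos (c.coord j (f t))))).abs
      exact h2.eventually_lt_const (by simpa using hε)
    obtain ⟨V, hV, hVU, hVc⟩ := unitInterval.exists_isPreconnected_subset hev
    filter_upwards [hV] with s hs S hj g hg
    have hm : g s = g t := hVc.apply_eq_of_eventually
      (fun y hy => (hg y).2 ⟨j, hj, (hVU hy).1⟩) hs (mem_of_mem_nhds hV)
    rw [interp_of_mem hj (hVU hs).1, interp_of_mem hj h, hm, add_sub_add_left_eq_sub, ← sub_mul,
      abs_mul, abs_letterCount_mul_of_self, mul_one]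
    exact (hVU hs).2.le

/-- The letter counts along lifts of a path to the trees for the various `S` are bounded. -/
theorem exists_interp_letterCount_le {f : I → X} (hf : Continuous f) (hf0 : c.IsBase (f 0))
    (j : J) : ∃ n : ℝ, 0 ≤ n ∧ ∀ (t : I) (S : Finset J), j ∈ S → ∀ g : I → FreeGroup J,
      c.Horizontal S f g → g 0 = 1 → |c.interp S (letterCount j) (f t) (g t)| ≤ n := by
  -- Boundedness at a time, uniformly in `S`, is a locally constant property by equicontinuity and
  -- holds at time `0`, so it holds at all times. Compactness then makes the bound uniform in time.
  let B : I → Prop := fun t => ∃ n : ℝ, ∀ (S : Finset J), j ∈ S → ∀ g : I → FreeGroup J,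
      c.Horizontal S f g → g 0 = 1 → |c.interp S (letterCount j) (f t) (g t)| ≤ n
  have hstep : ∀ t, ∀ᶠ s in 𝓝 t, (B s ↔ B t) := by
    intro t
    filter_upwards [eventually_abs_interp_letterCount_sub_le (c := c) hf j t one_pos] with s hs
    constructor
    · rintro ⟨n, hn⟩
      refine ⟨n + 1, fun S hj g hg hg0 => ?_⟩
      have h1 := abs_le.1 (hs S hj g hg)
      have h2 := abs_le.1 (hn S hj g hg hg0)
      exact abs_le.2 ⟨by linarith, by linarith⟩
    · rintro ⟨n, hn⟩
      refine ⟨n + 1, fun S hj g hg hg0 => ?_⟩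
      have h1 := abs_le.1 (hs S hj g hg)
      have h2 := abs_le.1 (hn S hj g hg hg0)
      exact abs_le.2 ⟨by linarith, by linarith⟩
  have hB0 : B 0 := ⟨0, fun S hj g hg hg0 => by
    rw [interp_of_notMem hf0.notMem_inside, hg0, letterCount_one, abs_zero]⟩
  have hB : ∀ t, B t := by
    intro t
    have hlc : IsLocallyConstant B :=
      (IsLocallyConstant.iff_eventually_eq _).2 fun t => (hstep t).mono fun s hs => propext hs
    rw [hlc.apply_eq_of_preconnectedSpace t 0]
    exact hB0
  have hcpt : ∃ n : ℝ, ∀ t ∈ (univ : Set I), ∀ (S : Finset J), j ∈ S → ∀ g : I → FreeGroup J,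
      c.Horizontal S f g → g 0 = 1 → |c.interp S (letterCount j) (f t) (g t)| ≤ n := by
    refine isCompact_univ.induction_on (p := fun s : Set I => ∃ n : ℝ, ∀ t ∈ s,
      ∀ (S : Finset J), j ∈ S → ∀ g : I → FreeGroup J,
      c.Horizontal S f g → g 0 = 1 → |c.interp S (letterCount j) (f t) (g t)| ≤ n) ?_ ?_ ?_ ?_
    · exact ⟨0, fun t ht => absurd ht (notMem_empty t)⟩
    · rintro s s' hs ⟨n, hn⟩
      exact ⟨n, fun t ht => hn t (hs ht)⟩
    · rintro s s' ⟨n, hn⟩ ⟨n', hn'⟩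
      refine ⟨max n n', fun t ht S hj g hg hg0 => ?_⟩
      rcases ht with ht | ht
      · exact (hn t ht S hj g hg hg0).trans (le_max_left _ _)
      · exact (hn' t ht S hj g hg hg0).trans (le_max_right _ _)
    · intro t _
      obtain ⟨n, hn⟩ := hB t
      refine ⟨_, nhdsWithin_le_nhds
        (eventually_abs_interp_letterCount_sub_le (c := c) hf j t one_pos), n + 1, ?_⟩
      intro s hs S hj g hg hg0
      have h1 := abs_le.1 (hs S hj g hg)
      have h2 := abs_le.1 (hn S hj g hg hg0)
      exact abs_le.2 ⟨by linarith, by linarith⟩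
  obtain ⟨n, hn⟩ := hcpt
  refine ⟨max n 0, le_max_right _ _, fun t S hj g hg hg0 => ?_⟩
  exact (hn t (mem_univ t) S hj g hg hg0).trans (le_max_left _ _)

theorem interp_wordWeight_eq_sum (w : J → ℝ) (x : X) (g : FreeGroup J) :
    c.interp S (fun g => wordWeight (fun j => if j ∈ S then w j else 0) g.toWord) x g =
      ∑ j ∈ S, w j * c.interp S (letterCount j) x g := by
  simp only [interp, wordWeight_sum, letterCount, mul_add, Finset.sum_add_distrib,
    ← Finset.sum_sub_distrib, ← mul_sub, Finset.mul_sum]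
  congr 1
  rw [Finset.sum_comm]
  exact Finset.sum_congr rfl fun i _ => Finset.sum_congr rfl fun k _ => by ring

theorem interp_letterCount_nonneg (j : J) (x : X) (g : FreeGroup J) :
    0 ≤ c.interp S (letterCount j) x g := by
  by_cases hx : x ∈ c.inside S
  · obtain ⟨i, hi, hix⟩ := hx
    rw [interp_of_mem hi hix]
    have h1 := letterCount_nonneg j g
    have h2 := letterCount_nonneg j (g * FreeGroup.of i)
    have h3 := circlePos_pos hix
    have h4 := circlePos_lt_one (c.coord i x)
    nlinarith
  · rw [interp_of_notMem hx]
    exact letterCount_nonneg j g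

/-- A loop in a space with jointly injective circle coordinates is null-homotopic if the words of
its crossings of sufficiently large finite sets of circles are all trivial. -/
theorem homotopic_refl_of_hol [Countable J] {p : X} (hp : c.IsBase p)
    (hinj : ∀ x y, (∀ j, c.coord j x = c.coord j y) → x = y) (α : Path p p)
    (hα : ∀ᶠ S in atTop, c.hol S α = 1) : α.Homotopic (Path.refl p) := by
  have hαc := α.continuous
  choose g hg hg0 using fun S : Finset J => exists_horizontal_path (c := c) (S := S) hαc
  have hg1 : ∀ᶠ S in atTop, g S 1 = 1 := hα.mono fun S hS => by rw [← (hg S).hol_eq (hg0 S), hS]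
  have hp0 : c.IsBase (α 0) := by rwa [α.source]
  have hp1 : c.IsBase (α 1) := by rwa [α.target]
  choose n hn0 hn using exists_interp_letterCount_le (c := c) hαc hp0
  obtain ⟨e, he⟩ := exists_injective_nat J
  -- Positive weights, small enough that the weighted letter bounds `w j * n j` are dominated by a
  -- geometric series; the summand `1` guards against `n j = 0`.
  let w : J → ℝ := fun j => (1 / 2) ^ e j / (n j + 1)
  have hw : ∀ j, 0 < w j := fun j => div_pos (by positivity) (by linarith [hn0 j])
  have hwn : ∀ j, w j * n j ≤ (1 / 2) ^ e j := fun j => by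
    have : 0 < n j + 1 := by linarith [hn0 j]
    rw [div_mul_eq_mul_div, div_le_iff₀ this]
    exact mul_le_mul_of_nonneg_left (by linarith) (by positivity)
  have hsum : Summable fun j => w j * n j :=
    Summable.of_nonneg_of_le (fun j => mul_nonneg (hw j).le (hn0 j)) hwn
      (summable_geometric_two.comp_injective he)
  let N : Finset J → J → I → ℝ := fun S j t =>
    if j ∈ S then c.interp S (letterCount j) (α t) (g S t) else 0
  have hNn : ∀ S j t, |N S j t| ≤ n j := fun S j t => by
    simp only [N]; split_ifs with h
    · exact hn j t S h _ (hg S) (hg0 S)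
    · simpa using hn0 j
  have hN0 : ∀ S j t, 0 ≤ N S j t := fun S j t => by
    simp only [N]; split_ifs with h
    · exact interp_letterCount_nonneg _ _ _
    · exact le_rfl
  have hNeq : ∀ j t, ∀ ε > 0, ∀ᶠ s in 𝓝 t, ∀ S, |N S j s - N S j t| ≤ ε := by
    intro j t ε hε
    filter_upwards [eventually_abs_interp_letterCount_sub_le (c := c) hαc j t hε] with s hs S
    simp only [N]; split_ifs with h
    · exact hs S h _ (hg S)
    · simpa using hε.le
  -- The weighted distance from the root of the lift to the tree for `S`.
  let h : Finset J → I → ℝ := fun S t =>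
    c.interp S (fun g => wordWeight (fun j => if j ∈ S then w j else 0) g.toWord) (α t) (g S t)
  have hh : ∀ S t, h S t = ∑ j ∈ S, w j * N S j t := fun S t => by
    rw [show h S t = _ from interp_wordWeight_eq_sum w (α t) (g S t)]
    exact Finset.sum_congr rfl fun j hj => by simp only [N, if_pos hj]
  have hh0 : ∀ S t, 0 ≤ h S t := fun S t => by
    rw [hh]
    exact Finset.sum_nonneg fun j _ => mul_nonneg (hw j).le (hN0 S j t)
  have hhC : ∀ S t, h S t ≤ ∑' j, w j * n j := fun S t => by
    rw [hh]
    refine le_trans (Finset.sum_le_sum fun j _ =>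
      mul_le_mul_of_nonneg_left ((le_abs_self _).trans (hNn S j t)) (hw j).le) ?_
    exact hsum.sum_le_tsum _ fun j _ => mul_nonneg (hw j).le (hn0 j)
  have hheq : ∀ t, ∀ ε > 0, ∀ᶠ s in 𝓝 t, ∀ S, |h S s - h S t| ≤ ε := by
    intro t ε hε
    -- Equicontinuity of the heights: the worst oscillation over all `S` of each letter count tends
    -- to zero, and dominated convergence passes this to the weighted sum.
    let D : I → J → ℝ := fun s j => ⨆ S, |N S j s - N S j t|
    have hbd : ∀ S j s, |N S j s - N S j t| ≤ 2 * n j := fun S j s => by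
      have h1 := abs_sub (N S j s) (N S j t)
      linarith [hNn S j s, hNn S j t]
    have hDbdd : ∀ s j, BddAbove (range fun S => |N S j s - N S j t|) := fun s j =>
      ⟨2 * n j, by rintro _ ⟨S, rfl⟩; exact hbd S j s⟩
    have hD0 : ∀ s j, 0 ≤ D s j := fun s j => Real.iSup_nonneg fun S => abs_nonneg _
    have hD2 : ∀ s j, D s j ≤ 2 * n j := fun s j => ciSup_le fun S => hbd S j s
    have hwD : ∀ s j, ‖w j * D s j‖ ≤ 2 * (w j * n j) := fun s j => by
      rw [Real.norm_of_nonneg (mul_nonneg (hw j).le (hD0 s j))]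
      have := mul_le_mul_of_nonneg_left (hD2 s j) (hw j).le
      linarith
    have hlim : Tendsto (fun s => ∑' j, w j * D s j) (𝓝 t) (𝓝 (∑' _ : J, 0)) := by
      refine tendsto_tsum_of_dominated_convergence (hsum.mul_left 2) (fun j => ?_)
        (.of_forall hwD)
      have : Tendsto (fun s => D s j) (𝓝 t) (𝓝 0) := by
        rw [Metric.tendsto_nhds]
        intro δ hδ
        filter_upwards [hNeq j t (δ / 2) (by positivity)] with s hs
        rw [Real.dist_0_eq_abs, abs_of_nonneg (hD0 s j)]
        exact lt_of_le_of_lt (ciSup_le hs) (by linarith)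
      simpa using this.const_mul (w j)
    rw [tsum_zero] at hlim
    filter_upwards [hlim.eventually_lt_const hε] with s hs S
    rw [hh, hh, ← Finset.sum_sub_distrib]
    refine (Finset.abs_sum_le_sum_abs _ _).trans (le_trans ?_ hs.le)
    have hs' : Summable fun j => w j * D s j :=
      Summable.of_norm_bounded (hsum.mul_left 2) (hwD s)
    refine le_trans (Finset.sum_le_sum fun j _ => ?_)
      (hs'.sum_le_tsum S fun j _ => mul_nonneg (hw j).le (hD0 s j))
    rw [← mul_sub, abs_mul, abs_of_pos (hw j)]
    exact mul_le_mul_of_nonneg_left (le_ciSup (hDbdd s j) S) (hw j).le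
  -- An ultrafilter limit exists at every time because the heights are bounded, and inherits
  -- continuity from equicontinuity. It plays the role of a subsequence in the Arzelà–Ascoli
  -- theorem.
  let 𝓤 : Ultrafilter (Finset J) := Ultrafilter.of atTop
  have h𝓤 : (𝓤 : Filter (Finset J)) ≤ atTop := Ultrafilter.of_le atTop
  have hlim : ∀ t, ∃ y, Tendsto (fun S => h S t) 𝓤 (𝓝 y) := by
    intro t
    obtain ⟨y, -, hy⟩ := (isCompact_Icc (a := (0 : ℝ)) (b := ∑' j, w j * n j)).ultrafilter_le_nhds
      (𝓤.map fun S => h S t) (by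
        rw [Ultrafilter.coe_map, le_principal_iff, mem_map]
        exact univ_mem' fun S => ⟨hh0 S t, hhC S t⟩)
    exact ⟨y, hy⟩
  choose H hH using hlim
  have hHc : Continuous H := by
    rw [continuous_iff_continuousAt]
    intro t
    rw [Metric.continuousAt_iff']
    intro ε hε
    filter_upwards [hheq t (ε / 2) (by positivity)] with s hs
    have h1 : |H s - H t| ≤ ε / 2 :=
      le_of_tendsto ((hH s).sub (hH t)).abs (.of_forall hs)
    rw [Real.dist_eq]
    linarith
  refine α.homotopic_refl_of_height hHc ?_ ?_
    (fun t => ge_of_tendsto (hH t) (.of_forall fun S => hh0 S t)) ?_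
  · refine tendsto_nhds_unique (hH 0) (tendsto_const_nhds.congr fun S => ?_)
    simp only [h]
    rw [interp_of_notMem hp0.notMem_inside, hg0]
    simp
  · refine tendsto_nhds_unique (hH 1) (tendsto_const_nhds.congr' ?_)
    filter_upwards [h𝓤 hg1] with S hS
    simp only [h]
    rw [interp_of_notMem hp1.notMem_inside, hS]
    simp
  · intro s t hst hHst hmin
    -- If the coordinates `j` differed, then for every `S` containing `j` the lift would descend
    -- between the two times by the fixed amount `w j * (κ / 2)`. The low points accumulate along
    -- the ultrafilter at some `v`, and equicontinuity leaves half of the descent for the limit at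
    -- `v`, which contradicts minimality of the height at `s`. The endpoints are unordered since
    -- only the first is assumed to lie inside the circle `j`.
    have main : ∀ a b : I, uIcc a b = Icc s t → H a = H s → H b = H s → ∀ j,
        c.coord j (α a) ≠ -1 → c.coord j (α a) = c.coord j (α b) := by
      intro a b hab hHa hHb j hj
      by_contra hne
      set κ := min |circlePos (c.coord j (α a)) - circlePos (c.coord j (α b))|
        (circleDepth (c.coord j (α a))) with hκ
      have hκ0 : 0 < κ := lt_min
        (abs_pos.2 (sub_ne_zero.2 fun h' => hne (circlePos_injective h'))) (circleDepth_pos hj)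
      have hex : ∀ S, ∃ u ∈ Icc s t, j ∈ S → h S u + w j * (κ / 2) ≤ max (h S a) (h S b) := by
        intro S
        by_cases hjS : j ∈ S
        · have hwS : ∀ i, 0 ≤ (if i ∈ S then w i else 0) := fun i => by
            split_ifs
            · exact (hw i).le
            · exact le_rfl
          obtain ⟨u, hu, hu'⟩ := (hg S).exists_interp_add_le hαc hwS hjS (t := b) hj
          rw [if_pos hjS] at hu'
          exact ⟨u, hab ▸ hu, fun _ => hu'⟩
        · exact ⟨s, ⟨le_rfl, hst⟩, fun h' => absurd h' hjS⟩
      choose u hu hu' using hex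
      obtain ⟨v, hv, hv'⟩ := (isCompact_Icc (a := s) (b := t)).ultrafilter_le_nhds (𝓤.map u) (by
        rw [Ultrafilter.coe_map, le_principal_iff, mem_map]
        exact univ_mem' hu)
      have hv'' : Tendsto u 𝓤 (𝓝 v) := hv'
      have hjev : ∀ᶠ S in (𝓤 : Filter (Finset J)), j ∈ S := by
        refine h𝓤 ?_
        filter_upwards [mem_atTop ({j} : Finset J)] with S hS
        exact hS (Finset.mem_singleton_self j)
      have hδ : 0 < w j * (κ / 2) := mul_pos (hw j) (by positivity)
      have hle : H v + w j * (κ / 2) ≤ max (H a) (H b) + w j * (κ / 2) / 2 := by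
        refine le_of_tendsto_of_tendsto ((hH v).add tendsto_const_nhds)
          (((hH a).max (hH b)).add tendsto_const_nhds) ?_
        filter_upwards [hjev, hv''.eventually (hheq v (w j * (κ / 2) / 2) (by positivity))]
          with S h1 h2
        have h3 := hu' S h1
        have h4 := (abs_le.1 (h2 S)).1
        linarith
      rw [hHa, hHb, max_self] at hle
      have := hmin v hv
      linarith
    refine hinj _ _ fun j => ?_
    by_cases h1 : c.coord j (α s) = -1
    · by_cases h2 : c.coord j (α t) = -1
      · rw [h1, h2]
      · exact (main t s (by rw [uIcc_comm, uIcc_of_le hst]) hHst.symm rfl j h2).symm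
    · exact main s t (uIcc_of_le hst) rfl hHst.symm j h1

end CircleCoords

/-! ### Substitutions in free groups. -/

section FreeGroupSubstitution

variable {J : Type*} [DecidableEq J]

/-- The endomorphism of the free group that replaces the letter `n` by `w`. -/
def FreeGroup.subst (n : J) (w : FreeGroup J) : FreeGroup J →* FreeGroup J :=
  FreeGroup.lift fun k => if k = n then w else FreeGroup.of k

@[simp] theorem FreeGroup.subst_of_self (n : J) (w : FreeGroup J) :
    FreeGroup.subst n w (FreeGroup.of n) = w := by simp [FreeGroup.subst]

theorem FreeGroup.subst_of_ne {n k : J} (h : k ≠ n) (w : FreeGroup J) :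
    FreeGroup.subst n w (FreeGroup.of k) = FreeGroup.of k := by simp [FreeGroup.subst, h]

theorem FreeGroup.subst_one_mk (a : J) (L : List (J × Bool)) :
    FreeGroup.subst a 1 (FreeGroup.mk L) = FreeGroup.mk (L.filter fun l => l.1 ≠ a) := by
  induction L with
  | nil => rfl
  | cons l L ih =>
    have h1 : FreeGroup.mk (l :: L) = FreeGroup.mk [l] * FreeGroup.mk L := by
      rw [FreeGroup.mul_mk]; rfl
    rw [h1, _root_.map_mul, ih]
    obtain ⟨k, ε⟩ := l
    by_cases hk : k = a
    · subst hk
      cases ε <;> simp [FreeGroup.subst]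
    · have : FreeGroup.subst a 1 (FreeGroup.mk [(k, ε)]) = FreeGroup.mk [(k, ε)] := by
        cases ε
        · have : FreeGroup.mk [(k, false)] = (FreeGroup.of k)⁻¹ := rfl
          rw [this, _root_.map_inv, FreeGroup.subst_of_ne hk]
        · exact FreeGroup.subst_of_ne hk 1
      rw [this, FreeGroup.mul_mk]
      simp [hk]

/-- Being fixed under erasure of `a` encodes that `a` does not occur: otherwise erasing it from the
reduced word would give a shorter word for the same element. -/
theorem FreeGroup.ne_of_subst_one_eq {a : J} {h : FreeGroup J} (hh : FreeGroup.subst a 1 h = h)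
    {l : J × Bool} (hl : l ∈ h.toWord) : l.1 ≠ a := by
  intro hla
  have h1 : FreeGroup.mk (h.toWord.filter fun l => l.1 ≠ a) = h := by
    rw [← FreeGroup.subst_one_mk, FreeGroup.mk_toWord, hh]
  have h2 : h.norm ≤ (h.toWord.filter fun l => l.1 ≠ a).length := by
    conv_lhs => rw [← h1]
    exact FreeGroup.norm_mk_le
  have h3 : (h.toWord.filter fun l => l.1 ≠ a).length < h.toWord.length :=
    List.length_filter_lt_length_iff_exists.2 ⟨l, hl, by simp [hla]⟩
  exact absurd h2 (not_le.2 h3)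

/-- Replacing a letter `n` by a word `a b y b⁻¹ x a⁻¹` with new letters `a` and `b` is injective. -/
theorem FreeGroup.eq_one_of_subst_eq_one {n x y a b : J} (hab : a ≠ b) (hax : a ≠ x) (hby : b ≠ y)
    (hbx : b ≠ x) (hbn : b ≠ n)
    {h : FreeGroup J} (ha : FreeGroup.subst a 1 h = h) (hb : FreeGroup.subst b 1 h = h)
    (hn : FreeGroup.subst n (FreeGroup.of a * FreeGroup.of b * FreeGroup.of y *
      (FreeGroup.of b)⁻¹ * FreeGroup.of x * (FreeGroup.of a)⁻¹) h = 1) : h = 1 := by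
  -- Consecutive copies of `a b y b⁻¹ x a⁻¹` cancel at their junction. Replacing `b` by `a⁻¹ b`
  -- turns this word into `b y b⁻¹ a x a⁻¹`, whose copies do not cancel against each other or
  -- against letters other than `a` and `b`; `s` spells this word and its inverse.
  let s : J × Bool → List (J × Bool) := fun l =>
    if l.1 = n then
      bif l.2 then [(b, true), (y, true), (b, false), (a, true), (x, true), (a, false)]
      else [(a, true), (x, false), (a, false), (b, true), (y, false), (b, false)]
    else [l]
  let ψ : FreeGroup J →* FreeGroup J := FreeGroup.subst n (FreeGroup.of b * FreeGroup.of y *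
    (FreeGroup.of b)⁻¹ * FreeGroup.of a * FreeGroup.of x * (FreeGroup.of a)⁻¹)
  have hψ : ∀ L : List (J × Bool), ψ (FreeGroup.mk L) = FreeGroup.mk (L.flatMap s) := by
    intro L
    induction L with
    | nil => rfl
    | cons l L ih =>
      have h1 : FreeGroup.mk (l :: L) = FreeGroup.mk [l] * FreeGroup.mk L := by
        rw [FreeGroup.mul_mk]; rfl
      rw [h1, _root_.map_mul, ih, List.flatMap_cons, ← FreeGroup.mul_mk]
      congr 1
      obtain ⟨k, ε⟩ := l
      by_cases hk : k = n
      · subst hk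
        cases ε
        · have : FreeGroup.mk [(k, false)] = (FreeGroup.of k)⁻¹ := rfl
          rw [this, _root_.map_inv, FreeGroup.subst_of_self]
          simp [s, FreeGroup.of, FreeGroup.mul_mk, FreeGroup.inv_mk, FreeGroup.invRev]
        · have : FreeGroup.mk [(k, true)] = (FreeGroup.of k) := rfl
          rw [this, FreeGroup.subst_of_self]
          simp [s, FreeGroup.of, FreeGroup.mul_mk, FreeGroup.inv_mk, FreeGroup.invRev]
      · have hs : s (k, ε) = [(k, ε)] := by simp [s, hk]
        rw [hs]
        cases ε
        · have : FreeGroup.mk [(k, false)] = (FreeGroup.of k)⁻¹ := rfl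
          rw [this, _root_.map_inv, FreeGroup.subst_of_ne hk]
        · exact FreeGroup.subst_of_ne hk _
  -- The first letter of the image is carried through the induction, since reducedness must be
  -- checked at the junction with the next letter's image.
  have hred : ∀ L : List (J × Bool), FreeGroup.IsReduced L → (∀ l ∈ L, l.1 ≠ a) →
      (∀ l ∈ L, l.1 ≠ b) → FreeGroup.IsReduced (L.flatMap s) ∧
        (L.flatMap s).head? = L.head?.bind fun l => (s l).head? := by
    intro L
    induction L with
    | nil => intro _ _ _; simp [FreeGroup.IsReduced.nil]
    | cons l L ih =>
      intro hL hLa hLb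
      obtain ⟨ih1, ih2⟩ := ih (hL.infix (List.suffix_cons l L).isInfix)
        (fun m hm => hLa m (List.mem_cons_of_mem _ hm))
        (fun m hm => hLb m (List.mem_cons_of_mem _ hm))
      obtain ⟨k, ε⟩ := l
      have hka := hLa (k, ε) List.mem_cons_self
      have hkb := hLb (k, ε) List.mem_cons_self
      simp only at hka hkb
      refine ⟨?_, ?_⟩
      · rw [List.flatMap_cons, FreeGroup.IsReduced, List.isChain_append]
        refine ⟨?_, ih1, ?_⟩
        · by_cases hk : k = n
          · cases ε <;> simp [s, hk, hab, hab.symm, hax, hax.symm, hby, hby.symm]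
          · simp [s, hk]
        · rw [ih2]
          cases L with
          | nil => simp
          | cons m L =>
            obtain ⟨k', ε'⟩ := m
            have hka' := hLa (k', ε') (by simp)
            have hkb' := hLb (k', ε') (by simp)
            have hr : k = k' → ε = ε' := (FreeGroup.isReduced_cons_cons.1 hL).1
            simp only at hka' hkb'
            by_cases hk : k = n <;> by_cases hk' : k' = n
            · have := hr (hk.trans hk'.symm)
              subst this
              cases ε <;> simp [s, hk, hk', hab, hab.symm]
            · cases ε <;> simp [s, hk, hk', hka'.symm, hkb'.symm]
            · cases ε' <;> simp [s, hk, hk', hka, hkb]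
            · have hs1 : s (k, ε) = [(k, ε)] := by simp [s, hk]
              have hs2 : s (k', ε') = [(k', ε')] := by simp [s, hk']
              intro u hu v hv
              simp [hs1] at hu
              simp [hs2] at hv
              subst hu hv
              exact hr
      · by_cases hk : k = n
        · cases ε <;> simp [s, hk]
        · simp [s, hk]
  obtain ⟨h1, h2⟩ := hred h.toWord FreeGroup.isReduced_toWord
    (fun l => FreeGroup.ne_of_subst_one_eq ha) (fun l => FreeGroup.ne_of_subst_one_eq hb)
  -- The two homomorphisms need to agree only on words without `b`; erasing `b` beforehand makes
  -- this an identity of homomorphisms, to be checked on generators.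
  have key : ((FreeGroup.subst b ((FreeGroup.of a)⁻¹ * FreeGroup.of b)).comp
      (FreeGroup.subst n (FreeGroup.of a * FreeGroup.of b * FreeGroup.of y *
      (FreeGroup.of b)⁻¹ * FreeGroup.of x * (FreeGroup.of a)⁻¹))).comp (FreeGroup.subst b 1) =
      ψ.comp (FreeGroup.subst b 1) := by
    ext k
    rcases eq_or_ne k b with rfl | hkb
    · simp
    rcases eq_or_ne k n with rfl | hkn
    · simp [ψ, FreeGroup.subst_of_ne hkb, FreeGroup.subst_of_ne hab, FreeGroup.subst_of_ne hbx.symm,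
        FreeGroup.subst_of_ne hby.symm, mul_assoc]
    · simp [ψ, FreeGroup.subst_of_ne hkb, FreeGroup.subst_of_ne hkn]
  have h3 := DFunLike.congr_fun key h
  simp only [MonoidHom.comp_apply] at h3
  rw [hb, hn, _root_.map_one] at h3
  have h4 : FreeGroup.mk (h.toWord.flatMap s) = 1 := by rw [← hψ, FreeGroup.mk_toWord, ← h3]
  have h5 : h.toWord.flatMap s = [] := by
    rw [← h1.reduce_eq, ← FreeGroup.toWord_mk, h4, FreeGroup.toWord_one]
  rw [← FreeGroup.toWord_eq_nil_iff]
  rw [h5] at h2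
  cases hw : h.toWord with
  | nil => rfl
  | cons l L =>
    exfalso
    rw [hw] at h2
    obtain ⟨k, ε⟩ := l
    by_cases hk : k = n
    · cases ε <;> simp [s, hk] at h2
    · simp [s, hk] at h2

end FreeGroupSubstitution

/-! ### Holonomy under maps that replace a circle by a loop. -/

/-- `circlePos` as a point of the unit interval. -/
noncomputable def circlePosI (u : Circle) : I :=
  ⟨circlePos u, (circleDepth_nonneg u).trans (circleDepth_le_circlePos u), (circlePos_lt_one u).le⟩

theorem continuousAt_circlePosI {u : Circle} (hu : u ≠ -1) : ContinuousAt circlePosI u :=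
  Topology.IsInducing.subtypeVal.continuousAt_iff.2 (continuousAt_circlePos hu)

theorem circlePosI_of_nonneg {u : Circle} (h : 0 ≤ (u : ℂ).im) :
    (circlePosI u : ℝ) = circleDepth u := by simp [circlePosI, circlePos, h]

theorem circlePosI_of_neg {u : Circle} (h : (u : ℂ).im < 0) :
    (circlePosI u : ℝ) = 1 - circleDepth u := by simp [circlePosI, circlePos, not_le.2 h]

/-- The position jumps at `-1`: nearby points have positions close to `0` on the first half of the
circle and close to `1` on the second. -/
theorem eventually_circlePosI {P : I → Prop} (h0 : ∀ᶠ t in 𝓝 0, P t) (h1 : ∀ᶠ t in 𝓝 1, P t) :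
    ∀ᶠ u in 𝓝 (-1 : Circle), P (circlePosI u) := by
  have hd : Tendsto circleDepth (𝓝 (-1)) (𝓝 0) := by
    have := continuous_circleDepth.tendsto (-1)
    rwa [circleDepth_neg_one] at this
  rw [Metric.eventually_nhds_iff] at h0 h1
  obtain ⟨ε, hε, h0⟩ := h0
  obtain ⟨δ, hδ, h1⟩ := h1
  filter_upwards [hd.eventually_lt_const hε, hd.eventually_lt_const hδ] with u hu hu'
  rcases le_or_gt 0 (u : ℂ).im with h | h
  · refine h0 ?_
    rw [Subtype.dist_eq, circlePosI_of_nonneg h, Icc.coe_zero, Real.dist_eq, sub_zero,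
      abs_of_nonneg (circleDepth_nonneg u)]
    exact hu
  · refine h1 ?_
    rw [Subtype.dist_eq, circlePosI_of_neg h, Icc.coe_one, Real.dist_eq, sub_sub_cancel_left,
      abs_neg, abs_of_nonneg (circleDepth_nonneg u)]
    exact hu'

namespace CircleCoords

variable {X J : Type*} [TopologicalSpace X] {c : CircleCoords X J} {S : Finset J}

/-- The change of a horizontal lift along a path that stays in the interior of one circle between
two base points. -/
theorem Horizontal.eq_mul_of_crossing {f : I → X} {g : I → FreeGroup J} (hg : c.Horizontal S f g)
    {j : J} (hj : j ∈ S) {s t : I} (hst : s < t) (hs : c.IsBase (f s)) (ht : c.IsBase (f t))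
    (h : ∀ z ∈ Ioo s t, c.coord j (f z) ≠ -1) {v w : FreeGroup J}
    (hv : ∀ᶠ z in 𝓝[>] s, c.jump S (f z) = v) (hw : ∀ᶠ z in 𝓝[<] t, c.jump S (f z) = w) :
    g t = g s * v⁻¹ * w := by
  have h1 := (hg s).1 hs.mem_awayMid
  have h2 := (hg t).1 ht.mem_awayMid
  rw [hs.jump, mul_one] at h1
  rw [ht.jump, mul_one] at h2
  have : (𝓝[>] s).NeBot := nhdsGT_neBot_of_exists_gt ⟨t, hst⟩
  have : (𝓝[<] t).NeBot := nhdsLT_neBot_of_exists_lt ⟨s, hst⟩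
  obtain ⟨a, ha1, ha2, ha3⟩ := (hv.and ((h1.filter_mono nhdsWithin_le_nhds).and
    (Ioo_mem_nhdsGT hst))).exists
  obtain ⟨b, hb1, hb2, hb3⟩ := (hw.and ((h2.filter_mono nhdsWithin_le_nhds).and
    (Ioo_mem_nhdsLT hst))).exists
  -- Just after `s` the label satisfies `g a * v = g s`, just before `t` it satisfies `g b * w = g
  -- t`, and in between it is constant.
  have hab : g a = g b := IsPreconnected.apply_eq_of_eventually isPreconnected_Ioo
    (fun y hy => (hg y).2 ⟨j, hj, h y hy⟩) ha3 hb3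
  rw [ha1] at ha2
  rw [hb1] at hb2
  rw [← hb2, ← hab, ← ha2]
  group

variable {Y : Type*} [TopologicalSpace Y] {d : CircleCoords Y J}

theorem jump_congr {x : X} {y : Y} (h : ∀ k, d.coord k y = c.coord k x) :
    d.jump S y = c.jump S x := by
  simp only [jump, h]

open Classical in
/-- If `k` maps the circle `n` by a loop `l` and preserves the other circles, then the holonomy of
`k ∘ f` results from that of `f` by the substitution of the holonomy of `l` for the letter `n`. -/
theorem hol_comp_eq_subst {n : J} (hn : n ∈ S) {k : X → Y} {l : I → Y} {G : I → FreeGroup J}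
    (hG : d.Horizontal S l G) (hG0 : G 0 = 1) (hl0 : d.IsBase (l 0)) (hl1 : d.IsBase (l 1))
    (hk : ∀ x, c.coord n x = -1 → ∀ i, d.coord i (k x) = c.coord i x)
    (hkn : ∀ x, c.coord n x ≠ -1 → k x = l (circlePosI (c.coord n x)))
    {f : I → X} (hf : Continuous f) (hf0 : c.IsBase (f 0)) (hf1 : c.IsBase (f 1)) :
    d.hol S (fun t => k (f t)) = FreeGroup.subst n (G 1) (c.hol S f) := by
  obtain ⟨g, hg, hg0⟩ := exists_horizontal_path (c := c) (S := S) hf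
  rw [hg.hol_eq hg0]
  let φ := FreeGroup.subst n (G 1)
  -- The lift of `k ∘ f`: the substituted label of the lift of `f`, advanced along the lift `G` of
  -- the loop `l` while `f` is inside the circle `n`.
  let G' : I → FreeGroup J := fun t => φ (g t) *
    if c.coord n (f t) = -1 then 1 else G (circlePosI (c.coord n (f t)))
  have hcn : Continuous fun t => c.coord n (f t) := (c.continuous_coord n).comp hf
  have hG' : d.Horizontal S (fun t => k (f t)) G' := by
    intro y
    by_cases hy : c.coord n (f y) = -1
    · have hGy : G' y = φ (g y) := by simp [G', hy]
      by_cases hin : f y ∈ c.inside S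
      · obtain ⟨i, hi, hiy⟩ := id hin
        have hev : ∀ᶠ z in 𝓝 y, c.coord n (f z) = -1 := by
          have h1 : ∀ᶠ z in 𝓝 y, c.coord i (f z) ≠ -1 :=
            ((c.continuous_coord i).comp hf).continuousAt.eventually_ne hiy
          have hni : n ≠ i := fun h => hiy (h ▸ hy)
          filter_upwards [h1] with z hz using coord_eq_of_ne hz hni
        have hcon : ∀ᶠ z in 𝓝 y, G' z = G' y := by
          filter_upwards [hev, (hg y).2 hin] with z hz hz'
          rw [hGy]
          simp [G', hz, hz']
        refine ⟨fun haw => ?_, fun _ => hcon⟩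
        have haw' : f y ∈ c.awayMid S := fun i hi => by
          rw [← hk _ hy]; exact haw i hi
        filter_upwards [hev, hcon, hf.continuousAt.eventually (eventually_jump_eq haw' hin)]
          with z hz hz1 hz2
        rw [hz1, jump_congr (hk _ hz), jump_congr (hk _ hy), hz2]
      · refine ⟨fun _ => ?_, fun hin' => absurd ?_ hin⟩
        swap
        · obtain ⟨i, hi, hi'⟩ := hin'
          exact ⟨i, hi, by rwa [← hk _ hy]⟩
        have h1 := (hg y).1 (mem_awayMid_of_notMem_inside hin)
        rw [jump_of_notMem_inside hin, mul_one] at h1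
        rw [hGy, jump_congr (hk _ hy), jump_of_notMem_inside hin, mul_one]
        have h2 := (hG 0).1 hl0.mem_awayMid
        have h3 := (hG 1).1 hl1.mem_awayMid
        rw [hl0.jump, mul_one, hG0] at h2
        rw [hl1.jump, mul_one] at h3
        have hd : Tendsto (fun t => c.coord n (f t)) (𝓝 y) (𝓝 (-1)) := by
          have := hcn.tendsto y
          rwa [hy] at this
        -- Near the base point of the circle `n`, the loop `l` has either just begun, with nearest
        -- vertex `1`, or almost ended, with nearest vertex `G 1`.
        have h4 : ∀ᶠ z in 𝓝 y, (0 ≤ ((c.coord n (f z) : Circle) : ℂ).im →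
            G (circlePosI (c.coord n (f z))) * d.jump S (l (circlePosI (c.coord n (f z)))) = 1) ∧
            (((c.coord n (f z) : Circle) : ℂ).im < 0 →
            G (circlePosI (c.coord n (f z))) * d.jump S (l (circlePosI (c.coord n (f z)))) =
              G 1) := by
          refine hd.eventually (p := fun u : Circle => (0 ≤ (u : ℂ).im →
            G (circlePosI u) * d.jump S (l (circlePosI u)) = 1) ∧ ((u : ℂ).im < 0 →
            G (circlePosI u) * d.jump S (l (circlePosI u)) = G 1)) ?_
          have hz : ∀ᶠ u in 𝓝 (-1 : Circle), circleDepth u < 1 / 2 := by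
            refine continuous_circleDepth.continuousAt.eventually_lt_const ?_
            rw [circleDepth_neg_one]; norm_num
          have h5 := eventually_circlePosI (P := fun t => ((t : ℝ) < 1 / 2 →
            G t * d.jump S (l t) = 1) ∧ (1 / 2 < (t : ℝ) → G t * d.jump S (l t) = G 1)) ?_ ?_
          · filter_upwards [h5, hz] with u hu hu'
            refine ⟨fun h => hu.1 ?_, fun h => hu.2 ?_⟩
            · rwa [circlePosI_of_nonneg h]
            · rw [circlePosI_of_neg h]; linarith
          · have : ∀ᶠ t : I in 𝓝 0, (t : ℝ) < 1 / 2 :=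
              continuous_subtype_val.continuousAt.eventually_lt_const (by norm_num)
            filter_upwards [h2, this] with t ht ht'
            exact ⟨fun _ => ht, fun h => absurd h (by linarith)⟩
          · have : ∀ᶠ t : I in 𝓝 1, 1 / 2 < (t : ℝ) :=
              continuous_subtype_val.continuousAt.eventually_const_lt (by norm_num)
            filter_upwards [h3, this] with t ht ht'
            exact ⟨fun h => absurd h (by linarith), fun _ => ht⟩
        filter_upwards [h1, h4] with z hz hz4
        by_cases hzn : c.coord n (f z) = -1
        · have hne : φ (c.jump S (f z)) = c.jump S (f z) := by
            by_cases hex : ∃ i ∈ S, ((c.coord i (f z) : Circle) : ℂ).im < 0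
            · obtain ⟨i, hi, hi'⟩ := hex
              rw [jump_of_neg hi hi']
              refine FreeGroup.subst_of_ne ?_ _
              rintro rfl
              exact ne_of_im_neg hi' hzn
            · push Not at hex
              rw [jump_of_forall hex, _root_.map_one]
          simp only [G', hzn, if_true, mul_one]
          rw [jump_congr (hk _ hzn), ← hne, ← _root_.map_mul, hz]
        · simp only [G', hzn, if_false]
          rw [hkn _ hzn, ← hz, mul_assoc]
          rcases le_or_gt 0 ((c.coord n (f z) : Circle) : ℂ).im with him | him
          · rw [hz4.1 him, jump_of_nonneg hzn him, mul_one, mul_one]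
          · rw [hz4.2 him, jump_of_neg hn him, _root_.map_mul, FreeGroup.subst_of_self]
    · have hin : f y ∈ c.inside S := ⟨n, hn, hy⟩
      have hev : ∀ᶠ z in 𝓝 y, c.coord n (f z) ≠ -1 := hcn.continuousAt.eventually_ne hy
      have hpos : ContinuousAt (fun z => circlePosI (c.coord n (f z))) y :=
        (continuousAt_circlePosI hy).comp hcn.continuousAt (f := fun z => c.coord n (f z))
      refine ⟨fun haw => ?_, fun hin' => ?_⟩
      · simp only [hkn _ hy] at haw
        filter_upwards [hev, (hg y).2 hin, hpos.eventually ((hG _).1 haw)] with z hz hz1 hz2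
        simp only [G', hz, hy, if_false, hz1, hkn _ hz, hkn _ hy, mul_assoc]
        rw [hz2]
      · simp only [hkn _ hy] at hin'
        filter_upwards [hev, (hg y).2 hin, hpos.eventually ((hG _).2 hin')] with z hz hz1 hz2
        simp only [G', hz, hy, if_false, hz1, hz2]
  have h0 : G' 0 = 1 := by simp [G', hg0, hf0 n]
  rw [hG'.hol_eq h0]
  simp [G', hf1 n, φ]

open Classical in
/-- The holonomy does not involve circles that a space does not meet. -/
theorem subst_one_hol {n : J} (hn : n ∈ S) (h : ∀ x, c.coord n x = -1) {f : I → X}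
    (hf : Continuous f) (hf0 : c.IsBase (f 0)) (hf1 : c.IsBase (f 1)) :
    FreeGroup.subst n 1 (c.hol S f) = c.hol S f := by
  -- The identity map may be regarded as replacing the circle `n` by a constant loop, since no point
  -- lies inside that circle.
  have hG : c.Horizontal S (fun _ : I => f 0) (fun _ => 1) := fun y =>
    ⟨fun _ => .of_forall fun _ => rfl, fun _ => .of_forall fun _ => rfl⟩
  exact (hol_comp_eq_subst hn (k := fun x => x) hG rfl hf0 hf0 (fun _ _ _ => rfl)
    (fun x hx => absurd (h x) hx) hf hf0 hf1).symm

end CircleCoords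

/-! ### Points on the circle with given real part, and its parametrization. -/

/-- The point of the unit circle with real part `c` (clipped to `[-1, 1]`) whose imaginary part has
the sign of `y`. -/
noncomputable def circleOver (c y : ℝ) : Circle :=
  ⟨⟨max (-1) (min 1 c), if 0 ≤ y then √(1 - (max (-1) (min 1 c)) ^ 2)
    else -√(1 - (max (-1) (min 1 c)) ^ 2)⟩, by
    have h1 : -1 ≤ max (-1) (min 1 c) := le_max_left _ _
    have h2 : max (-1) (min 1 c) ≤ 1 := max_le (by norm_num) (min_le_left _ _)
    have h3 : (0 : ℝ) ≤ 1 - (max (-1) (min 1 c)) ^ 2 := by nlinarith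
    refine mem_sphere_zero_iff_norm.2 ?_
    have : Complex.normSq ⟨max (-1) (min 1 c), if 0 ≤ y then √(1 - (max (-1) (min 1 c)) ^ 2)
        else -√(1 - (max (-1) (min 1 c)) ^ 2)⟩ = 1 := by
      rw [Complex.normSq_mk]
      split_ifs
      · rw [Real.mul_self_sqrt h3]; ring
      · rw [neg_mul_neg, Real.mul_self_sqrt h3]; ring
    rw [← Complex.sq_norm] at this
    have h0 := norm_nonneg (⟨max (-1) (min 1 c), if 0 ≤ y then √(1 - (max (-1) (min 1 c)) ^ 2)
        else -√(1 - (max (-1) (min 1 c)) ^ 2)⟩ : ℂ)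
    nlinarith⟩

theorem circleOver_re (c y : ℝ) : (circleOver c y : ℂ).re = max (-1) (min 1 c) := rfl

theorem circleOver_re_of_mem {c : ℝ} (h1 : -1 ≤ c) (h2 : c ≤ 1) (y : ℝ) :
    (circleOver c y : ℂ).re = c := by
  rw [circleOver_re, min_eq_right h2, max_eq_right h1]

theorem circleOver_im (c y : ℝ) : (circleOver c y : ℂ).im =
    if 0 ≤ y then √(1 - (max (-1) (min 1 c)) ^ 2) else -√(1 - (max (-1) (min 1 c)) ^ 2) := rfl

theorem circleOver_im_nonneg {c y : ℝ} (h : 0 ≤ y) : 0 ≤ (circleOver c y : ℂ).im := by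
  rw [circleOver_im, if_pos h]; positivity

theorem circleOver_im_neg {c y : ℝ} (h1 : -1 < c) (h2 : c < 1) (h : y < 0) :
    (circleOver c y : ℂ).im < 0 := by
  rw [circleOver_im, if_neg (not_le.2 h), min_eq_right h2.le, max_eq_right h1.le, neg_lt_zero]
  exact Real.sqrt_pos.2 (by nlinarith)

theorem circleOver_of_le {c : ℝ} (h : c ≤ -1) (y : ℝ) : circleOver c y = -1 := by
  apply Circle.eq_neg_one_of_re
  rw [circleOver_re, max_eq_left]
  exact (min_le_right _ _).trans h

theorem circleOver_of_ge {c : ℝ} (h : 1 ≤ c) (y : ℝ) : circleOver c y = 1 := by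
  ext
  apply Complex.ext
  · rw [circleOver_re, min_eq_left h]; simp
  · rw [circleOver_im, min_eq_left h]; simp

theorem circleOver_ne {c : ℝ} (h : -1 < c) (y : ℝ) : circleOver c y ≠ -1 := by
  intro h'
  have := congrArg (fun u : Circle => (u : ℂ).re) h'
  simp only [circleOver_re, Circle.coe_neg_one', Complex.neg_re, Complex.one_re] at this
  have h2 : -1 < max (-1) (min 1 c) := lt_max_of_lt_right (lt_min (by norm_num) h)
  linarith

theorem circleOver_re_im (u : Circle) : circleOver (u : ℂ).re (u : ℂ).im = u := by
  have h := u.re_sq_add_im_sq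
  have h1 : -1 ≤ (u : ℂ).re := by nlinarith
  have h2 : (u : ℂ).re ≤ 1 := by nlinarith
  ext
  apply Complex.ext
  · exact circleOver_re_of_mem h1 h2 _
  · rw [circleOver_im, min_eq_right h2, max_eq_right h1]
    have h3 : 1 - (u : ℂ).re ^ 2 = (u : ℂ).im ^ 2 := by linarith
    rw [h3, Real.sqrt_sq_eq_abs]
    split_ifs with h4
    · exact abs_of_nonneg h4
    · rw [abs_of_neg (not_le.1 h4), neg_neg]

/-- The sign of the imaginary part is ambiguous only where `y = 0`; there the clipped real part is
`1` or `-1`, and both choices give imaginary part zero. -/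
theorem continuous_circleOver {Z : Type*} [TopologicalSpace Z] {c y : Z → ℝ} (hc : Continuous c)
    (hy : Continuous y) (h : ∀ z, y z = 0 → c z ≤ -1 ∨ 1 ≤ c z) :
    Continuous fun z => circleOver (c z) (y z) := by
  refine Continuous.subtype_mk ?_ _
  refine Complex.equivRealProdCLM.symm.continuous.comp (Continuous.prodMk (by fun_prop) ?_)
  refine Continuous.if_le (by fun_prop) (by fun_prop) continuous_const hy fun z hz => ?_
  have : 1 - (max (-1) (min 1 (c z))) ^ 2 = 0 := by
    rcases h z hz.symm with h | h
    · rw [max_eq_left ((min_le_right _ _).trans h)]; norm_num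
    · rw [min_eq_left h]; norm_num
  simp [this]

/-- The clockwise parametrization of the unit circle, starting at `-1`, inverse to `circlePos`;
it is constant outside `[0, 1]`. -/
noncomputable def circleParam (t : ℝ) : Circle := circleOver (1 - |4 * t - 2|) (1 - 2 * t)

theorem continuous_circleParam : Continuous circleParam :=
  continuous_circleOver (by fun_prop) (by fun_prop) fun t ht => by
    right; rw [show 4 * t - 2 = 0 by linarith]; simp

theorem circleParam_eq_neg_one {t : ℝ} (h : t ≤ 0 ∨ 1 ≤ t) : circleParam t = -1 := by
  refine circleOver_of_le ?_ _
  rcases h with h | h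
  · rw [abs_of_nonpos (by linarith)]; linarith
  · rw [abs_of_nonneg (by linarith)]; linarith

theorem circleParam_ne {t : ℝ} (h0 : 0 < t) (h1 : t < 1) : circleParam t ≠ -1 := by
  refine circleOver_ne ?_ _
  have : |4 * t - 2| < 2 := abs_lt.2 ⟨by linarith, by linarith⟩
  linarith

theorem circleParam_im_nonneg {t : ℝ} (h : t ≤ 1 / 2) : 0 ≤ (circleParam t : ℂ).im :=
  circleOver_im_nonneg (by linarith)

theorem circleParam_im_neg {t : ℝ} (h : 1 / 2 < t) (h1 : t < 1) : (circleParam t : ℂ).im < 0 := by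
  refine circleOver_im_neg ?_ ?_ (by linarith)
  · rw [abs_of_pos (by linarith)]; linarith
  · rw [abs_of_pos (by linarith)]; linarith

theorem circleParam_re {t : ℝ} (h0 : 0 ≤ t) (h1 : t ≤ 1) :
    (circleParam t : ℂ).re = 1 - |4 * t - 2| := by
  refine circleOver_re_of_mem ?_ ?_ _
  · have : |4 * t - 2| ≤ 2 := abs_le.2 ⟨by linarith, by linarith⟩
    linarith
  · have := abs_nonneg (4 * t - 2)
    linarith

theorem circlePos_circleParam {t : ℝ} (h0 : 0 ≤ t) (h1 : t < 1) : circlePos (circleParam t) = t := by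
  have hre := circleParam_re h0 h1.le
  rcases le_or_gt t (1 / 2) with h | h
  · rw [circlePos, if_pos (circleParam_im_nonneg h), circleDepth, hre, abs_of_nonpos (by linarith)]
    ring
  · rw [circlePos, if_neg (not_le.2 (circleParam_im_neg h h1)), circleDepth, hre,
      abs_of_pos (by linarith)]
    ring

theorem circleParam_circlePos (u : Circle) : circleParam (circlePos u) = u :=
  circlePos_injective (circlePos_circleParam
    ((circleDepth_nonneg u).trans (circleDepth_le_circlePos u)) (circlePos_lt_one u))

theorem continuous_comp_circlePos {Z : Type*} [TopologicalSpace Z] {f : I → Z} (hf : Continuous f)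
    (h : f 0 = f 1) : Continuous fun u => f (circlePosI u) := by
  refine continuous_iff_continuousAt.2 fun u => ?_
  by_cases hu : u = -1
  · subst hu
    have h0 : circlePosI (-1) = 0 := Subtype.ext circlePos_neg_one
    intro V hV
    simp only [h0] at hV
    refine eventually_circlePosI (P := fun t => f t ∈ V) (hf.continuousAt.eventually hV) ?_
    rw [h] at hV
    exact hf.continuousAt.eventually hV
  · exact hf.continuousAt.comp (continuousAt_circlePosI hu)

/-! ### The pair of pants -/

theorem mem_pairOfPants {z : ℂ} : z ∈ pairOfPants ↔ z.re ^ 2 + z.im ^ 2 ≤ 16 ∧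
    1 ≤ (z.re + 2) ^ 2 + z.im ^ 2 ∧ 1 ≤ (z.re - 2) ^ 2 + z.im ^ 2 := by
  have key : ∀ (w : ℂ) (r : ℝ), 0 ≤ r → (‖w‖ ≤ r ↔ w.re ^ 2 + w.im ^ 2 ≤ r ^ 2) := fun w r hr => by
    rw [← Complex.normSq_add_mul_I, Complex.re_add_im, ← Complex.sq_norm]
    exact (pow_le_pow_iff_left₀ (norm_nonneg w) hr two_ne_zero).symm
  have key' : ∀ w : ℂ, 1 ≤ ‖w‖ ↔ 1 ≤ w.re ^ 2 + w.im ^ 2 := fun w => by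
    rw [← Complex.normSq_add_mul_I, Complex.re_add_im, ← Complex.sq_norm,
      one_le_sq_iff₀ (norm_nonneg w)]
  simp only [pairOfPants, Set.mem_sdiff, mem_union, not_or, Metric.mem_ball, not_lt, dist_eq_norm,
    mem_closedBall_zero_iff, key', key z 4 (by norm_num)]
  norm_num

/-- The height over `x` of the inner boundary circles of the pair of pants. -/
noncomputable def pantsHeight (x : ℝ) : ℝ := √(1 - (x + 2) ^ 2) + √(1 - (x - 2) ^ 2)

theorem continuous_pantsHeight : Continuous pantsHeight := by unfold pantsHeight; fun_prop

theorem pantsHeight_nonneg (x : ℝ) : 0 ≤ pantsHeight x := by unfold pantsHeight; positivity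

/-- The square root is zero at negative arguments, so the second inner circle contributes nothing on
this range. -/
theorem pantsHeight_of_nonpos {x : ℝ} (h : x ≤ 1) : pantsHeight x = √(1 - (x + 2) ^ 2) := by
  rw [pantsHeight, Real.sqrt_eq_zero_of_nonpos (x := 1 - (x - 2) ^ 2) (by nlinarith), add_zero]

theorem pantsHeight_of_nonneg {x : ℝ} (h : -1 ≤ x) : pantsHeight x = √(1 - (x - 2) ^ 2) := by
  rw [pantsHeight, Real.sqrt_eq_zero_of_nonpos (x := 1 - (x + 2) ^ 2) (by nlinarith), zero_add]

theorem pantsHeight_eq_zero {x : ℝ} (h : x ≤ -3 ∨ (-1 ≤ x ∧ x ≤ 1) ∨ 3 ≤ x) : pantsHeight x = 0 := by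
  rcases h with h | ⟨h, h'⟩ | h
  · rw [pantsHeight_of_nonpos (by linarith), Real.sqrt_eq_zero_of_nonpos (by nlinarith)]
  · rw [pantsHeight_of_nonpos h', Real.sqrt_eq_zero_of_nonpos (by nlinarith)]
  · rw [pantsHeight_of_nonneg (by linarith), Real.sqrt_eq_zero_of_nonpos (by nlinarith)]

/-- The holes are described by the size of the imaginary part over each real part, which suits
deformations along vertical lines. -/
theorem mem_pairOfPants_iff_height {z : ℂ} : z ∈ pairOfPants ↔ z.re ^ 2 + z.im ^ 2 ≤ 16 ∧
    pantsHeight z.re ≤ |z.im| := by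
  rw [mem_pairOfPants]
  refine and_congr_right fun _ => ?_
  rcases le_total z.re 0 with h | h
  · rw [pantsHeight_of_nonpos (by linarith), Real.sqrt_le_iff, sq_abs]
    exact ⟨fun ⟨h1, _⟩ => ⟨abs_nonneg _, by linarith⟩, fun ⟨_, h1⟩ => ⟨by linarith, by nlinarith⟩⟩
  · rw [pantsHeight_of_nonneg (by linarith), Real.sqrt_le_iff, sq_abs]
    exact ⟨fun ⟨_, h1⟩ => ⟨abs_nonneg _, by linarith⟩, fun ⟨_, h1⟩ => ⟨by nlinarith, by linarith⟩⟩

theorem pantsHeight_pos {x : ℝ} (h : (-3 < x ∧ x < -1) ∨ (1 < x ∧ x < 3)) : 0 < pantsHeight x := by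
  rcases h with ⟨h, h'⟩ | ⟨h, h'⟩
  · rw [pantsHeight_of_nonpos (by linarith)]; exact Real.sqrt_pos.2 (by nlinarith)
  · rw [pantsHeight_of_nonneg (by linarith)]; exact Real.sqrt_pos.2 (by nlinarith)

theorem pantsHeight_eq_zero_of_im {z : ℂ} (hz : z ∈ pairOfPants) (h : z.im = 0) :
    pantsHeight z.re = 0 := by
  have := (mem_pairOfPants_iff_height.1 hz).2
  rw [h, abs_zero] at this
  exact this.antisymm (pantsHeight_nonneg _)

theorem re_of_im_eq_zero {z : ℂ} (hz : z ∈ pairOfPants) (h : z.im = 0) :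
    z.re ≤ -3 ∨ (-1 ≤ z.re ∧ z.re ≤ 1) ∨ 3 ≤ z.re := by
  have h1 := pantsHeight_eq_zero_of_im hz h
  by_contra hc
  push Not at hc
  obtain ⟨h2, h3, h4⟩ := hc
  rcases lt_or_ge z.re (-1) with h5 | h5
  · exact (pantsHeight_pos (Or.inl ⟨h2, h5⟩)).ne' h1
  · exact (pantsHeight_pos (Or.inr ⟨h3 h5, h4⟩)).ne' h1

theorem ofReal_mem_pairOfPants {x : ℝ} (h : (-4 ≤ x ∧ x ≤ -3) ∨ (-1 ≤ x ∧ x ≤ 1)) :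
    (x : ℂ) ∈ pairOfPants := by
  rw [mem_pairOfPants_iff_height, Complex.ofReal_re, Complex.ofReal_im,
    pantsHeight_eq_zero (by tauto)]
  refine ⟨?_, by simp⟩
  rcases h with ⟨h, h'⟩ | ⟨h, h'⟩ <;> nlinarith

theorem re_mem_of_mem_pairOfPants {z : ℂ} (hz : z ∈ pairOfPants) : -4 ≤ z.re ∧ z.re ≤ 4 := by
  have := (mem_pairOfPants.1 hz).1
  constructor <;> nlinarith [sq_nonneg z.im]

theorem continuous_pants_re : Continuous fun z : pairOfPants => (z : ℂ).re :=
  Complex.continuous_re.comp continuous_subtype_val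

theorem continuous_pants_im : Continuous fun z : pairOfPants => (z : ℂ).im :=
  Complex.continuous_im.comp continuous_subtype_val

theorem continuous_outerBoundary : Continuous outerBoundary :=
  (continuous_const.mul continuous_subtype_val).subtype_mk _

/-- The retraction of the interval `[-4, 4]` onto `[-4, 3]` that collapses `[-1, 0]` to `-1`. -/
noncomputable def pantsFold (x : ℝ) : ℝ := min 3 (max (min x (-1)) (min x (2 * x - 1)))

theorem continuous_pantsFold : Continuous pantsFold := by unfold pantsFold; fun_prop

theorem pantsFold_of_le {x : ℝ} (h : x ≤ -1) : pantsFold x = x := by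
  simp only [pantsFold, min_def, max_def]; split_ifs <;> linarith

theorem pantsFold_of_mem {x : ℝ} (h : -1 ≤ x) (h' : x ≤ 0) : pantsFold x = -1 := by
  simp only [pantsFold, min_def, max_def]; split_ifs <;> linarith

theorem pantsFold_of_mem' {x : ℝ} (h : 0 ≤ x) (h' : x ≤ 1) : pantsFold x = 2 * x - 1 := by
  simp only [pantsFold, min_def, max_def]; split_ifs <;> linarith

theorem pantsFold_of_ge {x : ℝ} (h : 1 ≤ x) : pantsFold x = min 3 x := by
  simp only [pantsFold, min_def, max_def]; split_ifs <;> linarith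

theorem pantsFold_mem_of_mem {x : ℝ} (h : -1 ≤ x) (h' : x ≤ 1) :
    -1 ≤ pantsFold x ∧ pantsFold x ≤ 1 := by
  rcases le_total x 0 with h0 | h0
  · rw [pantsFold_of_mem h h0]; norm_num
  · rw [pantsFold_of_mem' h0 h']; constructor <;> linarith

/-- The retraction of the pair of pants, along vertical lines and the real axis, onto its two
inner circles and the real segments that connect them with each other and with `-4`. -/
noncomputable def pantsSpine (z : ℂ) : ℂ :=
  ⟨pantsFold z.re, if 0 ≤ z.im then pantsHeight (pantsFold z.re) else -pantsHeight (pantsFold z.re)⟩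

theorem pantsHeight_fold_eq_zero {z : ℂ} (hz : z ∈ pairOfPants) (h : z.im = 0) :
    pantsHeight (pantsFold z.re) = 0 := by
  rcases re_of_im_eq_zero hz h with h1 | ⟨h1, h2⟩ | h1
  · rw [pantsFold_of_le (by linarith), pantsHeight_eq_zero (Or.inl h1)]
  · exact pantsHeight_eq_zero (Or.inr (Or.inl (pantsFold_mem_of_mem h1 h2)))
  · rw [pantsFold_of_ge (by linarith), min_eq_left h1, pantsHeight_eq_zero (Or.inr (Or.inr le_rfl))]

theorem continuous_pantsSpine : Continuous fun z : pairOfPants => pantsSpine z := by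
  have h1 := continuous_pantsFold.comp continuous_pants_re
  have h2 := continuous_pantsHeight.comp h1
  refine Complex.equivRealProdCLM.symm.continuous.comp (Continuous.prodMk h1 ?_)
  refine Continuous.if_le h2 h2.neg continuous_const continuous_pants_im fun z hz => ?_
  have := pantsHeight_fold_eq_zero z.2 hz.symm
  simp [this]

theorem pantsHeight_le_one {x : ℝ} : pantsHeight x ≤ 1 := by
  rcases le_total x 0 with h | h
  · rw [pantsHeight_of_nonpos (by linarith)]
    refine Real.sqrt_le_iff.2 ⟨zero_le_one, ?_⟩
    nlinarith [sq_nonneg (x + 2)]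
  · rw [pantsHeight_of_nonneg (by linarith)]
    refine Real.sqrt_le_iff.2 ⟨zero_le_one, ?_⟩
    nlinarith [sq_nonneg (x - 2)]

theorem pantsSpine_im_sq (z : ℂ) : (pantsSpine z).im ^ 2 = pantsHeight (pantsFold z.re) ^ 2 := by
  simp only [pantsSpine]; split_ifs <;> ring

theorem pantsSpine_sq_le {z : ℂ} (hz : z ∈ pairOfPants) :
    (pantsSpine z).re ^ 2 + (pantsSpine z).im ^ 2 ≤ 16 := by
  rw [pantsSpine_im_sq]
  change pantsFold z.re ^ 2 + _ ≤ _
  rcases le_total z.re (-3) with h | h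
  · rw [pantsFold_of_le (by linarith), pantsHeight_eq_zero (Or.inl h)]
    have := (re_mem_of_mem_pairOfPants hz).1
    nlinarith
  · have h1 : pantsFold z.re ^ 2 ≤ 9 := by
      have h2 : pantsFold z.re ≤ 3 := min_le_left _ _
      have h3 : -3 ≤ pantsFold z.re := by
        refine le_min (by norm_num) (le_max_of_le_left (le_min h (by norm_num)))
      nlinarith
    have h4 := pantsHeight_le_one (x := pantsFold z.re)
    have h5 := pantsHeight_nonneg (pantsFold z.re)
    nlinarith

theorem fold_eq_or_of_mem (x : ℝ) : pantsFold x = x ∨ (-1 ≤ x ∧ x ≤ 1 ∧ -1 ≤ pantsFold x ∧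
    pantsFold x ≤ 1) ∨ (3 ≤ x ∧ pantsFold x = 3) := by
  rcases le_total x (-1) with h | h
  · exact Or.inl (pantsFold_of_le h)
  rcases le_total x 1 with h1 | h1
  · exact Or.inr (Or.inl ⟨h, h1, pantsFold_mem_of_mem h h1⟩)
  · rcases le_total x 3 with h2 | h2
    · left; rw [pantsFold_of_ge h1, min_eq_right h2]
    · right; right; exact ⟨h2, by rw [pantsFold_of_ge h1, min_eq_left h2]⟩

/-- The disk is convex. For the holes there are three cases: the segment is vertical and keeps the
side of the real axis, or it stays in the strip between the holes, or it stays to the right of the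
second hole. -/
theorem pants_segment_mem {z : ℂ} (hz : z ∈ pairOfPants) {s : ℝ} (h0 : 0 ≤ s) (h1 : s ≤ 1) :
    (1 - s) * z + s * pantsSpine z ∈ pairOfPants := by
  have hre : ((1 - s) * z + s * pantsSpine z).re = (1 - s) * z.re + s * (pantsSpine z).re := by
    simp
  have him : ((1 - s) * z + s * pantsSpine z).im = (1 - s) * z.im + s * (pantsSpine z).im := by
    simp
  rw [mem_pairOfPants_iff_height, hre, him]
  obtain ⟨hz1, hz2⟩ := mem_pairOfPants_iff_height.1 hz
  constructor
  · have h2 := pantsSpine_sq_le hz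
    have h3 : 0 ≤ s * (1 - s) := mul_nonneg h0 (by linarith)
    have h4 := mul_nonneg h3 (sq_nonneg (z.re - (pantsSpine z).re))
    have h5 := mul_nonneg h3 (sq_nonneg (z.im - (pantsSpine z).im))
    nlinarith
  · change pantsHeight ((1 - s) * z.re + s * pantsFold z.re) ≤ _
    rcases fold_eq_or_of_mem z.re with h | ⟨h2, h3, h4, h5⟩ | ⟨h2, h3⟩
    · rw [h, show (1 - s) * z.re + s * z.re = z.re by ring]
      simp only [pantsSpine, h]
      have hn := pantsHeight_nonneg z.re
      split_ifs with hi
      · rw [abs_of_nonneg hi] at hz2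
        rw [abs_of_nonneg (by nlinarith)]
        nlinarith
      · rw [abs_of_neg (not_le.1 hi)] at hz2
        rw [abs_of_nonpos (by nlinarith)]
        nlinarith
    · rw [pantsHeight_eq_zero (Or.inr (Or.inl ⟨by nlinarith, by nlinarith⟩))]
      exact abs_nonneg _
    · rw [pantsHeight_eq_zero (Or.inr (Or.inr (by nlinarith)))]
      exact abs_nonneg _

/-- The linear homotopy from the identity of the pair of pants to `pantsSpine`. -/
noncomputable def pantsShrink (q : I × pairOfPants) : pairOfPants :=
  ⟨(1 - (q.1 : ℝ)) * q.2 + (q.1 : ℝ) * pantsSpine q.2, pants_segment_mem q.2.2 q.1.2.1 q.1.2.2⟩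

theorem continuous_pantsShrink : Continuous pantsShrink := by
  have h := continuous_pantsSpine.comp (continuous_snd : Continuous fun q : I × pairOfPants => q.2)
  have h1 : Continuous fun q : I × pairOfPants => ((q.1 : ℝ) : ℂ) := by fun_prop
  refine Continuous.subtype_mk ?_ _
  exact ((continuous_const.sub h1).mul (by fun_prop)).add (h1.mul h)

theorem pantsShrink_zero (z : pairOfPants) : pantsShrink (0, z) = z := by
  ext; simp [pantsShrink]

theorem pantsShrink_one (z : pairOfPants) : (pantsShrink (1, z) : ℂ) = pantsSpine z := by
  simp [pantsShrink]

theorem pantsShrink_of_spine_eq {z : pairOfPants} (h : pantsSpine z = z) (s : I) :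
    pantsShrink (s, z) = z := by
  ext; simp only [pantsShrink, h]; ring

/-- The displacement of the homotopy that drags the middle of the seam `[-1, 0]` around the upper
half of the first inner circle. -/
noncomputable def seamShift (s x : ℝ) : ℂ :=
  -- The tent function has its peak `1` at `x = -1 / 2`, so at `s = 1` the middle of the seam
  -- reaches `-3`, a point glued to the common point of the circles. The segment ending at `-1`,
  -- which is not such a point, thereby becomes part of a loop: the seam first returns along the
  -- first inner circle and then runs from `-3` to `1`.
  (circleOver (1 - 2 * s * max 0 (1 - |2 * x + 1|)) 1 : ℂ) - 1

theorem seamShift_eq_zero {s x : ℝ} (h : x ≤ -1 ∨ 0 ≤ x) : seamShift s x = 0 := by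
  have : max 0 (1 - |2 * x + 1|) = 0 := by
    refine max_eq_left ?_
    rcases h with h | h
    · rw [abs_of_nonpos (by linarith)]; linarith
    · rw [abs_of_nonneg (by linarith)]; linarith
  rw [seamShift, this, circleOver_of_ge (by linarith)]
  simp

theorem seamShift_zero (x : ℝ) : seamShift 0 x = 0 := by
  rw [seamShift, circleOver_of_ge (by linarith)]
  simp

theorem pantsSpine_mem {z : ℂ} (hz : z ∈ pairOfPants) : pantsSpine z ∈ pairOfPants := by
  simpa using pants_segment_mem hz zero_le_one le_rfl

theorem pantsSpine_of_seam {z : ℂ} (h : -1 ≤ z.re) (h' : z.re ≤ 0) : pantsSpine z = -1 := by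
  apply Complex.ext <;> simp [pantsSpine, pantsFold_of_mem h h', pantsHeight_eq_zero]

theorem pantsSpine_add_seamShift_mem {z : ℂ} (hz : z ∈ pairOfPants) (s : ℝ) :
    pantsSpine z + seamShift s z.re ∈ pairOfPants := by
  by_cases h : z.re ≤ -1 ∨ 0 ≤ z.re
  · rw [seamShift_eq_zero h, add_zero]
    exact pantsSpine_mem hz
  · push Not at h
    rw [pantsSpine_of_seam h.1.le h.2.le]
    have : (-1 : ℂ) + seamShift s z.re =
        innerBoundary₁ (circleOver (1 - 2 * s * max 0 (1 - |2 * z.re + 1|)) 1) := by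
      simp only [seamShift, innerBoundary₁]; ring
    rw [this]
    exact Subtype.property _

/-- The second part of the deformation of the pair of pants onto a graph. -/
noncomputable def pantsDrag (q : I × pairOfPants) : pairOfPants :=
  ⟨pantsSpine q.2 + seamShift q.1 (q.2 : ℂ).re, pantsSpine_add_seamShift_mem q.2.2 _⟩

theorem continuous_pantsDrag : Continuous pantsDrag := by
  have h := continuous_pantsSpine.comp (continuous_snd : Continuous fun q : I × pairOfPants => q.2)
  have h1 : Continuous fun q : I × pairOfPants => (q.2 : ℂ).re :=
    continuous_pants_re.comp continuous_snd
  refine Continuous.subtype_mk (h.add (Continuous.sub ?_ continuous_const)) _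
  refine continuous_subtype_val.comp (continuous_circleOver (by fun_prop) continuous_const ?_)
  intro _ h
  exact absurd h one_ne_zero

theorem pantsDrag_zero (z : pairOfPants) : pantsDrag (0, z) = pantsShrink (1, z) := by
  ext; rw [pantsShrink_one]; simp [pantsDrag, seamShift_zero]

theorem pantsDrag_of_re {z : pairOfPants} (h : (z : ℂ).re ≤ -1 ∨ 0 ≤ (z : ℂ).re) (s : I) :
    (pantsDrag (s, z) : ℂ) = pantsSpine z := by
  simp [pantsDrag, seamShift_eq_zero h]

theorem pantsDrag_one_of_seam {z : pairOfPants} (h : -1 ≤ (z : ℂ).re) (h' : (z : ℂ).re ≤ -1 / 2) :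
    pantsDrag (1, z) = innerBoundary₁ (circleOver (-3 - 4 * (z : ℂ).re) 1) := by
  ext
  have : max 0 (1 - |2 * (z : ℂ).re + 1|) = 2 * (z : ℂ).re + 2 := by
    rw [abs_of_nonpos (by linarith), max_eq_right (by linarith)]; ring
  simp only [pantsDrag, seamShift, pantsSpine_of_seam h (by linarith), innerBoundary₁, this,
    Icc.coe_one]
  rw [show 1 - 2 * 1 * (2 * (z : ℂ).re + 2) = -3 - 4 * (z : ℂ).re by ring]
  ring

/-- On the axes, `pantsDrag` depends only on the real part. -/
theorem pantsDrag_congr {z w : pairOfPants} (h : (z : ℂ).re = (w : ℂ).re)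
    (h0 : pantsHeight (pantsFold (z : ℂ).re) = 0) (s : I) : pantsDrag (s, z) = pantsDrag (s, w) := by
  ext
  simp only [pantsDrag, pantsSpine, ← h, h0, neg_zero, ite_self]

/-! ### The boundary -/

theorem circle_re_mem (u : Circle) : -1 ≤ (u : ℂ).re ∧ (u : ℂ).re ≤ 1 := by
  have h := u.re_sq_add_im_sq
  constructor <;> nlinarith [sq_nonneg (u : ℂ).im]

@[simp] theorem innerBoundary₁_re (u : Circle) : (innerBoundary₁ u : ℂ).re = -2 + (u : ℂ).re := by
  simp [innerBoundary₁]
@[simp] theorem innerBoundary₁_im (u : Circle) : (innerBoundary₁ u : ℂ).im = (u : ℂ).im := by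
  simp [innerBoundary₁]
@[simp] theorem innerBoundary₂_re (u : Circle) : (innerBoundary₂ u : ℂ).re = 2 + (u : ℂ).re := by
  simp [innerBoundary₂]
@[simp] theorem innerBoundary₂_im (u : Circle) : (innerBoundary₂ u : ℂ).im = (u : ℂ).im := by
  simp [innerBoundary₂]
@[simp] theorem outerBoundary_re (u : Circle) : (outerBoundary u : ℂ).re = 4 * (u : ℂ).re := by
  simp [outerBoundary]
@[simp] theorem outerBoundary_im (u : Circle) : (outerBoundary u : ℂ).im = 4 * (u : ℂ).im := by
  simp [outerBoundary]

theorem pantsSpine_eq_self {z : ℂ} (h1 : pantsFold z.re = z.re) (h2 : pantsHeight z.re = |z.im|) :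
    pantsSpine z = z := by
  apply Complex.ext
  · exact h1
  · simp only [pantsSpine, h1, h2]
    split_ifs with h
    · exact abs_of_nonneg h
    · rw [abs_of_neg (not_le.1 h), neg_neg]

theorem pantsSpine_inner₁ (u : Circle) : pantsSpine (innerBoundary₁ u) = innerBoundary₁ u := by
  have h := circle_re_mem u
  refine pantsSpine_eq_self (pantsFold_of_le (by rw [innerBoundary₁_re]; linarith)) ?_
  rw [innerBoundary₁_re, innerBoundary₁_im, pantsHeight_of_nonpos (by linarith),
    ← Real.sqrt_sq_eq_abs]
  congr 1
  linarith [u.re_sq_add_im_sq]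

theorem pantsSpine_inner₂ (u : Circle) : pantsSpine (innerBoundary₂ u) = innerBoundary₂ u := by
  have h := circle_re_mem u
  refine pantsSpine_eq_self ?_ ?_
  · rw [innerBoundary₂_re, pantsFold_of_ge (by linarith), min_eq_right (by linarith)]
  rw [innerBoundary₂_re, innerBoundary₂_im, pantsHeight_of_nonneg (by linarith),
    ← Real.sqrt_sq_eq_abs]
  congr 1
  linarith [u.re_sq_add_im_sq]

theorem pantsSpine_outer_neg_one : pantsSpine (outerBoundary (-1)) = outerBoundary (-1) := by
  refine pantsSpine_eq_self ?_ ?_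
  · refine pantsFold_of_le ?_; rw [outerBoundary_re]; norm_num
  · rw [outerBoundary_re, outerBoundary_im, pantsHeight_eq_zero (Or.inl (by norm_num))]
    norm_num

theorem pantsDrag_inner₁ (s : I) (u : Circle) :
    pantsDrag (s, innerBoundary₁ u) = innerBoundary₁ u := by
  have h := circle_re_mem u
  ext
  rw [pantsDrag_of_re, pantsSpine_inner₁]
  left; rw [innerBoundary₁_re]; linarith

theorem pantsDrag_inner₂ (s : I) (u : Circle) :
    pantsDrag (s, innerBoundary₂ u) = innerBoundary₂ u := by
  have h := circle_re_mem u
  ext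
  rw [pantsDrag_of_re, pantsSpine_inner₂]
  right; rw [innerBoundary₂_re]; linarith

theorem pantsDrag_outer_neg_one (s : I) :
    pantsDrag (s, outerBoundary (-1)) = outerBoundary (-1) := by
  ext
  rw [pantsDrag_of_re, pantsSpine_outer_neg_one]
  left; rw [outerBoundary_re]; norm_num

/-! ### The coordinates of the retraction onto a graph -/

/-- The position on the segment `[-4, -3]`. -/
noncomputable def pantsCoordA (z : ℂ) : Circle := circleParam (z.re + 4)
/-- The position on the arc from `-3` along the first inner circle and the real axis to `1`. -/
noncomputable def pantsCoordB (z : ℂ) : Circle := circleParam ((z.re + 1 / 2) / (3 / 2))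
/-- The position on the first inner circle. -/
noncomputable def pantsCoordL (z : ℂ) : Circle :=
  if z.re ≤ -1 then circleOver (z.re + 2) z.im else circleOver (-3 - 4 * z.re) 1
/-- The position on the second inner circle. -/
noncomputable def pantsCoordR (z : ℂ) : Circle := circleOver (z.re - 2) z.im

theorem continuous_pantsCoordA : Continuous fun z : pairOfPants => pantsCoordA z :=
  continuous_circleParam.comp (continuous_pants_re.add continuous_const)

theorem continuous_pantsCoordB : Continuous fun z : pairOfPants => pantsCoordB z :=
  continuous_circleParam.comp ((continuous_pants_re.add continuous_const).div_const _)

theorem continuous_pantsCoordL : Continuous fun z : pairOfPants => pantsCoordL z := by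
  have h1 := continuous_pants_re
  refine Continuous.if_le (continuous_circleOver (by fun_prop) continuous_pants_im fun z hz => ?_)
    (continuous_circleOver (by fun_prop) continuous_const fun _ h => absurd h one_ne_zero)
    h1 continuous_const fun z hz => ?_
  · rcases re_of_im_eq_zero z.2 hz with h | h | h
    · left; linarith
    · right; linarith
    · right; linarith
  · rw [circleOver_of_ge (by linarith), circleOver_of_ge (by linarith)]

theorem continuous_pantsCoordR : Continuous fun z : pairOfPants => pantsCoordR z := by
  have h1 := continuous_pants_re
  refine continuous_circleOver (by fun_prop) continuous_pants_im fun z hz => ?_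
  rcases re_of_im_eq_zero z.2 hz with h | h | h
  · left; linarith
  · left; linarith
  · right; linarith

theorem pantsCoordA_ne {z : ℂ} (h : pantsCoordA z ≠ -1) : -4 < z.re ∧ z.re < -3 := by
  by_contra h'
  refine h (circleParam_eq_neg_one ?_)
  by_contra h2
  push Not at h2
  exact h' ⟨by linarith, by linarith⟩

theorem pantsCoordB_ne {z : ℂ} (h : pantsCoordB z ≠ -1) : -1 / 2 < z.re ∧ z.re < 1 := by
  by_contra h'
  refine h (circleParam_eq_neg_one ?_)
  by_contra h2
  push Not at h2
  exact h' ⟨by linarith, by linarith⟩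

theorem pantsCoordL_ne {z : ℂ} (h : pantsCoordL z ≠ -1) : -3 < z.re ∧ z.re < -1 / 2 := by
  by_contra h'
  refine h ?_
  by_cases h2 : z.re ≤ -3
  · rw [pantsCoordL, if_pos (by linarith)]
    exact circleOver_of_le (by linarith) _
  · have h3 : -1 / 2 ≤ z.re := by
      by_contra h3
      exact h' ⟨by linarith, by linarith⟩
    rw [pantsCoordL, if_neg (by linarith)]
    exact circleOver_of_le (by linarith) _

theorem pantsCoordR_ne {z : ℂ} (h : pantsCoordR z ≠ -1) : 1 < z.re := by
  by_contra h'
  exact h (circleOver_of_le (by linarith) _)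

theorem pantsCoordL_inner₁ (u : Circle) : pantsCoordL (innerBoundary₁ u) = u := by
  have h := circle_re_mem u
  rw [pantsCoordL, if_pos (by rw [innerBoundary₁_re]; linarith), innerBoundary₁_re,
    innerBoundary₁_im, show -2 + (u : ℂ).re + 2 = (u : ℂ).re by ring, circleOver_re_im]

theorem pantsCoordR_inner₂ (u : Circle) : pantsCoordR (innerBoundary₂ u) = u := by
  rw [pantsCoordR, innerBoundary₂_re, innerBoundary₂_im,
    show 2 + (u : ℂ).re - 2 = (u : ℂ).re by ring, circleOver_re_im]

theorem circleOver_im_of_mem {x y : ℝ} (h1 : -1 ≤ x) (h2 : x ≤ 1) :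
    (circleOver x y : ℂ).im = if 0 ≤ y then √(1 - x ^ 2) else -√(1 - x ^ 2) := by
  rw [circleOver_im, min_eq_right h2, max_eq_right h1]

theorem pantsDrag_one_of_coordL {z : pairOfPants} (h : pantsCoordL z ≠ -1) :
    pantsDrag (1, z) = innerBoundary₁ (pantsCoordL z) := by
  obtain ⟨h1, h2⟩ := pantsCoordL_ne h
  by_cases h3 : (z : ℂ).re ≤ -1
  · ext
    rw [pantsDrag_of_re (Or.inl h3), pantsCoordL, if_pos h3]
    apply Complex.ext
    · rw [innerBoundary₁_re, circleOver_re_of_mem (by linarith) (by linarith)]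
      change pantsFold _ = _
      rw [pantsFold_of_le h3]; ring
    · rw [innerBoundary₁_im, circleOver_im_of_mem (by linarith) (by linarith)]
      simp only [pantsSpine, pantsFold_of_le h3]
      rw [pantsHeight_of_nonpos (by linarith)]
  · rw [pantsDrag_one_of_seam (by linarith) (by linarith), pantsCoordL, if_neg h3]

theorem pantsDrag_one_of_coordR {z : pairOfPants} (h : pantsCoordR z ≠ -1) :
    pantsDrag (1, z) = innerBoundary₂ (pantsCoordR z) := by
  have h1 := pantsCoordR_ne h
  ext
  rw [pantsDrag_of_re (Or.inr (by linarith)), pantsCoordR]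
  apply Complex.ext
  · rw [innerBoundary₂_re, circleOver_re, max_eq_right (le_min (by norm_num) (by linarith))]
    change pantsFold _ = _
    rw [pantsFold_of_ge h1.le, ← min_add_add_left]
    norm_num
  · rw [innerBoundary₂_im, circleOver_im, max_eq_right (le_min (by norm_num) (by linarith))]
    simp only [pantsSpine, pantsFold_of_ge h1.le]
    rw [pantsHeight_of_nonneg (le_min (by norm_num) (by linarith))]
    have : min 3 (z : ℂ).re - 2 = min 1 ((z : ℂ).re - 2) := by
      rw [← min_sub_sub_right]; norm_num
    rw [this]

/-- Trivial coordinates force the real part to be `-4`, `-3`, `-1 / 2` or `1`; the dragged images of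
such points are the three boundary points that are glued to the common point of the circles. -/
theorem pantsDrag_one_of_coords {z : pairOfPants} (ha : pantsCoordA z = -1)
    (hb : pantsCoordB z = -1) (hl : pantsCoordL z = -1) (hr : pantsCoordR z = -1) :
    pantsDrag (1, z) = outerBoundary (-1) ∨ pantsDrag (1, z) = innerBoundary₁ (-1) ∨
      pantsDrag (1, z) = innerBoundary₂ (-1) := by
  have hz := re_mem_of_mem_pairOfPants z.2
  rcases lt_trichotomy (z : ℂ).re (-3) with h | h | h
  · have h4 : (z : ℂ).re = -4 := by
      by_contra h4
      exact circleParam_ne (t := (z : ℂ).re + 4) (by have := lt_of_le_of_ne hz.1 (Ne.symm h4); linarith)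
        (by linarith) ha
    left
    ext
    rw [pantsDrag_of_re (Or.inl (by linarith))]
    apply Complex.ext
    · change pantsFold _ = _
      rw [pantsFold_of_le (by linarith), h4, outerBoundary_re]; norm_num
    · simp [pantsSpine, h4, pantsFold_of_le (x := -4) (by norm_num),
        pantsHeight_eq_zero (x := -4) (Or.inl (by norm_num))]
  · right; left
    ext
    rw [pantsDrag_of_re (Or.inl (by linarith))]
    apply Complex.ext
    · change pantsFold _ = _
      rw [pantsFold_of_le (by linarith), h, innerBoundary₁_re]; norm_num
    · simp [pantsSpine, h, pantsFold_of_le (x := -3) (by norm_num),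
        pantsHeight_eq_zero (x := -3) (Or.inl le_rfl)]
  have h2 : -1 / 2 ≤ (z : ℂ).re := by
    by_contra h2
    push Not at h2
    rw [pantsCoordL] at hl
    split_ifs at hl
    · exact circleOver_ne (by linarith) _ hl
    · exact circleOver_ne (by linarith) _ hl
  have h3 : (z : ℂ).re ≤ 1 := by
    by_contra h3
    exact circleOver_ne (by linarith) _ hr
  rcases h2.eq_or_lt with h2 | h2
  · right; left
    rw [pantsDrag_one_of_seam (by linarith) (by linarith), ← h2, circleOver_of_le (by norm_num)]
  · have h4 : (z : ℂ).re = 1 := by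
      by_contra h4
      have h5 := lt_of_le_of_ne h3 h4
      exact circleParam_ne (t := ((z : ℂ).re + 1 / 2) / (3 / 2)) (by linarith) (by linarith) hb
    right; right
    ext
    rw [pantsDrag_of_re (Or.inr (by linarith))]
    apply Complex.ext
    · change pantsFold _ = _
      rw [pantsFold_of_ge h4.ge, h4, innerBoundary₂_re]; norm_num
    · simp [pantsSpine, h4, pantsFold_of_ge le_rfl,
        pantsHeight_eq_zero (x := 1) (Or.inr (Or.inl ⟨by norm_num, le_rfl⟩))]

/-! ### Wedges of circles with the topology of the Hawaiian earring -/

/-- The wedge of the circles in `L`, as a subspace of the product of the circles in `J`. -/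
abbrev CircleWedge {J : Type*} (L : Set J) : Type _ :=
  {b : J → Circle // (∀ i j, i ≠ j → b i = -1 ∨ b j = -1) ∧ ∀ j ∉ L, b j = -1}

namespace CircleWedge

variable {J : Type*} {L : Set J}

/-- The coordinates of a wedge of circles. -/
def coords (L : Set J) : CircleCoords (CircleWedge L) J where
  coord j b := b.1 j
  continuous_coord j := (continuous_apply j).comp continuous_subtype_val
  eq_or_eq b := b.2.1

theorem continuous_coord (j : J) : Continuous fun b : CircleWedge L => b.1 j :=
  (coords L).continuous_coord j

open Classical in
/-- The point with given coordinates, where the coordinates outside of `L` are discarded. -/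
noncomputable def mk (L : Set J) (f : J → Circle) (hf : ∀ i j, i ≠ j → f i = -1 ∨ f j = -1) :
    CircleWedge L :=
  ⟨fun j => if j ∈ L then f j else -1, fun i j hij => by
    rcases hf i j hij with h | h
    · left; simp [h]
    · right; simp [h], fun j hj => by simp [hj]⟩

theorem mk_of_mem {f : J → Circle} (hf : ∀ i j, i ≠ j → f i = -1 ∨ f j = -1) {j : J} (hj : j ∈ L) :
    (mk L f hf).1 j = f j := by simp [mk, hj]

theorem continuous_mk {Z : Type*} [TopologicalSpace Z] {f : Z → J → Circle}
    {hf : ∀ z i j, i ≠ j → f z i = -1 ∨ f z j = -1} (h : ∀ j, Continuous fun z => f z j) :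
    Continuous fun z => mk L (f z) (hf z) := by
  refine Continuous.subtype_mk (continuous_pi fun j => ?_) _
  by_cases hj : j ∈ L
  · simpa [hj] using h j
  · simpa [hj] using continuous_const

/-- The common point of the circles. -/
noncomputable def base (L : Set J) : CircleWedge L := ⟨fun _ => -1, fun _ _ _ => Or.inl rfl, fun _ _ => rfl⟩

theorem isBase_base : (coords L).IsBase (base L) := fun _ => rfl

theorem coord_injective (x y : CircleWedge L) (h : ∀ j, x.1 j = y.1 j) : x = y :=
  Subtype.ext (funext h)

open Classical in
/-- The inclusion of the circle `j`. -/
noncomputable def circ (L : Set J) (j : J) (u : Circle) : CircleWedge L :=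
  mk L (fun i => if i = j then u else -1) fun i k hik => by
    by_cases h : i = j
    · right; exact if_neg fun h' => hik (h.trans h'.symm)
    · left; exact if_neg h

theorem circ_self {j : J} (hj : j ∈ L) (u : Circle) : (circ L j u).1 j = u := by
  rw [circ, mk_of_mem _ hj, if_pos rfl]

theorem circ_of_ne {i j : J} (h : i ≠ j) (u : Circle) : (circ L j u).1 i = -1 := by
  by_cases hi : i ∈ L
  · rw [circ, mk_of_mem _ hi, if_neg h]
  · exact (circ L j u).2.2 i hi

theorem circ_neg_one (j : J) : circ L j (-1) = base L := by
  refine coord_injective _ _ fun i => ?_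
  by_cases hi : i ∈ L
  · rw [circ, mk_of_mem _ hi, ite_self]; rfl
  · exact (circ L j (-1)).2.2 i hi

theorem continuous_circ (j : J) : Continuous (circ L j) := by
  refine continuous_mk fun i => ?_
  by_cases h : i = j
  · simpa [h] using continuous_id'
  · simpa [h] using continuous_const

theorem mem_of_ne {b : CircleWedge L} {j : J} (h : b.1 j ≠ -1) : j ∈ L := by
  by_contra hj; exact h (b.2.2 j hj)

theorem eq_circ {b : CircleWedge L} {j : J} (h : b.1 j ≠ -1) : b = circ L j (b.1 j) := by
  refine coord_injective _ _ fun i => ?_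
  by_cases hi : i = j
  · rw [hi, circ_self (mem_of_ne h)]
  · rw [circ_of_ne hi]; exact (coords L).coord_eq_of_ne h hi

theorem eq_base {b : CircleWedge L} (h : ∀ j, b.1 j = -1) : b = base L :=
  coord_injective _ _ h

/-- The map between wedges of circles that is the identity on common circles and constant on the
others. -/
noncomputable def map (L L' : Set J) (b : CircleWedge L) : CircleWedge L' := mk L' b.1 b.2.1

theorem continuous_map (L' : Set J) : Continuous (map L L') := continuous_mk continuous_coord

theorem map_of_mem {L' : Set J} (b : CircleWedge L) {j : J} (hj : j ∈ L') :
    (map L L' b).1 j = b.1 j := mk_of_mem _ hj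

theorem map_base (L' : Set J) : map L L' (base L) = base L' := by
  refine eq_base fun j => ?_
  by_cases hj : j ∈ L'
  · rw [map_of_mem _ hj]; rfl
  · exact (map L L' (base L)).2.2 j hj

theorem map_circ {L' : Set J} {j : J} (hj : j ∈ L) (hj' : j ∈ L') (u : Circle) :
    map L L' (circ L j u) = circ L' j u := by
  refine coord_injective _ _ fun i => ?_
  by_cases hi : i ∈ L'
  · rw [map_of_mem _ hi]
    by_cases hij : i = j
    · rw [hij, circ_self hj, circ_self hj']
    · rw [circ_of_ne hij, circ_of_ne hij]
  · rw [(map L L' (circ L j u)).2.2 i hi, (circ L' j u).2.2 i hi]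

open Classical in
/-- The map that agrees with `l` on the circle `k` and with `f` elsewhere. -/
noncomputable def glue {Z : Type*} (k : J) (f : CircleWedge L → Z) (l : Circle → Z)
    (b : CircleWedge L) : Z := if b.1 k = -1 then f b else l (b.1 k)

theorem glue_of_eq {Z : Type*} {k : J} {f : CircleWedge L → Z} {l : Circle → Z}
    {b : CircleWedge L} (h : b.1 k = -1) : glue k f l b = f b := if_pos h

theorem glue_of_ne {Z : Type*} {k : J} {f : CircleWedge L → Z} {l : Circle → Z}
    {b : CircleWedge L} (h : b.1 k ≠ -1) : glue k f l b = l (b.1 k) := if_neg h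

theorem glue_circ_self {Z : Type*} {k : J} {f : CircleWedge L → Z} {l : Circle → Z}
    (hk : k ∈ L) (h : f (base L) = l (-1)) (u : Circle) : glue k f l (circ L k u) = l u := by
  by_cases hu : u = -1
  · rw [hu, circ_neg_one, glue_of_eq rfl, h]
  · rw [glue_of_ne, circ_self hk]
    rwa [circ_self hk]

theorem glue_circ_of_ne {Z : Type*} {k j : J} {f : CircleWedge L → Z} {l : Circle → Z}
    (hk : k ≠ j) (u : Circle) : glue k f l (circ L j u) = f (circ L j u) :=
  glue_of_eq (circ_of_ne hk u)

/-- The wedge is the union of two closed sets, the circle `k` and the union of the other circles,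
which meet only in the base point. -/
theorem continuous_glue {Z : Type*} [TopologicalSpace Z] {k : J} {f : CircleWedge L → Z}
    {l : Circle → Z} (hf : Continuous f) (hl : Continuous l) (h : f (base L) = l (-1)) :
    Continuous (glue k f l) := by
  have h1 : IsClosed {b : CircleWedge L | b.1 k = -1} :=
    isClosed_eq (continuous_coord k) continuous_const
  have h2 : IsClosed {b : CircleWedge L | ∀ j, j ≠ k → b.1 j = -1} := by
    simp only [ofPred_forall]
    exact isClosed_iInter fun j => isClosed_iInter fun _ =>
      isClosed_eq (continuous_coord j) continuous_const
  have h3 : {b : CircleWedge L | b.1 k = -1} ∪ {b | ∀ j, j ≠ k → b.1 j = -1} = univ := by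
    refine eq_univ_of_forall fun b => ?_
    by_cases hb : b.1 k = -1
    · exact Or.inl hb
    · exact Or.inr fun j hj => (coords L).coord_eq_of_ne hb hj
  rw [← continuousOn_univ, ← h3]
  refine ContinuousOn.union_of_isClosed ?_ ?_ h1 h2
  · exact hf.continuousOn.congr fun b hb => glue_of_eq hb
  · refine (hl.comp (continuous_coord k)).continuousOn.congr fun b hb => ?_
    by_cases hbk : b.1 k = -1
    · have : b = base L := eq_base fun j => by
        by_cases hj : j = k
        · rw [hj, hbk]
        · exact hb j hj
      rw [glue_of_eq hbk, Function.comp_apply, hbk, this, h]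
    · exact glue_of_ne hbk

end CircleWedge

/-! ### The tower -/

/-- Circles `(n, 0)`, to which pairs of pants are attached, and, for each pair of pants, two
further circles. -/
abbrev Letter : Type := ℕ × Fin 3

/-- The circles that are present when the first `N` pairs of pants are collapsed. -/
def letters (N : ℕ) : Set Letter := {l | l.2 = 0 ∨ l.1 < N}

theorem mem_letters_zero (N n : ℕ) : (n, 0) ∈ letters N := Or.inl rfl

/-- The wedge of circles that are present when the first `N` pairs of pants are collapsed. -/
abbrev TowerWedge (N : ℕ) : Type := CircleWedge (letters N)

/-- The inclusion of the circle `(n, 0)`. -/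
noncomputable abbrev towerCirc (N n : ℕ) (u : Circle) : TowerWedge N :=
  CircleWedge.circ (letters N) (n, 0) u

/-- The gluing of pairs of pants to a wedge of circles; the pair of pants with index `k` is the
one with number `N + k`. -/
inductive TowerGlue (N : ℕ) : (TowerWedge N ⊕ (Σ _ : ℕ, pairOfPants)) →
    (TowerWedge N ⊕ (Σ _ : ℕ, pairOfPants)) → Prop
  | outer (k : ℕ) (u : Circle) :
      TowerGlue N (Sum.inr ⟨k, outerBoundary u⟩) (Sum.inl (towerCirc N (N + k) u))
  | inner₁ (k : ℕ) (u : Circle) :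
      TowerGlue N (Sum.inr ⟨k, innerBoundary₁ u⟩) (Sum.inl (towerCirc N (2 * (N + k) + 1) u))
  | inner₂ (k : ℕ) (u : Circle) :
      TowerGlue N (Sum.inr ⟨k, innerBoundary₂ u⟩) (Sum.inl (towerCirc N (2 * (N + k) + 2) u))

/-- The Hawaiian Pants with the first `N` pairs of pants collapsed to graphs. -/
abbrev Tower (N : ℕ) : Type := Quot (TowerGlue N)

namespace Tower

variable {N : ℕ}

/-- The inclusion of the wedge of circles. -/
def ofWedge (b : TowerWedge N) : Tower N := Quot.mk _ (Sum.inl b)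

variable (N) in
/-- The characteristic map of a pair of pants. -/
def ofPants (k : ℕ) (z : pairOfPants) : Tower N := Quot.mk _ (Sum.inr ⟨k, z⟩)

theorem continuous_ofWedge : Continuous (ofWedge (N := N)) :=
  continuous_quot_mk.comp continuous_inl

theorem continuous_ofPants (k : ℕ) : Continuous (ofPants N k) :=
  continuous_quot_mk.comp (continuous_inr.comp continuous_sigmaMk)

theorem ofPants_outer (k : ℕ) (u : Circle) :
    ofPants N k (outerBoundary u) = ofWedge (towerCirc N (N + k) u) :=
  Quot.sound (TowerGlue.outer k u)

theorem ofPants_inner₁ (k : ℕ) (u : Circle) :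
    ofPants N k (innerBoundary₁ u) = ofWedge (towerCirc N (2 * (N + k) + 1) u) :=
  Quot.sound (TowerGlue.inner₁ k u)

theorem ofPants_inner₂ (k : ℕ) (u : Circle) :
    ofPants N k (innerBoundary₂ u) = ofWedge (towerCirc N (2 * (N + k) + 2) u) :=
  Quot.sound (TowerGlue.inner₂ k u)

/-- The common point of the circles. -/
noncomputable def base (N : ℕ) : Tower N := ofWedge (CircleWedge.base _)

theorem ind {P : Tower N → Prop} (h1 : ∀ b, P (ofWedge b)) (h2 : ∀ k z, P (ofPants N k z))
    (x : Tower N) : P x := by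
  obtain ⟨b | ⟨k, z⟩⟩ := x
  · exact h1 b
  · exact h2 k z

theorem continuous_of {Z : Type*} [TopologicalSpace Z] {g : Tower N → Z}
    (h1 : Continuous fun b => g (ofWedge b)) (h2 : ∀ k, Continuous fun z => g (ofPants N k z)) :
    Continuous g := by
  refine isQuotientMap_quot_mk.continuous_iff.2 ?_
  exact continuous_sum_dom.2 ⟨h1, continuous_sigma h2⟩

theorem isOpen_of {U : Set (Tower N)} (h1 : IsOpen (ofWedge ⁻¹' U))
    (h2 : ∀ k, IsOpen (ofPants N k ⁻¹' U)) : IsOpen U := by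
  refine isQuotientMap_quot_mk.isOpen_preimage.1 ?_
  exact isOpen_sum_iff.2 ⟨h1, isOpen_sigma_iff.2 h2⟩

theorem continuousOn_of {Z : Type*} [TopologicalSpace Z] {g : Tower N → Z} {U : Set (Tower N)}
    (hU : IsOpen U) (h1 : ContinuousOn (fun b => g (ofWedge b)) (ofWedge ⁻¹' U))
    (h2 : ∀ k, ContinuousOn (fun z => g (ofPants N k z)) (ofPants N k ⁻¹' U)) :
    ContinuousOn g U := by
  rw [continuousOn_open_iff hU]
  intro t ht
  refine isOpen_of ?_ fun k => ?_
  · exact h1.isOpen_inter_preimage (hU.preimage continuous_ofWedge) ht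
  · exact (h2 k).isOpen_inter_preimage (hU.preimage (continuous_ofPants k)) ht

/-- Maps out of the adjunction space. -/
def desc {Z : Type*} (f : TowerWedge N → Z) (g : ℕ → pairOfPants → Z)
    (h0 : ∀ k u, g k (outerBoundary u) = f (towerCirc N (N + k) u))
    (h1 : ∀ k u, g k (innerBoundary₁ u) = f (towerCirc N (2 * (N + k) + 1) u))
    (h2 : ∀ k u, g k (innerBoundary₂ u) = f (towerCirc N (2 * (N + k) + 2) u)) : Tower N → Z :=
  Quot.lift (Sum.elim f fun p => g p.1 p.2) fun _ _ h => by
    cases h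
    · exact h0 _ _
    · exact h1 _ _
    · exact h2 _ _

end Tower

/-! ### The collapse of one pair of pants and its left homotopy inverse. -/

theorem pantsCoords_eq_or_eq (N : ℕ) (z : ℂ) (i j : Letter) (hij : i ≠ j) :
    let f : Letter → Circle := fun j => if j = (N, 1) then pantsCoordA z else if j = (N, 2) then
      pantsCoordB z else if j = (2 * N + 1, 0) then pantsCoordL z else
      if j = (2 * N + 2, 0) then pantsCoordR z else -1
    f i = -1 ∨ f j = -1 := by
  intro f
  by_contra h
  push Not at h
  obtain ⟨hi, hj⟩ := h
  -- The four coordinates are nontrivial over pairwise disjoint ranges of the real part.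
  have key : ∀ i, f i ≠ -1 → (i = (N, 1) ∧ -4 < z.re ∧ z.re < -3) ∨
      (i = (N, 2) ∧ -1 / 2 < z.re ∧ z.re < 1) ∨
      (i = (2 * N + 1, 0) ∧ -3 < z.re ∧ z.re < -1 / 2) ∨ (i = (2 * N + 2, 0) ∧ 1 < z.re) := by
    intro i hi
    simp only [f] at hi
    split_ifs at hi with h1 h2 h3 h4
    · exact Or.inl ⟨h1, pantsCoordA_ne hi⟩
    · exact Or.inr (Or.inl ⟨h2, pantsCoordB_ne hi⟩)
    · exact Or.inr (Or.inr (Or.inl ⟨h3, pantsCoordL_ne hi⟩))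
    · exact Or.inr (Or.inr (Or.inr ⟨h4, pantsCoordR_ne hi⟩))
    · exact absurd rfl hi
  rcases key i hi with h | h | h | h <;> rcases key j hj with h' | h' | h' | h' <;>
    first
    | exact hij (h.1.trans h'.1.symm)
    | (exfalso; linarith [h.2, h'.2])

/-- The retraction of the pair of pants number `N` onto a graph. -/
noncomputable def pantsCollapse (N : ℕ) (z : pairOfPants) : TowerWedge (N + 1) :=
  CircleWedge.mk _ (fun j => if j = (N, 1) then pantsCoordA z else if j = (N, 2) then
      pantsCoordB z else if j = (2 * N + 1, 0) then pantsCoordL z else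
      if j = (2 * N + 2, 0) then pantsCoordR z else -1) (pantsCoords_eq_or_eq N z)

theorem mem_letters_succ (N : ℕ) (i : Fin 3) : (N, i) ∈ letters (N + 1) := Or.inr (Nat.lt_succ_self N)

theorem continuous_pantsCollapse (N : ℕ) : Continuous (pantsCollapse N) := by
  refine CircleWedge.continuous_mk fun j => ?_
  split_ifs
  · exact continuous_pantsCoordA
  · exact continuous_pantsCoordB
  · exact continuous_pantsCoordL
  · exact continuous_pantsCoordR
  · exact continuous_const

theorem pantsCollapse_A (N : ℕ) (z : pairOfPants) :
    (pantsCollapse N z).1 (N, 1) = pantsCoordA z := by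
  rw [pantsCollapse, CircleWedge.mk_of_mem _ (mem_letters_succ N 1), if_pos rfl]

theorem pantsCollapse_B (N : ℕ) (z : pairOfPants) :
    (pantsCollapse N z).1 (N, 2) = pantsCoordB z := by
  rw [pantsCollapse, CircleWedge.mk_of_mem _ (mem_letters_succ N 2), if_neg (by simp), if_pos rfl]

theorem pantsCollapse_L (N : ℕ) (z : pairOfPants) :
    (pantsCollapse N z).1 (2 * N + 1, 0) = pantsCoordL z := by
  rw [pantsCollapse, CircleWedge.mk_of_mem _ (mem_letters_zero _ _), if_neg (by simp),
    if_neg (by simp), if_pos rfl]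

theorem pantsCollapse_R (N : ℕ) (z : pairOfPants) :
    (pantsCollapse N z).1 (2 * N + 2, 0) = pantsCoordR z := by
  rw [pantsCollapse, CircleWedge.mk_of_mem _ (mem_letters_zero _ _), if_neg (by simp),
    if_neg (by simp), if_neg (by simp), if_pos rfl]

theorem pantsCollapse_of_ne (N : ℕ) (z : pairOfPants) {j : Letter} (h1 : j ≠ (N, 1))
    (h2 : j ≠ (N, 2)) (h3 : j ≠ (2 * N + 1, 0)) (h4 : j ≠ (2 * N + 2, 0)) :
    (pantsCollapse N z).1 j = -1 := by
  by_cases hj : j ∈ letters (N + 1)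
  · rw [pantsCollapse, CircleWedge.mk_of_mem _ hj, if_neg h1, if_neg h2, if_neg h3, if_neg h4]
  · exact (pantsCollapse N z).2.2 j hj

theorem pantsCollapse_eq_base (N : ℕ) {z : pairOfPants} (ha : pantsCoordA z = -1)
    (hb : pantsCoordB z = -1) (hl : pantsCoordL z = -1) (hr : pantsCoordR z = -1) :
    pantsCollapse N z = CircleWedge.base _ := by
  refine CircleWedge.eq_base fun j => ?_
  by_cases h1 : j = (N, 1)
  · rw [h1, pantsCollapse_A, ha]
  by_cases h2 : j = (N, 2)
  · rw [h2, pantsCollapse_B, hb]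
  by_cases h3 : j = (2 * N + 1, 0)
  · rw [h3, pantsCollapse_L, hl]
  by_cases h4 : j = (2 * N + 2, 0)
  · rw [h4, pantsCollapse_R, hr]
  exact pantsCollapse_of_ne N z h1 h2 h3 h4

theorem pantsCollapse_eq_circ {N : ℕ} {z : pairOfPants} {j : Letter} {u : Circle}
    (h : (pantsCollapse N z).1 j = u) (hu : u ≠ -1) :
    pantsCollapse N z = CircleWedge.circ _ j u := by
  subst h; exact CircleWedge.eq_circ hu

theorem coords_of_re_mem {z : ℂ} (h : -3 ≤ z.re) (h' : z.re ≤ -1 / 2) :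
    pantsCoordA z = -1 ∧ pantsCoordB z = -1 ∧ pantsCoordR z = -1 := by
  refine ⟨?_, ?_, ?_⟩ <;> by_contra hc
  · linarith [(pantsCoordA_ne hc).2]
  · linarith [(pantsCoordB_ne hc).1]
  · linarith [pantsCoordR_ne hc]

theorem coords_of_re_ge {z : ℂ} (h : 1 ≤ z.re) :
    pantsCoordA z = -1 ∧ pantsCoordB z = -1 ∧ pantsCoordL z = -1 := by
  refine ⟨?_, ?_, ?_⟩ <;> by_contra hc
  · linarith [(pantsCoordA_ne hc).2]
  · linarith [(pantsCoordB_ne hc).2]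
  · linarith [(pantsCoordL_ne hc).2]

theorem pantsCollapse_inner₁ (N : ℕ) (u : Circle) :
    pantsCollapse N (innerBoundary₁ u) = towerCirc (N + 1) (2 * N + 1) u := by
  have h := circle_re_mem u
  by_cases hu : u = -1
  · have h0 := coords_of_re_mem (z := innerBoundary₁ u) (by rw [innerBoundary₁_re]; linarith)
      (by rw [innerBoundary₁_re]; linarith)
    rw [pantsCollapse_eq_base N h0.1 h0.2.1 (by rw [pantsCoordL_inner₁, hu]) h0.2.2, hu, towerCirc,
      CircleWedge.circ_neg_one]
  · exact pantsCollapse_eq_circ ((pantsCollapse_L N _).trans (pantsCoordL_inner₁ u)) hu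

theorem pantsCollapse_inner₂ (N : ℕ) (u : Circle) :
    pantsCollapse N (innerBoundary₂ u) = towerCirc (N + 1) (2 * N + 2) u := by
  have h := circle_re_mem u
  by_cases hu : u = -1
  · have h0 := coords_of_re_ge (z := innerBoundary₂ u) (by rw [innerBoundary₂_re]; linarith)
    rw [pantsCollapse_eq_base N h0.1 h0.2.1 h0.2.2 (by rw [pantsCoordR_inner₂, hu]), hu, towerCirc,
      CircleWedge.circ_neg_one]
  · exact pantsCollapse_eq_circ ((pantsCollapse_R N _).trans (pantsCoordR_inner₂ u)) hu

theorem pantsCollapse_outer_neg_one (N : ℕ) :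
    pantsCollapse N (outerBoundary (-1)) = CircleWedge.base _ := by
  have hre : (outerBoundary (-1) : ℂ).re = -4 := by rw [outerBoundary_re]; norm_num
  refine pantsCollapse_eq_base N ?_ ?_ ?_ ?_ <;> by_contra hc
  · linarith [(pantsCoordA_ne hc).1]
  · linarith [(pantsCoordB_ne hc).1]
  · linarith [(pantsCoordL_ne hc).1]
  · linarith [pantsCoordR_ne hc]

theorem Path.homotopic_of_family {X : Type*} [TopologicalSpace X] {p q : X} {α β : Path p q}
    (F : I × I → X) (hF : Continuous F) (h0 : ∀ t, F (0, t) = α t) (h1 : ∀ t, F (1, t) = β t)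
    (hp : ∀ s, F (s, 0) = p) (hq : ∀ s, F (s, 1) = q) : α.Homotopic β :=
  ⟨{ toFun := F
     continuous_toFun := hF
     map_zero_left := h0
     map_one_left := h1
     prop' := by
      rintro s t (rfl | rfl)
      · simp [hp]
      · simp [hq] }⟩

namespace Tower

variable {N : ℕ}

/-- The map on the wedge of circles induced by the collapse of the next pair of pants. -/
noncomputable def collapseWedge (N : ℕ) : TowerWedge N → TowerWedge (N + 1) :=
  -- The circle `(N, 0)` becomes a loop in the new graph. It is still present in the target, so that
  -- the sets of letters are nested, but no point of its interior is in the image.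
  CircleWedge.glue (N, 0) (CircleWedge.map _ _) fun u => pantsCollapse N (outerBoundary u)

theorem continuous_collapseWedge : Continuous (collapseWedge N) :=
  CircleWedge.continuous_glue (CircleWedge.continuous_map _)
    ((continuous_pantsCollapse N).comp continuous_outerBoundary)
    (by rw [CircleWedge.map_base, pantsCollapse_outer_neg_one])

theorem collapseWedge_base : collapseWedge N (CircleWedge.base _) = CircleWedge.base _ := by
  rw [collapseWedge, CircleWedge.glue_of_eq rfl, CircleWedge.map_base]

theorem collapseWedge_circ_self (u : Circle) :
    collapseWedge N (towerCirc N N u) = pantsCollapse N (outerBoundary u) :=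
  CircleWedge.glue_circ_self (mem_letters_zero _ _)
    (by rw [CircleWedge.map_base, pantsCollapse_outer_neg_one]) u

theorem collapseWedge_circ_of_ne {n : ℕ} (h : N ≠ n) (u : Circle) :
    collapseWedge N (towerCirc N n u) = towerCirc (N + 1) n u := by
  rw [collapseWedge, CircleWedge.glue_circ_of_ne (by simpa using h),
    CircleWedge.map_circ (mem_letters_zero _ _) (mem_letters_zero _ _)]

/-- The map that collapses the next pair of pants. -/
noncomputable def collapse (N : ℕ) : Tower N → Tower (N + 1) :=
  desc (fun b => ofWedge (collapseWedge N b))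
    (fun k z => match k with
      | 0 => ofWedge (pantsCollapse N z)
      | k + 1 => ofPants (N + 1) k z)
    (fun k u => by
      cases k with
      | zero => simp only [add_zero, collapseWedge_circ_self]
      | succ k =>
        simp only [ofPants_outer]
        rw [collapseWedge_circ_of_ne (by omega), add_right_comm, add_assoc])
    (fun k u => by
      cases k with
      | zero =>
        simp only [add_zero]
        rw [collapseWedge_circ_of_ne (by omega), pantsCollapse_inner₁]
      | succ k =>
        simp only [ofPants_inner₁]
        rw [collapseWedge_circ_of_ne (by omega), add_right_comm N 1 k, add_assoc N k 1])
    (fun k u => by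
      cases k with
      | zero =>
        simp only [add_zero]
        rw [collapseWedge_circ_of_ne (by omega), pantsCollapse_inner₂]
      | succ k =>
        simp only [ofPants_inner₂]
        rw [collapseWedge_circ_of_ne (by omega), add_right_comm N 1 k, add_assoc N k 1])

theorem collapse_ofWedge (b : TowerWedge N) :
    collapse N (ofWedge b) = ofWedge (collapseWedge N b) := rfl
theorem collapse_ofPants_zero (z : pairOfPants) :
    collapse N (ofPants N 0 z) = ofWedge (pantsCollapse N z) := rfl
theorem collapse_ofPants_succ (k : ℕ) (z : pairOfPants) :
    collapse N (ofPants N (k + 1) z) = ofPants (N + 1) k z := rfl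

theorem continuous_collapse : Continuous (collapse N) := by
  refine continuous_of (continuous_ofWedge.comp continuous_collapseWedge) fun k => ?_
  cases k with
  | zero => exact continuous_ofWedge.comp (continuous_pantsCollapse N)
  | succ k => exact continuous_ofPants k

/-- The path in the pair of pants from `-4` to `-3`. -/
noncomputable def pantsPathA (t : I) : pairOfPants :=
  ⟨((-4 + t : ℝ) : ℂ), ofReal_mem_pairOfPants
    (Or.inl ⟨by linarith [t.2.1], by linarith [t.2.2]⟩)⟩

/-- The path in the pair of pants from `-1 / 2` to `1`. -/
noncomputable def pantsPathB (t : I) : pairOfPants :=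
  ⟨((-(1 / 2) + 3 / 2 * t : ℝ) : ℂ), ofReal_mem_pairOfPants
    (Or.inr ⟨by linarith [t.2.1], by linarith [t.2.2]⟩)⟩

theorem pantsPathA_re (t : I) : (pantsPathA t : ℂ).re = -4 + t := by
  rw [pantsPathA, Complex.ofReal_re]
theorem pantsPathB_re (t : I) : (pantsPathB t : ℂ).re = -(1 / 2) + 3 / 2 * t := by
  rw [pantsPathB, Complex.ofReal_re]

theorem continuous_pantsPathA : Continuous pantsPathA := by
  refine Continuous.subtype_mk (Complex.continuous_ofReal.comp ?_) _
  fun_prop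
theorem continuous_pantsPathB : Continuous pantsPathB := by
  refine Continuous.subtype_mk (Complex.continuous_ofReal.comp ?_) _
  fun_prop

theorem ofPants_drag_pathA_zero : ofPants N 0 (pantsDrag (1, pantsPathA 0)) = base N := by
  have : pantsPathA 0 = outerBoundary (-1) := by
    ext; simp [pantsPathA, outerBoundary]
  rw [this, pantsDrag_outer_neg_one, ofPants_outer, towerCirc, CircleWedge.circ_neg_one, base]

theorem ofPants_drag_pathA_one : ofPants N 0 (pantsDrag (1, pantsPathA 1)) = base N := by
  have : pantsPathA 1 = innerBoundary₁ (-1) := by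
    ext; simp [pantsPathA, innerBoundary₁]; norm_num
  rw [this, pantsDrag_inner₁, ofPants_inner₁, towerCirc, CircleWedge.circ_neg_one, base]

theorem ofPants_drag_pathB_zero : ofPants N 0 (pantsDrag (1, pantsPathB 0)) = base N := by
  have h : (pantsPathB 0 : ℂ).re = -1 / 2 := by rw [pantsPathB_re]; norm_num
  rw [pantsDrag_one_of_seam (by linarith) (by linarith), h, circleOver_of_le (by norm_num),
    ofPants_inner₁, towerCirc, CircleWedge.circ_neg_one, base]

theorem ofPants_drag_pathB_one : ofPants N 0 (pantsDrag (1, pantsPathB 1)) = base N := by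
  have : pantsPathB 1 = innerBoundary₂ (-1) := by
    ext; simp [pantsPathB, innerBoundary₂]; norm_num
  rw [this, pantsDrag_inner₂, ofPants_inner₂, towerCirc, CircleWedge.circ_neg_one, base]

/-- The loop in `Tower N` that is the image of the circle `(N, 1)`. -/
noncomputable def loopA (N : ℕ) (u : Circle) : Tower N :=
  ofPants N 0 (pantsDrag (1, pantsPathA (circlePosI u)))

/-- The loop in `Tower N` that is the image of the circle `(N, 2)`. -/
noncomputable def loopB (N : ℕ) (u : Circle) : Tower N :=
  ofPants N 0 (pantsDrag (1, pantsPathB (circlePosI u)))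

theorem circlePosI_neg_one : circlePosI (-1) = 0 := Subtype.ext circlePos_neg_one

theorem loopA_neg_one : loopA N (-1) = base N := by
  rw [loopA, circlePosI_neg_one, ofPants_drag_pathA_zero]
theorem loopB_neg_one : loopB N (-1) = base N := by
  rw [loopB, circlePosI_neg_one, ofPants_drag_pathB_zero]

theorem continuous_pantsDrag_one : Continuous fun z : pairOfPants => pantsDrag (1, z) :=
  continuous_pantsDrag.comp (by fun_prop)

theorem continuous_loopA : Continuous (loopA N) :=
  continuous_comp_circlePos (f := fun t => ofPants N 0 (pantsDrag (1, pantsPathA t)))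
    ((continuous_ofPants 0).comp (continuous_pantsDrag_one.comp continuous_pantsPathA))
    (ofPants_drag_pathA_zero.trans ofPants_drag_pathA_one.symm)

theorem continuous_loopB : Continuous (loopB N) :=
  continuous_comp_circlePos (f := fun t => ofPants N 0 (pantsDrag (1, pantsPathB t)))
    ((continuous_ofPants 0).comp (continuous_pantsDrag_one.comp continuous_pantsPathB))
    (ofPants_drag_pathB_zero.trans ofPants_drag_pathB_one.symm)

/-- The map on the wedge of circles underlying `expand`. -/
noncomputable def expandWedge (N : ℕ) : TowerWedge (N + 1) → Tower N :=
  CircleWedge.glue (N, 1) (CircleWedge.glue (N, 2) (fun b => ofWedge (CircleWedge.map _ _ b))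
    (loopB N)) (loopA N)

theorem continuous_expandWedge : Continuous (expandWedge N) := by
  refine CircleWedge.continuous_glue (CircleWedge.continuous_glue
    (continuous_ofWedge.comp (CircleWedge.continuous_map _)) continuous_loopB ?_) continuous_loopA ?_
  · rw [CircleWedge.map_base, loopB_neg_one, base]
  · rw [CircleWedge.glue_of_eq rfl, CircleWedge.map_base, loopA_neg_one, base]

theorem expandWedge_of_eq {b : TowerWedge (N + 1)} (h1 : b.1 (N, 1) = -1) (h2 : b.1 (N, 2) = -1) :
    expandWedge N b = ofWedge (CircleWedge.map _ _ b) := by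
  rw [expandWedge, CircleWedge.glue_of_eq h1, CircleWedge.glue_of_eq h2]

theorem expandWedge_base : expandWedge N (CircleWedge.base _) = base N := by
  rw [expandWedge_of_eq rfl rfl, CircleWedge.map_base, base]

theorem expandWedge_circ (n : ℕ) (u : Circle) :
    expandWedge N (towerCirc (N + 1) n u) = ofWedge (towerCirc N n u) := by
  rw [expandWedge_of_eq (CircleWedge.circ_of_ne (by simp) _) (CircleWedge.circ_of_ne (by simp) _),
    CircleWedge.map_circ (mem_letters_zero _ _) (mem_letters_zero _ _)]

/-- A homotopy inverse on the left of `collapse`. -/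
noncomputable def expand (N : ℕ) : Tower (N + 1) → Tower N :=
  desc (expandWedge N) (fun k z => ofPants N (k + 1) z)
    (fun k u => by rw [expandWedge_circ, ofPants_outer, add_right_comm N 1 k, add_assoc N k 1])
    (fun k u => by rw [expandWedge_circ, ofPants_inner₁, add_right_comm N 1 k, add_assoc N k 1])
    (fun k u => by rw [expandWedge_circ, ofPants_inner₂, add_right_comm N 1 k, add_assoc N k 1])

theorem expand_ofWedge (b : TowerWedge (N + 1)) : expand N (ofWedge b) = expandWedge N b := rfl
theorem expand_ofPants (k : ℕ) (z : pairOfPants) :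
    expand N (ofPants (N + 1) k z) = ofPants N (k + 1) z := rfl

theorem continuous_expand : Continuous (expand N) :=
  continuous_of continuous_expandWedge fun k => continuous_ofPants (k + 1)

/-- The map `expand` is built so that expanding the collapsed pants gives the final stage of the
deformation. At most one coordinate is nontrivial at each point; over the two connecting arcs the
dragged point depends only on the real part, which the coordinate determines. -/
theorem expandWedge_pantsCollapse (z : pairOfPants) :
    expandWedge N (pantsCollapse N z) = ofPants N 0 (pantsDrag (1, z)) := by
  by_cases ha : pantsCoordA z = -1
  swap
  · obtain ⟨h1, h2⟩ := pantsCoordA_ne ha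
    rw [expandWedge, CircleWedge.glue_of_ne (by rwa [pantsCollapse_A]), pantsCollapse_A, loopA]
    congr 1
    have hre : (pantsPathA (circlePosI (pantsCoordA z)) : ℂ).re = (z : ℂ).re := by
      rw [pantsPathA_re]
      change -4 + circlePos (circleParam _) = _
      rw [circlePos_circleParam (by linarith) (by linarith)]
      ring
    refine pantsDrag_congr hre ?_ _
    rw [hre, pantsFold_of_le (by linarith), pantsHeight_eq_zero (Or.inl h2.le)]
  by_cases hb : pantsCoordB z = -1
  swap
  · obtain ⟨h1, h2⟩ := pantsCoordB_ne hb
    rw [expandWedge, CircleWedge.glue_of_eq (by rwa [pantsCollapse_A]),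
      CircleWedge.glue_of_ne (by rwa [pantsCollapse_B]), pantsCollapse_B, loopB]
    congr 1
    have hre : (pantsPathB (circlePosI (pantsCoordB z)) : ℂ).re = (z : ℂ).re := by
      rw [pantsPathB_re]
      change -(1 / 2) + 3 / 2 * circlePos (circleParam _) = _
      rw [circlePos_circleParam (by linarith) (by linarith)]
      ring
    refine pantsDrag_congr hre ?_ _
    rw [hre]
    exact pantsHeight_eq_zero (Or.inr (Or.inl (pantsFold_mem_of_mem (by linarith) h2.le)))
  rw [expandWedge_of_eq (by rwa [pantsCollapse_A]) (by rwa [pantsCollapse_B])]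
  by_cases hl : pantsCoordL z = -1
  swap
  · rw [pantsCollapse_eq_circ (pantsCollapse_L N z) hl,
      CircleWedge.map_circ (mem_letters_zero _ _) (mem_letters_zero _ _),
      pantsDrag_one_of_coordL hl, ofPants_inner₁, add_zero]
  by_cases hr : pantsCoordR z = -1
  swap
  · rw [pantsCollapse_eq_circ (pantsCollapse_R N z) hr,
      CircleWedge.map_circ (mem_letters_zero _ _) (mem_letters_zero _ _),
      pantsDrag_one_of_coordR hr, ofPants_inner₂, add_zero]
  rw [pantsCollapse_eq_base N ha hb hl hr, CircleWedge.map_base]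
  rcases pantsDrag_one_of_coords ha hb hl hr with h | h | h
  · rw [h, ofPants_outer, towerCirc, CircleWedge.circ_neg_one]
  · rw [h, ofPants_inner₁, towerCirc, CircleWedge.circ_neg_one]
  · rw [h, ofPants_inner₂, towerCirc, CircleWedge.circ_neg_one]

/-- A homotopy of the first pair of pants of `Tower N` that fixes the inner boundary circles and
one point of the outer boundary circle induces a homotopy of `Tower N`. -/
theorem exists_homotopy {K : I × pairOfPants → pairOfPants} (hK : Continuous K)
    (h0 : ∀ s, K (s, outerBoundary (-1)) = outerBoundary (-1))
    (h1 : ∀ s u, K (s, innerBoundary₁ u) = innerBoundary₁ u)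
    (h2 : ∀ s u, K (s, innerBoundary₂ u) = innerBoundary₂ u) :
    ∃ H : I × Tower N → Tower N, Continuous H ∧ (∀ s z, H (s, ofPants N 0 z) =
      ofPants N 0 (K (s, z))) ∧ (∀ s k z, H (s, ofPants N (k + 1) z) = ofPants N (k + 1) z) ∧
      ∀ s b, b.1 (N, 0) = -1 → H (s, ofWedge b) = ofWedge b := by
  -- The homotopy is constructed as a map to the path space, so that it can be glued from maps on
  -- the pieces of the quotient, without a quotient topology on the product with the interval.
  let c : Tower N → C(I, Tower N) := fun x => ContinuousMap.const I x
  have hc : Continuous c := ContinuousMap.continuous_const'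
  let p : pairOfPants → C(I, Tower N) := fun z =>
    ⟨fun s => ofPants N 0 (K (s, z)), (continuous_ofPants 0).comp (hK.comp (by fun_prop))⟩
  have hp : Continuous p := by
    refine ContinuousMap.continuous_of_continuous_uncurry _ ?_
    exact (continuous_ofPants 0).comp (hK.comp continuous_swap)
  have hbase : c (ofWedge (CircleWedge.base _)) = p (outerBoundary (-1)) := by
    ext s
    change ofWedge _ = ofPants N 0 (K (s, _))
    rw [h0, ofPants_outer, towerCirc, CircleWedge.circ_neg_one]
  let w : TowerWedge N → C(I, Tower N) :=
    CircleWedge.glue (N, 0) (fun b => c (ofWedge b)) (fun u => p (outerBoundary u))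
  have hw : Continuous w := CircleWedge.continuous_glue (hc.comp continuous_ofWedge)
    (hp.comp continuous_outerBoundary) hbase
  have hw_ne : ∀ n u, N ≠ n → w (towerCirc N n u) = c (ofWedge (towerCirc N n u)) := fun n u hn =>
    CircleWedge.glue_circ_of_ne (by simpa using hn) u
  let g : ℕ → pairOfPants → C(I, Tower N) := fun k z => match k with
    | 0 => p z
    | k + 1 => c (ofPants N (k + 1) z)
  let D : Tower N → C(I, Tower N) := desc w g
    (fun k u => by
      cases k with
      | zero => exact (CircleWedge.glue_circ_self (f := fun b => c (ofWedge b))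
        (l := fun u => p (outerBoundary u)) (mem_letters_zero _ _) hbase u).symm
      | succ k => rw [hw_ne _ _ (by omega), ← ofPants_outer])
    (fun k u => by
      rw [hw_ne _ _ (by omega), ← ofPants_inner₁]
      cases k with
      | zero =>
        ext s
        change ofPants N 0 (K (s, _)) = _
        rw [h1]; rfl
      | succ k => rfl)
    (fun k u => by
      rw [hw_ne _ _ (by omega), ← ofPants_inner₂]
      cases k with
      | zero =>
        ext s
        change ofPants N 0 (K (s, _)) = _
        rw [h2]; rfl
      | succ k => rfl)
  have hD : Continuous D := by
    refine continuous_of hw fun k => ?_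
    cases k with
    | zero => exact hp
    | succ k => exact hc.comp (continuous_ofPants (k + 1))
  refine ⟨fun q => D q.2 q.1, ?_, fun s z => rfl, fun s k z => rfl, fun s b hb => ?_⟩
  · exact (hD.comp continuous_snd).eval continuous_fst
  · change w b s = _
    simp only [w]
    rw [CircleWedge.glue_of_eq hb]
    rfl

theorem exists_ofPants_outer {b : TowerWedge N} (h : b.1 (N, 0) ≠ -1) :
    ofWedge b = ofPants N 0 (outerBoundary (b.1 (N, 0))) := by
  rw [ofPants_outer, add_zero, towerCirc, ← CircleWedge.eq_circ h]

/-- The composite of `collapse` and `expand` is homotopic to the identity relative to the base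
point, by `pantsShrink` followed by `pantsDrag`. Hence `collapse` is injective on fundamental
groups. -/
theorem homotopic_refl_of_collapse {α : Path (base N) (base N)}
    {β : Path (base (N + 1)) (base (N + 1))} (hβ : ∀ t, β t = collapse N (α t))
    (h : β.Homotopic (Path.refl _)) : α.Homotopic (Path.refl _) := by
  have hexp : expand N (base (N + 1)) = base N := expandWedge_base
  obtain ⟨H, hH, H1, H2, H3⟩ := exists_homotopy (N := N) continuous_pantsShrink
    (fun s => pantsShrink_of_spine_eq pantsSpine_outer_neg_one s)
    (fun s u => pantsShrink_of_spine_eq (pantsSpine_inner₁ u) s)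
    (fun s u => pantsShrink_of_spine_eq (pantsSpine_inner₂ u) s)
  obtain ⟨H', hH', H1', H2', H3'⟩ := exists_homotopy (N := N) continuous_pantsDrag
    pantsDrag_outer_neg_one pantsDrag_inner₁ pantsDrag_inner₂
  have hb : ∀ s, H (s, base N) = base N := fun s => H3 s _ rfl
  have hb' : ∀ s, H' (s, base N) = base N := fun s => H3' s _ rfl
  have e0 : ∀ x, H (0, x) = x := by
    refine ind (fun b => ?_) (fun k z => ?_)
    · by_cases hbN : b.1 (N, 0) = -1
      · exact H3 _ _ hbN
      · rw [exists_ofPants_outer hbN, H1, pantsShrink_zero]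
    · cases k with
      | zero => rw [H1, pantsShrink_zero]
      | succ k => rw [H2]
  have e1 : ∀ x, H (1, x) = H' (0, x) := by
    refine ind (fun b => ?_) (fun k z => ?_)
    · by_cases hbN : b.1 (N, 0) = -1
      · rw [H3 _ _ hbN, H3' _ _ hbN]
      · rw [exists_ofPants_outer hbN, H1, H1', pantsDrag_zero]
    · cases k with
      | zero => rw [H1, H1', pantsDrag_zero]
      | succ k => rw [H2, H2']
  have e2 : ∀ x, H' (1, x) = expand N (collapse N x) := by
    refine ind (fun b => ?_) (fun k z => ?_)
    · rw [collapse_ofWedge, expand_ofWedge]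
      by_cases hbN : b.1 (N, 0) = -1
      · rw [H3' _ _ hbN, collapseWedge, CircleWedge.glue_of_eq hbN]
        have h' : ∀ i : Fin 3, i ≠ 0 → b.1 (N, i) = -1 := fun i hi => b.2.2 _ (by simp [letters, hi])
        rw [expandWedge_of_eq]
        · congr 1
          refine CircleWedge.coord_injective _ _ fun j => ?_
          by_cases hj : j ∈ letters N
          · have hj' : j ∈ letters (N + 1) := hj.imp_right fun h => h.trans (Nat.lt_succ_self N)
            rw [CircleWedge.map_of_mem _ hj, CircleWedge.map_of_mem _ hj']
          · rw [b.2.2 j hj, (CircleWedge.map _ _ _).2.2 j hj]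
        · rw [CircleWedge.map_of_mem _ (mem_letters_succ N 1)]; exact h' 1 (by simp)
        · rw [CircleWedge.map_of_mem _ (mem_letters_succ N 2)]; exact h' 2 (by simp)
      · rw [exists_ofPants_outer hbN, H1', collapseWedge, CircleWedge.glue_of_ne hbN,
          expandWedge_pantsCollapse]
    · cases k with
      | zero => rw [H1', collapse_ofPants_zero, expand_ofWedge, expandWedge_pantsCollapse]
      | succ k => rw [H2', collapse_ofPants_succ, expand_ofPants]
  let γ : Path (base N) (base N) :=
    { toFun := fun t => H (1, α t)
      continuous_toFun := hH.comp (by fun_prop)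
      source' := by rw [α.source, hb]
      target' := by rw [α.target, hb] }
  let δ : Path (base N) (base N) :=
    { toFun := fun t => expand N (β t)
      continuous_toFun := continuous_expand.comp β.continuous
      source' := by rw [β.source, hexp]
      target' := by rw [β.target, hexp] }
  have h1 : α.Homotopic γ := Path.homotopic_of_family (fun q => H (q.1, α q.2))
    (hH.comp (by fun_prop)) (fun t => e0 _) (fun t => rfl) (fun s => by simp [hb])
    (fun s => by simp [hb])
  have h2 : γ.Homotopic δ := Path.homotopic_of_family (fun q => H' (q.1, α q.2))
    (hH'.comp (by fun_prop)) (fun t => (e1 _).symm)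
    (fun t => by rw [e2, ← hβ]; rfl) (fun s => by simp [hb'])
    (fun s => by simp [hb'])
  obtain ⟨F⟩ := h
  have h3 : δ.Homotopic (Path.refl _) := Path.homotopic_of_family (fun q => expand N (F q))
    (continuous_expand.comp F.continuous) (fun t => by simp; rfl) (fun t => by simp [hexp])
    (fun s => by simp [hexp]) (fun s => by simp [hexp])
  exact (h1.trans h2).trans h3

end Tower

theorem CircleCoords.Horizontal.eq_mul_of_crossing' {X J : Type*} [TopologicalSpace X]
    {c : CircleCoords X J} {S : Finset J} {f : I → X} {g : I → FreeGroup J}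
    (hg : c.Horizontal S f g) {j : J} (hj : j ∈ S) {s m m' t : I} (hsm : s < m) (hmt : m' < t)
    (hst : s < t) (hs : c.IsBase (f s)) (ht : c.IsBase (f t))
    (h : ∀ z, s < z → z < t → c.coord j (f z) ≠ -1) {v w : FreeGroup J}
    (hv : ∀ z, s < z → z < m → z < t → c.jump S (f z) = v)
    (hw : ∀ z, m' < z → z < t → s < z → c.jump S (f z) = w) : g t = g s * v⁻¹ * w := by
  refine hg.eq_mul_of_crossing hj hst hs ht (fun z hz => h z hz.1 hz.2) ?_ ?_
  · filter_upwards [Ioo_mem_nhdsGT hsm, Ioo_mem_nhdsGT hst] with z hz hz'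
    exact hv z hz.1 hz.2 hz'.2
  · filter_upwards [Ioo_mem_nhdsLT hmt, Ioo_mem_nhdsLT hst] with z hz hz'
    exact hw z hz.1 hz.2 hz'.1

/-! ### The word of the outer boundary, and words under the collapse. -/

namespace Tower

variable {N : ℕ}

/-- The outer boundary loop of a pair of pants. -/
noncomputable def outerLoop (t : I) : pairOfPants := outerBoundary (circleParam t)

theorem continuous_outerLoop : Continuous outerLoop :=
  continuous_outerBoundary.comp (continuous_circleParam.comp continuous_subtype_val)

theorem outerLoop_re (t : I) : (outerLoop t : ℂ).re = 4 * (1 - |4 * (t : ℝ) - 2|) := by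
  rw [outerLoop, outerBoundary_re, circleParam_re t.2.1 t.2.2]

theorem outerLoop_re_of_le {t : I} (h : (t : ℝ) ≤ 1 / 2) : (outerLoop t : ℂ).re = 16 * t - 4 := by
  rw [outerLoop_re, abs_of_nonpos (by linarith)]; ring

theorem outerLoop_re_of_ge {t : I} (h : 1 / 2 ≤ (t : ℝ)) : (outerLoop t : ℂ).re = 12 - 16 * t := by
  rw [outerLoop_re, abs_of_nonneg (by linarith)]; ring

theorem outerLoop_im_nonneg {t : I} (h : (t : ℝ) ≤ 1 / 2) : 0 ≤ (outerLoop t : ℂ).im := by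
  rw [outerLoop, outerBoundary_im]
  have := circleParam_im_nonneg h
  linarith

theorem outerLoop_im_neg {t : I} (h : 1 / 2 < (t : ℝ)) (h1 : (t : ℝ) < 1) :
    (outerLoop t : ℂ).im < 0 := by
  rw [outerLoop, outerBoundary_im]
  have := circleParam_im_neg h h1
  linarith

theorem isBase_pantsCollapse {z : pairOfPants} (h : (z : ℂ).re = -4 ∨ (z : ℂ).re = -3 ∨
    (z : ℂ).re = -1 / 2 ∨ (z : ℂ).re = 1) :
    (CircleWedge.coords (letters (N + 1))).IsBase (pantsCollapse N z) := by
  rw [pantsCollapse_eq_base N]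
  · exact CircleWedge.isBase_base
  all_goals by_contra hc
  · have := pantsCoordA_ne hc; rcases h with h | h | h | h <;> linarith [this.1, this.2]
  · have := pantsCoordB_ne hc; rcases h with h | h | h | h <;> linarith [this.1, this.2]
  · have := pantsCoordL_ne hc; rcases h with h | h | h | h <;> linarith [this.1, this.2]
  · have := pantsCoordR_ne hc; rcases h with h | h | h | h <;> linarith [this]

theorem pantsCoordA_ne_of {z : ℂ} (h : -4 < z.re) (h' : z.re < -3) : pantsCoordA z ≠ -1 :=
  circleParam_ne (by linarith) (by linarith)

theorem pantsCoordB_ne_of {z : ℂ} (h : -1 / 2 < z.re) (h' : z.re < 1) : pantsCoordB z ≠ -1 :=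
  circleParam_ne (by linarith) (by linarith)

theorem pantsCoordL_ne_of {z : ℂ} (h : -3 < z.re) (h' : z.re < -1 / 2) : pantsCoordL z ≠ -1 := by
  rw [pantsCoordL]; split_ifs
  · exact circleOver_ne (by linarith) _
  · exact circleOver_ne (by linarith) _

theorem pantsCoordR_ne_of {z : ℂ} (h : 1 < z.re) : pantsCoordR z ≠ -1 :=
  circleOver_ne (by linarith) _

/-- The point `x` of the unit interval. -/
noncomputable def unitPt (x : ℝ) : I := projIcc 0 1 zero_le_one x

theorem coe_unitPt {x : ℝ} (h0 : 0 ≤ x) (h1 : x ≤ 1) : (unitPt x : ℝ) = x := by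
  rw [unitPt, projIcc_of_mem zero_le_one ⟨h0, h1⟩]

theorem lt_unitPt {x : ℝ} {z : I} (h0 : 0 ≤ x) (h1 : x ≤ 1) : z < unitPt x ↔ (z : ℝ) < x := by
  rw [← Subtype.coe_lt_coe, coe_unitPt h0 h1]

theorem unitPt_lt {x : ℝ} {z : I} (h0 : 0 ≤ x) (h1 : x ≤ 1) : unitPt x < z ↔ x < (z : ℝ) := by
  rw [← Subtype.coe_lt_coe, coe_unitPt h0 h1]

theorem crossing {S : Finset Letter} {g : I → FreeGroup Letter}
    (hg : (CircleWedge.coords (letters (N + 1))).Horizontal S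
      (fun t => pantsCollapse N (outerLoop t)) g) {j : Letter} (hj : j ∈ S) {s m m' t : ℝ}
    (h0 : 0 ≤ s) (hsm : s < m) (hmt : m' < t) (hmt' : m ≤ t) (hsm' : s ≤ m') (h1 : t ≤ 1)
    (hs : (CircleWedge.coords (letters (N + 1))).IsBase (pantsCollapse N (outerLoop (unitPt s))))
    (ht : (CircleWedge.coords (letters (N + 1))).IsBase (pantsCollapse N (outerLoop (unitPt t))))
    (h : ∀ z : I, s < z → z < t → (pantsCollapse N (outerLoop z)).1 j ≠ -1) {v w : FreeGroup Letter}
    (hv : ∀ z : I, s < z → z < m → (CircleWedge.coords (letters (N + 1))).jump S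
      (pantsCollapse N (outerLoop z)) = v)
    (hw : ∀ z : I, m' < z → z < t → (CircleWedge.coords (letters (N + 1))).jump S
      (pantsCollapse N (outerLoop z)) = w) : g (unitPt t) = g (unitPt s) * v⁻¹ * w := by
  have hs1 : s ≤ 1 := by linarith
  have ht0 : 0 ≤ t := by linarith
  have hm0 : 0 ≤ m := by linarith
  have hm1 : m ≤ 1 := by linarith
  have hm0' : 0 ≤ m' := by linarith
  have hm1' : m' ≤ 1 := by linarith
  refine hg.eq_mul_of_crossing' hj (m := unitPt m) (m' := unitPt m') ?_ ?_ ?_ hs ht ?_ ?_ ?_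
  · rwa [unitPt_lt h0 hs1, coe_unitPt hm0 hm1]
  · rwa [unitPt_lt hm0' hm1', coe_unitPt ht0 h1]
  · rw [unitPt_lt h0 hs1, coe_unitPt ht0 h1]; linarith
  · intro z hz hz'
    exact h z ((unitPt_lt h0 hs1).1 hz) ((lt_unitPt ht0 h1).1 hz')
  · intro z hz hz' _
    exact hv z ((unitPt_lt h0 hs1).1 hz) ((lt_unitPt hm0 hm1).1 hz')
  · intro z hz hz' _
    exact hw z ((unitPt_lt hm0' hm1').1 hz) ((lt_unitPt ht0 h1).1 hz')

theorem jump_pantsCollapse_of_nonneg {S : Finset Letter} {z : pairOfPants} {j : Letter} {u : Circle}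
    (h : (pantsCollapse N z).1 j = u) (hu : u ≠ -1) (hi : 0 ≤ (u : ℂ).im) :
    (CircleWedge.coords (letters (N + 1))).jump S (pantsCollapse N z) = 1 := by
  subst h; exact CircleCoords.jump_of_nonneg (c := CircleWedge.coords (letters (N + 1))) hu hi

theorem jump_pantsCollapse_of_neg {S : Finset Letter} {z : pairOfPants} {j : Letter} {u : Circle}
    (h : (pantsCollapse N z).1 j = u) (hj : j ∈ S) (hi : (u : ℂ).im < 0) :
    (CircleWedge.coords (letters (N + 1))).jump S (pantsCollapse N z) = FreeGroup.of j := by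
  subst h; exact CircleCoords.jump_of_neg (c := CircleWedge.coords (letters (N + 1))) hj hi

/-- The outer boundary of a pair of pants spells the word `a b y b⁻¹ x a⁻¹`. -/
theorem outerLoop_word {S : Finset Letter} (hA : (N, 1) ∈ S) (hB : (N, 2) ∈ S)
    (hL : (2 * N + 1, 0) ∈ S) (hR : (2 * N + 2, 0) ∈ S) {g : I → FreeGroup Letter}
    (hg : (CircleWedge.coords (letters (N + 1))).Horizontal S
      (fun t => pantsCollapse N (outerLoop t)) g) (hg0 : g 0 = 1) :
    g 1 = FreeGroup.of (N, 1) * FreeGroup.of (N, 2) * FreeGroup.of (2 * N + 2, 0) *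
      (FreeGroup.of (N, 2))⁻¹ * FreeGroup.of (2 * N + 1, 0) * (FreeGroup.of (N, 1))⁻¹ := by
  -- The real part is `16 t - 4` on the first half of the loop and `12 - 16 t` on the second. These
  -- are the times at which it equals `-4`, `-3`, `-1 / 2` or `1`, where the collapsed loop is at
  -- the base point.
  have base : ∀ x : ℝ, 0 ≤ x → x ≤ 1 → (x = 0 ∨ x = 1 / 16 ∨ x = 7 / 32 ∨ x = 5 / 16 ∨ x = 11 / 16 ∨
      x = 25 / 32 ∨ x = 15 / 16 ∨ x = 1) →
      (CircleWedge.coords (letters (N + 1))).IsBase (pantsCollapse N (outerLoop (unitPt x))) := by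
    intro x h0 h1 hx
    refine isBase_pantsCollapse ?_
    rw [outerLoop_re, coe_unitPt h0 h1]
    rcases hx with rfl | rfl | rfl | rfl | rfl | rfl | rfl | rfl <;> norm_num [abs_of_neg, abs_of_pos]
  have c1 : g (unitPt (1 / 16)) = g (unitPt 0) * 1⁻¹ * FreeGroup.of (N, 1) := by
    refine crossing hg hA (m := 1 / 32) (m' := 1 / 32) le_rfl (by norm_num) (by norm_num)
      (by norm_num) (by norm_num) (by norm_num) (base _ (by norm_num) (by norm_num) (by norm_num))
      (base _ (by norm_num) (by norm_num) (by norm_num)) ?_ ?_ ?_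
    all_goals intro z hz hz'
    all_goals have hre := outerLoop_re_of_le (t := z) (by linarith)
    · rw [pantsCollapse_A]
      exact pantsCoordA_ne_of (by linarith) (by linarith)
    · exact jump_pantsCollapse_of_nonneg (pantsCollapse_A N _)
        (pantsCoordA_ne_of (by linarith) (by linarith)) (circleParam_im_nonneg (by linarith))
    · exact jump_pantsCollapse_of_neg (pantsCollapse_A N _) hA
        (circleParam_im_neg (by linarith) (by linarith))
  -- On the way out, the upper arc of the first inner circle is followed by the dragged seam, which
  -- runs back along the same arc; nothing is contributed.
  have c2 : g (unitPt (7 / 32)) = g (unitPt (1 / 16)) * 1⁻¹ * 1 := by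
    have hj : ∀ z : I, 1 / 16 < (z : ℝ) → (z : ℝ) < 7 / 32 →
        (CircleWedge.coords (letters (N + 1))).jump S (pantsCollapse N (outerLoop z)) = 1 := by
      intro z hz hz'
      have hre := outerLoop_re_of_le (t := z) (by linarith)
      refine jump_pantsCollapse_of_nonneg (pantsCollapse_L N _)
        (pantsCoordL_ne_of (by linarith) (by linarith)) ?_
      rw [pantsCoordL]
      split_ifs
      · exact circleOver_im_nonneg (outerLoop_im_nonneg (by linarith))
      · exact circleOver_im_nonneg zero_le_one
    refine crossing hg hL (m := 1 / 8) (m' := 1 / 8) (by norm_num) (by norm_num) (by norm_num)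
      (by norm_num) (by norm_num) (by norm_num) (base _ (by norm_num) (by norm_num) (by norm_num))
      (base _ (by norm_num) (by norm_num) (by norm_num)) ?_ ?_ ?_
    all_goals intro z hz hz'
    · have hre := outerLoop_re_of_le (t := z) (by linarith)
      rw [pantsCollapse_L]
      exact pantsCoordL_ne_of (by linarith) (by linarith)
    · exact hj z (by linarith) (by linarith)
    · exact hj z (by linarith) (by linarith)
  have c3 : g (unitPt (5 / 16)) = g (unitPt (7 / 32)) * 1⁻¹ * FreeGroup.of (N, 2) := by
    refine crossing hg hB (m := 17 / 64) (m' := 17 / 64) (by norm_num) (by norm_num) (by norm_num)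
      (by norm_num) (by norm_num) (by norm_num) (base _ (by norm_num) (by norm_num) (by norm_num))
      (base _ (by norm_num) (by norm_num) (by norm_num)) ?_ ?_ ?_
    all_goals intro z hz hz'
    all_goals have hre := outerLoop_re_of_le (t := z) (by linarith)
    · rw [pantsCollapse_B]
      exact pantsCoordB_ne_of (by linarith) (by linarith)
    · exact jump_pantsCollapse_of_nonneg (pantsCollapse_B N _)
        (pantsCoordB_ne_of (by linarith) (by linarith)) (circleParam_im_nonneg (by linarith))
    · exact jump_pantsCollapse_of_neg (pantsCollapse_B N _) hB
        (circleParam_im_neg (by linarith) (by linarith))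
  -- Between `7 / 16` and `9 / 16` the real part is at least `3` and the coordinate rests at the
  -- midpoint of the second inner circle, so the second half of the circle is entered only after `9
  -- / 16`.
  have c4 : g (unitPt (11 / 16)) = g (unitPt (5 / 16)) * 1⁻¹ * FreeGroup.of (2 * N + 2, 0) := by
    refine crossing hg hR (m := 1 / 2) (m' := 9 / 16) (by norm_num) (by norm_num) (by norm_num)
      (by norm_num) (by norm_num) (by norm_num) (base _ (by norm_num) (by norm_num) (by norm_num))
      (base _ (by norm_num) (by norm_num) (by norm_num)) ?_ ?_ ?_
    all_goals intro z hz hz'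
    · rw [pantsCollapse_R]
      refine pantsCoordR_ne_of ?_
      rcases le_total (z : ℝ) (1 / 2) with h | h
      · rw [outerLoop_re_of_le h]; linarith
      · rw [outerLoop_re_of_ge h]; linarith
    · have hre := outerLoop_re_of_le (t := z) (by linarith)
      exact jump_pantsCollapse_of_nonneg (pantsCollapse_R N _)
        (pantsCoordR_ne_of (by linarith)) (circleOver_im_nonneg (outerLoop_im_nonneg (by linarith)))
    · have hre := outerLoop_re_of_ge (t := z) (by linarith)
      exact jump_pantsCollapse_of_neg (pantsCollapse_R N _) hR
        (circleOver_im_neg (by linarith) (by linarith) (outerLoop_im_neg (by linarith) (by linarith)))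
  have c5 : g (unitPt (25 / 32)) = g (unitPt (11 / 16)) * (FreeGroup.of (N, 2))⁻¹ * 1 := by
    refine crossing hg hB (m := 47 / 64) (m' := 47 / 64) (by norm_num) (by norm_num) (by norm_num)
      (by norm_num) (by norm_num) (by norm_num) (base _ (by norm_num) (by norm_num) (by norm_num))
      (base _ (by norm_num) (by norm_num) (by norm_num)) ?_ ?_ ?_
    all_goals intro z hz hz'
    all_goals have hre := outerLoop_re_of_ge (t := z) (by linarith)
    · rw [pantsCollapse_B]
      exact pantsCoordB_ne_of (by linarith) (by linarith)
    · exact jump_pantsCollapse_of_neg (pantsCollapse_B N _) hB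
        (circleParam_im_neg (by linarith) (by linarith))
    · exact jump_pantsCollapse_of_nonneg (pantsCollapse_B N _)
        (pantsCoordB_ne_of (by linarith) (by linarith)) (circleParam_im_nonneg (by linarith))
  -- On the way back the seam traverses the upper arc, until the real part is `-1` at time `13 /
  -- 16`, and the boundary below traverses the lower arc: together one full turn.
  have c6 : g (unitPt (15 / 16)) = g (unitPt (25 / 32)) * 1⁻¹ * FreeGroup.of (2 * N + 1, 0) := by
    refine crossing hg hL (m := 13 / 16) (m' := 14 / 16) (by norm_num) (by norm_num) (by norm_num)
      (by norm_num) (by norm_num) (by norm_num) (base _ (by norm_num) (by norm_num) (by norm_num))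
      (base _ (by norm_num) (by norm_num) (by norm_num)) ?_ ?_ ?_
    all_goals intro z hz hz'
    all_goals have hre := outerLoop_re_of_ge (t := z) (by linarith)
    · rw [pantsCollapse_L]
      exact pantsCoordL_ne_of (by linarith) (by linarith)
    · refine jump_pantsCollapse_of_nonneg (pantsCollapse_L N _)
        (pantsCoordL_ne_of (by linarith) (by linarith)) ?_
      rw [pantsCoordL, if_neg (by linarith)]
      exact circleOver_im_nonneg zero_le_one
    · refine jump_pantsCollapse_of_neg (pantsCollapse_L N _) hL ?_
      rw [pantsCoordL, if_pos (by linarith)]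
      exact circleOver_im_neg (by linarith) (by linarith)
        (outerLoop_im_neg (by linarith) (by linarith))
  have c7 : g (unitPt 1) = g (unitPt (15 / 16)) * (FreeGroup.of (N, 1))⁻¹ * 1 := by
    refine crossing hg hA (m := 31 / 32) (m' := 31 / 32) (by norm_num) (by norm_num) (by norm_num)
      (by norm_num) (by norm_num) (by norm_num) (base _ (by norm_num) (by norm_num) (by norm_num))
      (base _ (by norm_num) (by norm_num) (by norm_num)) ?_ ?_ ?_
    all_goals intro z hz hz'
    all_goals have hre := outerLoop_re_of_ge (t := z) (by linarith)
    · rw [pantsCollapse_A]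
      exact pantsCoordA_ne_of (by linarith) (by linarith)
    · exact jump_pantsCollapse_of_neg (pantsCollapse_A N _) hA
        (circleParam_im_neg (by linarith) (by linarith))
    · exact jump_pantsCollapse_of_nonneg (pantsCollapse_A N _)
        (pantsCoordA_ne_of (by linarith) (by linarith)) (circleParam_im_nonneg (by linarith))
  have u0 : unitPt 0 = 0 := Subtype.ext (coe_unitPt le_rfl zero_le_one)
  have u1 : unitPt 1 = 1 := Subtype.ext (coe_unitPt zero_le_one le_rfl)
  rw [u1] at c7
  rw [u0, hg0] at c1
  rw [c7, c6, c5, c4, c3, c2, c1]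
  simp only [inv_one, mul_one, one_mul]

/-- The collapse of a pair of pants is injective on the words of loops. -/
theorem hol_eq_one_of_collapseWedge {f : I → TowerWedge N} (hf : Continuous f)
    (hf0 : (CircleWedge.coords (letters N)).IsBase (f 0))
    (hf1 : (CircleWedge.coords (letters N)).IsBase (f 1))
    (h : ∀ᶠ S in atTop, (CircleWedge.coords (letters (N + 1))).hol S
      (fun t => collapseWedge N (f t)) = 1) :
    ∀ᶠ S in atTop, (CircleWedge.coords (letters N)).hol S f = 1 := by
  filter_upwards [h, eventually_ge_atTop
    ({(N, 0), (N, 1), (N, 2), (2 * N + 1, 0), (2 * N + 2, 0)} : Finset Letter)] with S hS hS'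
  have hl : Continuous fun t => pantsCollapse N (outerLoop t) :=
    (continuous_pantsCollapse N).comp continuous_outerLoop
  obtain ⟨G, hG, hG0⟩ := CircleCoords.exists_horizontal_path
    (c := CircleWedge.coords (letters (N + 1))) (S := S) hl
  have hA : (N, 1) ∈ S := hS' (by simp)
  have hB : (N, 2) ∈ S := hS' (by simp)
  have hG1 := outerLoop_word hA hB (hS' (by simp)) (hS' (by simp)) hG hG0
  have hout : ∀ t : I, t = 0 ∨ t = 1 → outerLoop t = outerBoundary (-1) := by
    rintro t (rfl | rfl)
    · rw [outerLoop, circleParam_eq_neg_one (Or.inl (by simp))]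
    · rw [outerLoop, circleParam_eq_neg_one (Or.inr (by simp))]
  have key := CircleCoords.hol_comp_eq_subst (c := CircleWedge.coords (letters N))
    (d := CircleWedge.coords (letters (N + 1))) (S := S) (n := (N, 0)) (hS' (by simp))
    (k := collapseWedge N) hG hG0
    (by rw [hout 0 (Or.inl rfl), pantsCollapse_outer_neg_one]; exact CircleWedge.isBase_base)
    (by rw [hout 1 (Or.inr rfl), pantsCollapse_outer_neg_one]; exact CircleWedge.isBase_base)
    (fun b hb i => by
      change (collapseWedge N b).1 i = b.1 i
      rw [collapseWedge, CircleWedge.glue_of_eq hb]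
      by_cases hi : i ∈ letters (N + 1)
      · rw [CircleWedge.map_of_mem _ hi]
      · rw [(CircleWedge.map _ _ b).2.2 i hi, b.2.2 i fun h =>
          hi (h.imp_right fun h => h.trans (Nat.lt_succ_self N))])
    (fun b hb => by
      change collapseWedge N b = _
      rw [collapseWedge, CircleWedge.glue_of_ne hb, outerLoop]
      congr 2
      exact (circleParam_circlePos _).symm)
    hf hf0 hf1
  rw [hS, hG1] at key
  -- The circles `a` and `b` are not yet present in level `N`, so their letters do not occur in the
  -- holonomy there, and the substitution is injective on it.
  have hnot : ∀ i : Fin 3, i ≠ 0 → ∀ b : TowerWedge N,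
      (CircleWedge.coords (letters N)).coord (N, i) b = -1 := fun i hi b =>
    b.2.2 _ (by simp [letters, hi])
  have ha := CircleCoords.subst_one_hol hA (hnot 1 (by simp)) hf hf0 hf1
  have hb := CircleCoords.subst_one_hol hB (hnot 2 (by simp)) hf hf0 hf1
  refine FreeGroup.eq_one_of_subst_eq_one (n := (N, 0)) (x := (2 * N + 1, 0)) (y := (2 * N + 2, 0))
    (a := (N, 1)) (b := (N, 2)) (by simp) (by simp) (by simp) (by simp) (by simp) ?_ ?_ ?_
  · convert ha
  · convert hb
  · convert key.symm

end Tower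

/-! ### Collars of the boundary, and the neighbourhood that deforms to the wedge. -/

/-- The radial projection of the punctured plane to the unit circle. -/
noncomputable def toCircle (w : ℂ) : Circle :=
  if h : w = 0 then -1 else ⟨w / ‖w‖, mem_sphere_zero_iff_norm.2 (by
    rw [norm_div, Complex.norm_real, norm_norm, div_self (norm_ne_zero_iff.2 h)])⟩

theorem coe_toCircle {w : ℂ} (h : w ≠ 0) : (toCircle w : ℂ) = w / ‖w‖ := by simp [toCircle, h]

theorem toCircle_mul {u : Circle} {r : ℝ} (hr : 0 < r) : toCircle (r * u) = u := by
  have h1 : ‖(r : ℂ) * u‖ = r := by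
    rw [norm_mul, Circle.norm_coe, mul_one, Complex.norm_real, Real.norm_of_nonneg hr.le]
  have h0 : (r : ℂ) * u ≠ 0 := by rw [← norm_ne_zero_iff, h1]; exact hr.ne'
  have h2 : (r : ℂ) ≠ 0 := Complex.ofReal_ne_zero.2 hr.ne'
  ext
  rw [coe_toCircle h0, h1]
  field_simp

theorem continuousAt_toCircle {w : ℂ} (h : w ≠ 0) : ContinuousAt toCircle w := by
  refine Topology.IsInducing.subtypeVal.continuousAt_iff.2 ?_
  have h1 : ContinuousAt (fun w : ℂ => w / ‖w‖) w :=
    continuousAt_id.div (by fun_prop) (by simpa using h)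
  refine h1.congr ?_
  filter_upwards [isOpen_ne.mem_nhds h] with v hv
  exact (coe_toCircle hv).symm

/-- The radial deformation of the punctured plane onto the circle of radius `r`. -/
noncomputable def radial (r s : ℝ) (w : ℂ) : ℂ := ((1 - s) * ‖w‖ + s * r : ℝ) * (toCircle w : ℂ)

theorem norm_radial {r s : ℝ} (hr : 0 ≤ r) (h0 : 0 ≤ s) (h1 : s ≤ 1) (w : ℂ) :
    ‖radial r s w‖ = (1 - s) * ‖w‖ + s * r := by
  have h2 : 0 ≤ 1 - s := by linarith
  have h3 : 0 ≤ (1 - s) * ‖w‖ + s * r := by positivity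
  rw [radial, norm_mul, Circle.norm_coe, mul_one, Complex.norm_real, Real.norm_of_nonneg h3]

theorem radial_zero {w : ℂ} (h : w ≠ 0) (r : ℝ) : radial r 0 w = w := by
  have : (‖w‖ : ℂ) ≠ 0 := by simpa using h
  rw [radial, coe_toCircle h]
  push_cast
  field_simp
  ring

theorem radial_one (r : ℝ) (w : ℂ) : radial r 1 w = r * toCircle w := by
  simp [radial]

theorem radial_self {w : ℂ} (h : w ≠ 0) {r : ℝ} (hr : ‖w‖ = r) (s : ℝ) : radial r s w = w := by
  have : (r : ℂ) ≠ 0 := by rw [← hr]; simpa using h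
  rw [radial, coe_toCircle h, hr]
  push_cast
  field_simp
  ring

theorem continuousAt_radial {Z : Type*} [TopologicalSpace Z] {r : ℝ} {s : Z → ℝ} {f : Z → ℂ} {z : Z}
    (hs : ContinuousAt s z) (hf : ContinuousAt f z) (h : f z ≠ 0) :
    ContinuousAt (fun q => radial r (s q) (f q)) z := by
  have h1 : ContinuousAt (fun q => toCircle (f q)) z :=
    ContinuousAt.comp (g := toCircle) (f := f) (continuousAt_toCircle h) hf
  have h2 : ContinuousAt (fun q => (toCircle (f q) : ℂ)) z :=
    continuous_subtype_val.continuousAt.comp h1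
  exact ContinuousAt.mul (by fun_prop) h2

theorem mem_pairOfPants_norm {z : ℂ} :
    z ∈ pairOfPants ↔ ‖z‖ ≤ 4 ∧ 1 ≤ ‖z + 2‖ ∧ 1 ≤ ‖z - 2‖ := by
  simp only [pairOfPants, Set.mem_sdiff, mem_union, not_or, Metric.mem_ball, not_lt, dist_eq_norm,
    mem_closedBall_zero_iff, sub_neg_eq_add]

/-- The collar of the outer boundary circle of a pair of pants. -/
def collar₀ : Set pairOfPants := {z | 7 / 2 < ‖(z : ℂ)‖}
/-- The collar of the first inner boundary circle of a pair of pants. -/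
def collar₁ : Set pairOfPants := {z | ‖(z : ℂ) + 2‖ < 7 / 5}
/-- The collar of the second inner boundary circle of a pair of pants. -/
def collar₂ : Set pairOfPants := {z | ‖(z : ℂ) - 2‖ < 7 / 5}

theorem isOpen_collar₀ : IsOpen collar₀ :=
  isOpen_lt continuous_const (by fun_prop)
theorem isOpen_collar₁ : IsOpen collar₁ :=
  isOpen_lt (by fun_prop) continuous_const
theorem isOpen_collar₂ : IsOpen collar₂ :=
  isOpen_lt (by fun_prop) continuous_const

/-- The collar radii satisfy `2 + 7 / 5 < 7 / 2` and `7 / 5 + 7 / 5 < 4`, which makes the three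
collars disjoint. -/
theorem notMem_collar₀_of_mem₁ {z : pairOfPants} (h : z ∈ collar₁) : z ∉ collar₀ := by
  intro h0
  have h1 := norm_sub_le ((z : ℂ) + 2) 2
  rw [add_sub_cancel_right, Complex.norm_ofNat] at h1
  have h2 : 7 / 2 < ‖(z : ℂ)‖ := h0
  have h3 : ‖(z : ℂ) + 2‖ < 7 / 5 := h
  linarith

theorem notMem_collar₀_of_mem₂ {z : pairOfPants} (h : z ∈ collar₂) : z ∉ collar₀ := by
  intro h0
  have h1 := norm_add_le ((z : ℂ) - 2) 2
  rw [sub_add_cancel, Complex.norm_ofNat] at h1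
  have h2 : 7 / 2 < ‖(z : ℂ)‖ := h0
  have h3 : ‖(z : ℂ) - 2‖ < 7 / 5 := h
  linarith

theorem notMem_collar₁_of_mem₂ {z : pairOfPants} (h : z ∈ collar₂) : z ∉ collar₁ := by
  intro h0
  have h1 := norm_sub_le ((z : ℂ) + 2) ((z : ℂ) - 2)
  rw [show (z : ℂ) + 2 - ((z : ℂ) - 2) = 4 by ring, Complex.norm_ofNat] at h1
  have h2 : ‖(z : ℂ) + 2‖ < 7 / 5 := h0
  have h3 : ‖(z : ℂ) - 2‖ < 7 / 5 := h
  linarith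

theorem outerBoundary_mem_collar (u : Circle) : outerBoundary u ∈ collar₀ := by
  change 7 / 2 < ‖4 * (u : ℂ)‖
  rw [norm_mul, Circle.norm_coe, Complex.norm_ofNat]; norm_num

theorem innerBoundary₁_mem_collar (u : Circle) : innerBoundary₁ u ∈ collar₁ := by
  change ‖-2 + (u : ℂ) + 2‖ < 7 / 5
  rw [show -2 + (u : ℂ) + 2 = u by ring, Circle.norm_coe]; norm_num

theorem innerBoundary₂_mem_collar (u : Circle) : innerBoundary₂ u ∈ collar₂ := by
  change ‖2 + (u : ℂ) - 2‖ < 7 / 5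
  rw [show 2 + (u : ℂ) - 2 = u by ring, Circle.norm_coe]; norm_num

theorem radial_mem₀ {z : pairOfPants} (h : z ∈ collar₀) {s : ℝ} (h0 : 0 ≤ s) (h1 : s ≤ 1) :
    radial 4 s z ∈ pairOfPants := by
  have hn := norm_radial (r := 4) (by norm_num) h0 h1 z
  have h2 : 7 / 2 < ‖(z : ℂ)‖ := h
  have h3 := (mem_pairOfPants_norm.1 z.2).1
  have h4 := norm_sub_le (radial 4 s z + 2) 2
  have h5 := norm_add_le (radial 4 s z - 2) 2
  rw [add_sub_cancel_right, Complex.norm_ofNat] at h4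
  rw [sub_add_cancel, Complex.norm_ofNat] at h5
  have h6 : ‖radial 4 s z‖ ≤ 4 := by rw [hn]; nlinarith
  have h7 : 7 / 2 ≤ ‖radial 4 s z‖ := by rw [hn]; nlinarith
  exact mem_pairOfPants_norm.2 ⟨h6, by linarith, by linarith⟩

theorem radial_mem₁ {z : pairOfPants} (h : z ∈ collar₁) {s : ℝ} (h0 : 0 ≤ s) (h1 : s ≤ 1) :
    radial 1 s (z + 2) - 2 ∈ pairOfPants := by
  have hn := norm_radial (r := 1) (by norm_num) h0 h1 ((z : ℂ) + 2)
  have h2 : ‖(z : ℂ) + 2‖ < 7 / 5 := h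
  have h3 := (mem_pairOfPants_norm.1 z.2).2.1
  set w := radial 1 s (z + 2)
  have h6 : ‖w‖ ≤ 7 / 5 := by rw [hn]; nlinarith
  have h7 : 1 ≤ ‖w‖ := by rw [hn]; nlinarith
  have h4 := norm_sub_le w 2
  have h5 := norm_sub_le w (w - 4)
  rw [Complex.norm_ofNat] at h4
  rw [sub_sub_cancel, Complex.norm_ofNat] at h5
  refine mem_pairOfPants_norm.2 ⟨by linarith, by rwa [sub_add_cancel], ?_⟩
  rw [show w - 2 - 2 = w - 4 by ring]; linarith

theorem radial_mem₂ {z : pairOfPants} (h : z ∈ collar₂) {s : ℝ} (h0 : 0 ≤ s) (h1 : s ≤ 1) :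
    radial 1 s (z - 2) + 2 ∈ pairOfPants := by
  have hn := norm_radial (r := 1) (by norm_num) h0 h1 ((z : ℂ) - 2)
  have h2 : ‖(z : ℂ) - 2‖ < 7 / 5 := h
  have h3 := (mem_pairOfPants_norm.1 z.2).2.2
  set w := radial 1 s (z - 2)
  have h6 : ‖w‖ ≤ 7 / 5 := by rw [hn]; nlinarith
  have h7 : 1 ≤ ‖w‖ := by rw [hn]; nlinarith
  have h4 := norm_add_le w 2
  have h5 := norm_sub_le (w + 4) w
  rw [Complex.norm_ofNat] at h4
  rw [add_sub_cancel_left, Complex.norm_ofNat] at h5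
  refine mem_pairOfPants_norm.2 ⟨by linarith, ?_, by rwa [add_sub_cancel_right]⟩
  rw [show w + 2 + 2 = w + 4 by ring]; linarith

open Classical in
/-- The radial deformation of the collars in a pair of pants onto the boundary. -/
noncomputable def collarPush (q : I × pairOfPants) : pairOfPants :=
  if h : q.2 ∈ collar₀ then ⟨radial 4 q.1 q.2, radial_mem₀ h q.1.2.1 q.1.2.2⟩
  else if h : q.2 ∈ collar₁ then ⟨radial 1 q.1 (q.2 + 2) - 2, radial_mem₁ h q.1.2.1 q.1.2.2⟩
  else if h : q.2 ∈ collar₂ then ⟨radial 1 q.1 (q.2 - 2) + 2, radial_mem₂ h q.1.2.1 q.1.2.2⟩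
  else q.2

theorem collarPush_of_mem₀ {s : I} {z : pairOfPants} (h : z ∈ collar₀) :
    (collarPush (s, z) : ℂ) = radial 4 s z := by rw [collarPush, dif_pos h]

theorem collarPush_of_mem₁ {s : I} {z : pairOfPants} (h : z ∈ collar₁) :
    (collarPush (s, z) : ℂ) = radial 1 s (z + 2) - 2 := by
  rw [collarPush, dif_neg (notMem_collar₀_of_mem₁ h), dif_pos h]

theorem collarPush_of_mem₂ {s : I} {z : pairOfPants} (h : z ∈ collar₂) :
    (collarPush (s, z) : ℂ) = radial 1 s (z - 2) + 2 := by
  rw [collarPush, dif_neg (notMem_collar₀_of_mem₂ h), dif_neg (notMem_collar₁_of_mem₂ h), dif_pos h]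

theorem ne_zero_of_collar₀ {z : pairOfPants} (h : z ∈ collar₀) : (z : ℂ) ≠ 0 := by
  rw [← norm_pos_iff]
  have h2 : 7 / 2 < ‖(z : ℂ)‖ := h
  linarith

theorem pants_add_ne_zero (z : pairOfPants) : (z : ℂ) + 2 ≠ 0 := by
  rw [← norm_pos_iff]; linarith [(mem_pairOfPants_norm.1 z.2).2.1]

theorem pants_sub_ne_zero (z : pairOfPants) : (z : ℂ) - 2 ≠ 0 := by
  rw [← norm_pos_iff]; linarith [(mem_pairOfPants_norm.1 z.2).2.2]

theorem collarPush_zero (z : pairOfPants) : collarPush (0, z) = z := by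
  ext
  by_cases h0 : z ∈ collar₀
  · rw [collarPush_of_mem₀ h0]; exact radial_zero (ne_zero_of_collar₀ h0) _
  by_cases h1 : z ∈ collar₁
  · rw [collarPush_of_mem₁ h1, Icc.coe_zero, radial_zero (pants_add_ne_zero z), add_sub_cancel_right]
  by_cases h2 : z ∈ collar₂
  · rw [collarPush_of_mem₂ h2, Icc.coe_zero, radial_zero (pants_sub_ne_zero z), sub_add_cancel]
  · rw [collarPush, dif_neg h0, dif_neg h1, dif_neg h2]

theorem collarPush_one₀ {z : pairOfPants} (h : z ∈ collar₀) :
    collarPush (1, z) = outerBoundary (toCircle z) := by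
  ext; rw [collarPush_of_mem₀ h, Icc.coe_one, radial_one]; simp [outerBoundary]

theorem collarPush_one₁ {z : pairOfPants} (h : z ∈ collar₁) :
    collarPush (1, z) = innerBoundary₁ (toCircle (z + 2)) := by
  ext; rw [collarPush_of_mem₁ h, Icc.coe_one, radial_one]; simp [innerBoundary₁]; ring

theorem collarPush_one₂ {z : pairOfPants} (h : z ∈ collar₂) :
    collarPush (1, z) = innerBoundary₂ (toCircle (z - 2)) := by
  ext; rw [collarPush_of_mem₂ h, Icc.coe_one, radial_one]; simp [innerBoundary₂]; ring

theorem collarPush_outer (s : I) (u : Circle) :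
    collarPush (s, outerBoundary u) = outerBoundary u := by
  have h := outerBoundary_mem_collar u
  ext; rw [collarPush_of_mem₀ h]
  refine radial_self (ne_zero_of_collar₀ h) ?_ _
  simp [outerBoundary, Circle.norm_coe]

theorem collarPush_inner₁ (s : I) (u : Circle) :
    collarPush (s, innerBoundary₁ u) = innerBoundary₁ u := by
  ext; rw [collarPush_of_mem₁ (innerBoundary₁_mem_collar u),
    radial_self (pants_add_ne_zero _) _, add_sub_cancel_right]
  simp [innerBoundary₁, Circle.norm_coe]

theorem collarPush_inner₂ (s : I) (u : Circle) :
    collarPush (s, innerBoundary₂ u) = innerBoundary₂ u := by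
  ext; rw [collarPush_of_mem₂ (innerBoundary₂_mem_collar u),
    radial_self (pants_sub_ne_zero _) _, sub_add_cancel]
  simp [innerBoundary₂, Circle.norm_coe]

theorem continuousAt_collarPush {s : I} {z : pairOfPants}
    (h : z ∈ collar₀ ∪ collar₁ ∪ collar₂) : ContinuousAt collarPush (s, z) := by
  refine Topology.IsInducing.subtypeVal.continuousAt_iff.2 ?_
  have h1 : ContinuousAt (fun q : I × pairOfPants => q.2) (s, z) := continuousAt_snd
  rcases h with (h | h) | h
  · have : ContinuousAt (fun q : I × pairOfPants => radial 4 q.1 q.2) (s, z) :=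
      continuousAt_radial (by fun_prop) (by fun_prop) (ne_zero_of_collar₀ h)
    refine this.congr ?_
    filter_upwards [h1.eventually (isOpen_collar₀.mem_nhds h)] with q hq
    exact (collarPush_of_mem₀ (s := q.1) hq).symm
  · have h3 : ContinuousAt (fun q : I × pairOfPants => (q.2 : ℂ) + 2) (s, z) := by fun_prop
    have h2 : ContinuousAt (fun q : I × pairOfPants => radial 1 q.1 ((q.2 : ℂ) + 2)) (s, z) :=
      continuousAt_radial (s := fun q : I × pairOfPants => (q.1 : ℝ)) (by fun_prop) h3
        (pants_add_ne_zero z)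
    have : ContinuousAt (fun q : I × pairOfPants => radial 1 q.1 ((q.2 : ℂ) + 2) - 2) (s, z) :=
      ContinuousAt.sub h2 continuousAt_const
    refine this.congr ?_
    filter_upwards [h1.eventually (isOpen_collar₁.mem_nhds h)] with q hq
    exact (collarPush_of_mem₁ (s := q.1) hq).symm
  · have h3 : ContinuousAt (fun q : I × pairOfPants => (q.2 : ℂ) - 2) (s, z) := by fun_prop
    have h2 : ContinuousAt (fun q : I × pairOfPants => radial 1 q.1 ((q.2 : ℂ) - 2)) (s, z) :=
      continuousAt_radial (s := fun q : I × pairOfPants => (q.1 : ℝ)) (by fun_prop) h3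
        (pants_sub_ne_zero z)
    have : ContinuousAt (fun q : I × pairOfPants => radial 1 q.1 ((q.2 : ℂ) - 2) + 2) (s, z) :=
      ContinuousAt.add h2 continuousAt_const
    refine this.congr ?_
    filter_upwards [h1.eventually (isOpen_collar₂.mem_nhds h)] with q hq
    exact (collarPush_of_mem₂ (s := q.1) hq).symm

namespace Tower

variable {N : ℕ}

open Classical in
/-- The retraction of a collar of a pair of pants to the wedge of circles. -/
noncomputable def collarRetract (N k : ℕ) (z : pairOfPants) : TowerWedge N :=
  if z ∈ collar₀ then towerCirc N (N + k) (toCircle z)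
  else if z ∈ collar₁ then towerCirc N (2 * (N + k) + 1) (toCircle (z + 2))
  else towerCirc N (2 * (N + k) + 2) (toCircle (z - 2))

theorem collarRetract_of_mem₀ {k : ℕ} {z : pairOfPants} (h : z ∈ collar₀) :
    collarRetract N k z = towerCirc N (N + k) (toCircle z) := if_pos h

theorem collarRetract_of_mem₁ {k : ℕ} {z : pairOfPants} (h : z ∈ collar₁) :
    collarRetract N k z = towerCirc N (2 * (N + k) + 1) (toCircle (z + 2)) := by
  rw [collarRetract, if_neg (notMem_collar₀_of_mem₁ h), if_pos h]

theorem collarRetract_of_mem₂ {k : ℕ} {z : pairOfPants} (h : z ∈ collar₂) :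
    collarRetract N k z = towerCirc N (2 * (N + k) + 2) (toCircle (z - 2)) := by
  rw [collarRetract, if_neg (notMem_collar₀_of_mem₂ h), if_neg (notMem_collar₁_of_mem₂ h)]

theorem continuousAt_collarRetract {k : ℕ} {z : pairOfPants}
    (h : z ∈ collar₀ ∪ collar₁ ∪ collar₂) : ContinuousAt (collarRetract N k) z := by
  rcases h with (h | h) | h
  · have : ContinuousAt (fun z : pairOfPants => towerCirc N (N + k) (toCircle z)) z :=
      (CircleWedge.continuous_circ _).continuousAt.comp ((continuousAt_toCircle
        (ne_zero_of_collar₀ h)).comp (f := fun z : pairOfPants => (z : ℂ)) (by fun_prop))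
    refine this.congr ?_
    filter_upwards [isOpen_collar₀.mem_nhds h] with q hq
    exact (collarRetract_of_mem₀ hq).symm
  · have : ContinuousAt (fun z : pairOfPants => towerCirc N (2 * (N + k) + 1) (toCircle (z + 2))) z :=
      (CircleWedge.continuous_circ _).continuousAt.comp ((continuousAt_toCircle
        (pants_add_ne_zero z)).comp (f := fun z : pairOfPants => (z : ℂ) + 2) (by fun_prop))
    refine this.congr ?_
    filter_upwards [isOpen_collar₁.mem_nhds h] with q hq
    exact (collarRetract_of_mem₁ hq).symm
  · have : ContinuousAt (fun z : pairOfPants => towerCirc N (2 * (N + k) + 2) (toCircle (z - 2))) z :=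
      (CircleWedge.continuous_circ _).continuousAt.comp ((continuousAt_toCircle
        (pants_sub_ne_zero z)).comp (f := fun z : pairOfPants => (z : ℂ) - 2) (by fun_prop))
    refine this.congr ?_
    filter_upwards [isOpen_collar₂.mem_nhds h] with q hq
    exact (collarRetract_of_mem₂ hq).symm

theorem collarRetract_outer (k : ℕ) (u : Circle) :
    collarRetract N k (outerBoundary u) = towerCirc N (N + k) u := by
  rw [collarRetract_of_mem₀ (outerBoundary_mem_collar u)]
  congr 1
  exact toCircle_mul (r := 4) (by norm_num)

theorem collarRetract_inner₁ (k : ℕ) (u : Circle) :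
    collarRetract N k (innerBoundary₁ u) = towerCirc N (2 * (N + k) + 1) u := by
  rw [collarRetract_of_mem₁ (innerBoundary₁_mem_collar u)]
  congr 1
  have : (innerBoundary₁ u : ℂ) + 2 = (1 : ℝ) * u := by simp [innerBoundary₁]
  rw [this, toCircle_mul one_pos]

theorem collarRetract_inner₂ (k : ℕ) (u : Circle) :
    collarRetract N k (innerBoundary₂ u) = towerCirc N (2 * (N + k) + 2) u := by
  rw [collarRetract_of_mem₂ (innerBoundary₂_mem_collar u)]
  congr 1
  have : (innerBoundary₂ u : ℂ) - 2 = (1 : ℝ) * u := by simp [innerBoundary₂]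
  rw [this, toCircle_mul one_pos]

/-- The neighbourhood of the wedge of circles that consists of the collars. -/
def nearWedge (N : ℕ) : Set (Tower N) :=
  {x | desc (Z := Prop) (fun _ => True) (fun _ z => z ∈ collar₀ ∪ collar₁ ∪ collar₂)
    (fun _ u => eq_true (Or.inl (Or.inl (outerBoundary_mem_collar u))))
    (fun _ u => eq_true (Or.inl (Or.inr (innerBoundary₁_mem_collar u))))
    (fun _ u => eq_true (Or.inr (innerBoundary₂_mem_collar u))) x}

theorem ofWedge_mem_nearWedge (b : TowerWedge N) : ofWedge b ∈ nearWedge N := trivial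

theorem isOpen_nearWedge : IsOpen (nearWedge N) := by
  refine isOpen_of ?_ fun k => ?_
  · have : ofWedge ⁻¹' nearWedge N = univ := eq_univ_of_forall ofWedge_mem_nearWedge
    rw [this]; exact isOpen_univ
  · exact (isOpen_collar₀.union isOpen_collar₁).union isOpen_collar₂

/-- The map that retracts `nearWedge` to the wedge of circles. -/
noncomputable def retract (N : ℕ) : Tower N → TowerWedge N :=
  desc (fun b => b) (collarRetract N) collarRetract_outer collarRetract_inner₁ collarRetract_inner₂

theorem retract_ofWedge (b : TowerWedge N) : retract N (ofWedge b) = b := rfl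

theorem continuousOn_retract : ContinuousOn (retract N) (nearWedge N) :=
  continuousOn_of isOpen_nearWedge continuousOn_id fun _ _ hz =>
    (continuousAt_collarRetract hz).continuousWithinAt

/-- The deformation of `nearWedge` to the wedge of circles. -/
noncomputable def push (s : I) : Tower N → Tower N :=
  desc ofWedge (fun k z => ofPants N k (collarPush (s, z)))
    (fun k u => by rw [collarPush_outer, ofPants_outer])
    (fun k u => by rw [collarPush_inner₁, ofPants_inner₁])
    (fun k u => by rw [collarPush_inner₂, ofPants_inner₂])

theorem push_zero (x : Tower N) : push 0 x = x := by
  refine ind (P := fun x => push 0 x = x) (fun b => rfl) (fun k z => ?_) x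
  change ofPants N k (collarPush (0, z)) = _
  rw [collarPush_zero]

theorem push_one {x : Tower N} (h : x ∈ nearWedge N) : push 1 x = ofWedge (retract N x) := by
  revert h
  refine ind (P := fun x => x ∈ nearWedge N → push 1 x = ofWedge (retract N x)) (fun b _ => rfl)
    (fun k z h => ?_) x
  change ofPants N k (collarPush (1, z)) = ofWedge (collarRetract N k z)
  rcases h with (h | h) | h
  · rw [collarPush_one₀ h, collarRetract_of_mem₀ h, ofPants_outer]
  · rw [collarPush_one₁ h, collarRetract_of_mem₁ h, ofPants_inner₁]
  · rw [collarPush_one₂ h, collarRetract_of_mem₂ h, ofPants_inner₂]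

theorem push_base (s : I) : push s (base N) = base N := rfl

end Tower

/-! ### Iterated collapses and closedness of the null-homotopic loops in the tower. -/

namespace Tower

variable {N : ℕ}

/-- The radial deformation is continuous only on the collars. As a map to the path space it can be
checked piecewise on the open set `nearWedge`; the constant paths elsewhere are placeholders. -/
theorem exists_continuousOn_push (N : ℕ) : ∃ D : Tower N → C(I, Tower N),
    ContinuousOn D (nearWedge N) ∧ ∀ x ∈ nearWedge N, ∀ s, D x s = push s x := by
  classical
  let d : ℕ → pairOfPants → C(I, Tower N) := fun k z =>
    if h : z ∈ collar₀ ∪ collar₁ ∪ collar₂ then ⟨fun s => ofPants N k (collarPush (s, z)),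
      continuous_iff_continuousAt.2 fun s => (continuous_ofPants k).continuousAt.comp
        (ContinuousAt.comp (g := collarPush) (f := fun s => (s, z)) (continuousAt_collarPush h)
          (by fun_prop))⟩
    else ContinuousMap.const I (ofPants N k z)
  have hd : ∀ k z, z ∈ collar₀ ∪ collar₁ ∪ collar₂ → ∀ s, d k z s = ofPants N k (collarPush (s, z)) := by
    intro k z h s
    simp only [d, dif_pos h]; rfl
  let D : Tower N → C(I, Tower N) := desc (fun b => ContinuousMap.const I (ofWedge b)) d
    (fun k u => by
      ext s
      rw [hd _ _ (Or.inl (Or.inl (outerBoundary_mem_collar u))), collarPush_outer, ofPants_outer]; rfl)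
    (fun k u => by
      ext s
      rw [hd _ _ (Or.inl (Or.inr (innerBoundary₁_mem_collar u))), collarPush_inner₁, ofPants_inner₁]
      rfl)
    (fun k u => by
      ext s
      rw [hd _ _ (Or.inr (innerBoundary₂_mem_collar u)), collarPush_inner₂, ofPants_inner₂]; rfl)
  refine ⟨D, ?_, fun x => ?_⟩
  · refine continuousOn_of isOpen_nearWedge
      (ContinuousMap.continuous_const'.comp continuous_ofWedge).continuousOn fun k => ?_
    rw [continuousOn_iff_continuous_domRestrict]
    refine ContinuousMap.continuous_of_continuous_uncurry _ ?_
    refine continuous_iff_continuousAt.2 fun ⟨⟨z, hz⟩, s⟩ => ?_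
    have h1 : ContinuousAt (fun q : (ofPants N k ⁻¹' nearWedge N) × I => collarPush (q.2, q.1.1))
        (⟨z, hz⟩, s) :=
      ContinuousAt.comp (g := collarPush)
        (f := fun q : (ofPants N k ⁻¹' nearWedge N) × I => (q.2, q.1.1))
        (continuousAt_collarPush hz) (by fun_prop)
    refine ((continuous_ofPants k).continuousAt.comp h1).congr (.of_forall fun q => ?_)
    exact (hd k q.1.1 q.1.2 q.2).symm
  · refine ind (P := fun x => x ∈ nearWedge N → ∀ s, D x s = push s x) (fun b _ s => rfl)
      (fun k z h s => hd k z h s) x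

/-- The loop in the wedge of circles to which a loop in `nearWedge` retracts. -/
noncomputable def retractPath (γ : Path (base N) (base N)) (h : ∀ t, γ t ∈ nearWedge N) :
    Path (CircleWedge.base (letters N)) (CircleWedge.base (letters N)) where
  toFun t := retract N (γ t)
  continuous_toFun := continuousOn_retract.comp_continuous γ.continuous h
  source' := by rw [γ.source]; rfl
  target' := by rw [γ.target]; rfl

/-- A loop in the wedge of circles as a loop in the tower. -/
noncomputable def wedgePath (β : Path (CircleWedge.base (letters N)) (CircleWedge.base (letters N))) :
    Path (base N) (base N) := β.map continuous_ofWedge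

theorem homotopic_wedgePath_retractPath (γ : Path (base N) (base N))
    (h : ∀ t, γ t ∈ nearWedge N) : γ.Homotopic (wedgePath (retractPath γ h)) := by
  obtain ⟨D, hD, hDp⟩ := exists_continuousOn_push N
  have h1 : Continuous fun t => D (γ t) := hD.comp_continuous γ.continuous h
  refine Path.homotopic_of_family (fun q => D (γ q.2) q.1)
    ((h1.comp continuous_snd).eval continuous_fst) (fun t => ?_) (fun t => ?_) (fun s => ?_)
    (fun s => ?_)
  · rw [hDp _ (h t), push_zero]
  · rw [hDp _ (h t), push_one (h t)]; rfl
  · rw [hDp _ (h 0), γ.source, push_base]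
  · rw [hDp _ (h 1), γ.target, push_base]

/-- The collapse of several pairs of pants. -/
noncomputable def collapseIter (N : ℕ) : (k : ℕ) → Tower N → Tower (N + k)
  | 0 => id
  | k + 1 => collapse (N + k) ∘ collapseIter N k

/-- The map on the wedges of circles induced by the collapse of several pairs of pants. -/
noncomputable def collapseWedgeIter (N : ℕ) : (k : ℕ) → TowerWedge N → TowerWedge (N + k)
  | 0 => id
  | k + 1 => collapseWedge (N + k) ∘ collapseWedgeIter N k

theorem continuous_collapseIter : ∀ k, Continuous (collapseIter N k)
  | 0 => continuous_id
  | k + 1 => continuous_collapse.comp (continuous_collapseIter k)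

theorem continuous_collapseWedgeIter : ∀ k, Continuous (collapseWedgeIter N k)
  | 0 => continuous_id
  | k + 1 => continuous_collapseWedge.comp (continuous_collapseWedgeIter k)

theorem collapseIter_ofWedge (b : TowerWedge N) :
    ∀ k, collapseIter N k (ofWedge b) = ofWedge (collapseWedgeIter N k b)
  | 0 => rfl
  | k + 1 => by
    change collapse _ (collapseIter N k _) = _
    rw [collapseIter_ofWedge b k]; rfl

theorem collapseWedgeIter_base : ∀ k, collapseWedgeIter N k (CircleWedge.base _) = CircleWedge.base _
  | 0 => rfl
  | k + 1 => by
    change collapseWedge _ (collapseWedgeIter N k _) = _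
    rw [collapseWedgeIter_base k, collapseWedge_base]; rfl

theorem collapseIter_base (k : ℕ) : collapseIter N k (base N) = base (N + k) := by
  rw [base, collapseIter_ofWedge, collapseWedgeIter_base, base]

theorem collapseIter_ofPants (z : pairOfPants) (i : ℕ) :
    ∀ k, collapseIter N k (ofPants N (k + i) z) = ofPants (N + k) i z
  | 0 => by rw [zero_add]; rfl
  | k + 1 => by
    change collapse _ (collapseIter N k _) = _
    have := collapseIter_ofPants z (i + 1) k
    rw [show k + 1 + i = k + (i + 1) by omega, this]; rfl

theorem collapse_mem_nearWedge {x : Tower N} (h : x ∈ nearWedge N) :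
    collapse N x ∈ nearWedge (N + 1) := by
  revert h
  refine ind (P := fun x => x ∈ nearWedge N → collapse N x ∈ nearWedge (N + 1))
    (fun b _ => ofWedge_mem_nearWedge _) (fun k z h => ?_) x
  cases k with
  | zero => exact ofWedge_mem_nearWedge _
  | succ k => exact h

/-- The preimages of the collar neighbourhoods form an increasing open cover, since pants with index
`k` are collapsed into the wedge after `k + 1` steps. A compact set is contained in one of them. -/
theorem exists_forall_collapseIter_mem {K : Set (Tower N)} (hK : IsCompact K) :
    ∃ k, ∀ x ∈ K, collapseIter N k x ∈ nearWedge (N + k) := by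
  refine hK.elim_directed_cover (fun k => collapseIter N k ⁻¹' nearWedge (N + k))
    (fun k => isOpen_nearWedge.preimage (continuous_collapseIter k)) (fun x _ => ?_)
    (Monotone.directed_le (monotone_nat_of_le_succ fun k x hx => collapse_mem_nearWedge hx))
  rw [mem_iUnion]
  refine ind (P := fun x => ∃ k, x ∈ collapseIter N k ⁻¹' nearWedge (N + k))
    (fun b => ⟨0, ofWedge_mem_nearWedge b⟩) (fun k z => ⟨k + 1, ?_⟩) x
  change collapse _ (collapseIter N k _) ∈ nearWedge _
  have := collapseIter_ofPants (N := N) z 0 k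
  rw [add_zero] at this
  rw [this]
  exact ofWedge_mem_nearWedge _

/-- The image of a loop under the collapse of several pairs of pants. -/
noncomputable def iterPath (k : ℕ) (γ : Path (base N) (base N)) :
    Path (base (N + k)) (base (N + k)) :=
  (γ.map (continuous_collapseIter k)).cast (collapseIter_base k).symm (collapseIter_base k).symm

theorem homotopic_refl_of_iterPath {γ : Path (base N) (base N)} :
    ∀ k, (iterPath k γ).Homotopic (Path.refl _) → γ.Homotopic (Path.refl _)
  | 0, h => h
  | k + 1, h => homotopic_refl_of_iterPath k (homotopic_refl_of_collapse (fun _ => rfl) h)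

theorem iterPath_homotopic_refl {γ : Path (base N) (base N)} (k : ℕ)
    (h : γ.Homotopic (Path.refl _)) : (iterPath k γ).Homotopic (Path.refl _) := by
  obtain ⟨F⟩ := h
  exact Path.homotopic_of_family (fun q => collapseIter N k (F q))
    ((continuous_collapseIter k).comp F.continuous) (fun t => by simp; rfl)
    (fun t => by simp [collapseIter_base]) (fun s => by simp [collapseIter_base])
    (fun s => by simp [collapseIter_base])

theorem hol_eq_one_of_collapseWedgeIter {f : I → TowerWedge N} (hf : Continuous f)
    (hf0 : f 0 = CircleWedge.base _) (hf1 : f 1 = CircleWedge.base _) (k : ℕ)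
    (h : ∀ᶠ S in atTop, (CircleWedge.coords (letters (N + k))).hol S
      (fun t => collapseWedgeIter N k (f t)) = 1) :
    ∀ᶠ S in atTop, (CircleWedge.coords (letters N)).hol S f = 1 := by
  induction k with
  | zero => exact h
  | succ k ih =>
    refine ih (hol_eq_one_of_collapseWedge (N := N + k)
      ((continuous_collapseWedgeIter k).comp hf) ?_ ?_ h)
    · rw [hf0, collapseWedgeIter_base]; exact CircleWedge.isBase_base
    · rw [hf1, collapseWedgeIter_base]; exact CircleWedge.isBase_base

/-- The inclusion of the wedge of circles is injective on fundamental groups. -/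
theorem homotopic_refl_of_wedgePath
    {β : Path (CircleWedge.base (letters N)) (CircleWedge.base (letters N))}
    (h : (wedgePath β).Homotopic (Path.refl _)) : β.Homotopic (Path.refl _) := by
  refine (CircleWedge.coords (letters N)).homotopic_refl_of_hol CircleWedge.isBase_base
    CircleWedge.coord_injective β ?_
  obtain ⟨F⟩ := h
  -- After enough collapses the whole null-homotopy retracts to the wedge, so all holonomies of the
  -- collapsed loop are trivial. Injectivity of the collapses on words returns this to `β` for all
  -- large `S`.
  obtain ⟨k, hk⟩ := exists_forall_collapseIter_mem (isCompact_range F.continuous)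
  refine hol_eq_one_of_collapseWedgeIter β.continuous β.source β.target k (.of_forall fun S => ?_)
  let β' : Path (CircleWedge.base (letters (N + k))) (CircleWedge.base (letters (N + k))) :=
    { toFun := fun t => collapseWedgeIter N k (β t)
      continuous_toFun := (continuous_collapseWedgeIter k).comp β.continuous
      source' := by rw [β.source, collapseWedgeIter_base]
      target' := by rw [β.target, collapseWedgeIter_base] }
  refine CircleCoords.hol_eq_one_of_homotopic (α := β') CircleWedge.isBase_base ?_
  have hr : retract (N + k) (base (N + k)) = CircleWedge.base _ := rfl
  refine Path.homotopic_of_family (fun q => retract (N + k) (collapseIter N k (F q)))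
    (continuousOn_retract.comp_continuous ((continuous_collapseIter k).comp F.continuous)
      fun q => hk _ (mem_range_self q)) (fun t => ?_) (fun t => ?_) (fun s => ?_) (fun s => ?_)
  · have : F (0, t) = ofWedge (β t) := F.apply_zero t
    rw [this, collapseIter_ofWedge, retract_ofWedge]; rfl
  · have : F (1, t) = base N := by simp
    rw [this, collapseIter_base, hr]; rfl
  · have : F (s, 0) = base N := by simp
    rw [this, collapseIter_base, hr]
  · have : F (s, 1) = base N := by simp
    rw [this, collapseIter_base, hr]

/-- The null-homotopic loops in the tower form a closed set. -/
theorem isClosed_homotopic_refl :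
    IsClosed {γ : Path (base N) (base N) | γ.Homotopic (Path.refl _)} := by
  rw [← isOpen_compl_iff, isOpen_iff_mem_nhds]
  intro α hα
  obtain ⟨k, hk⟩ := exists_forall_collapseIter_mem (isCompact_range α.continuous)
  have hk' : ∀ t, iterPath k α t ∈ nearWedge (N + k) := fun t => hk _ (mem_range_self t)
  -- Trivial words for all large `S` would contract the retracted loop in the wedge, hence the
  -- collapsed loop, hence `α`.
  have h1 : ¬ ∀ᶠ S in atTop, (CircleWedge.coords (letters (N + k))).hol S
      (retractPath (iterPath k α) hk') = 1 := by
    intro h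
    have h2 := (CircleWedge.coords (letters (N + k))).homotopic_refl_of_hol CircleWedge.isBase_base
      CircleWedge.coord_injective _ h
    have h3 : (wedgePath (retractPath (iterPath k α) hk')).Homotopic (Path.refl _) :=
      h2.map ⟨_, continuous_ofWedge⟩
    exact hα (homotopic_refl_of_iterPath k ((homotopic_wedgePath_retractPath _ hk').trans h3))
  obtain ⟨S, hS⟩ := (not_eventually.1 h1).exists
  let V : Set (Path (base N) (base N)) := {γ | ∀ t, collapseIter N k (γ t) ∈ nearWedge (N + k)}
  have hV : IsOpen V := by
    have h4 : IsOpen {f : C(I, Tower N) | MapsTo f univ (collapseIter N k ⁻¹' nearWedge (N + k))} :=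
      ContinuousMap.isOpen_setOfPred_mapsTo isCompact_univ
        (isOpen_nearWedge.preimage (continuous_collapseIter k))
    have h5 : V = (fun γ : Path (base N) (base N) => (γ : C(I, Tower N))) ⁻¹'
        {f : C(I, Tower N) | MapsTo f univ (collapseIter N k ⁻¹' nearWedge (N + k))} := by
      ext γ; simp [V, MapsTo]
    rw [h5]
    exact h4.preimage continuous_induced_dom
  have hαV : α ∈ V := hk'
  have hf : Continuous fun q : I × V => retract (N + k) (collapseIter N k (q.2.1 q.1)) := by
    refine continuousOn_retract.comp_continuous ((continuous_collapseIter k).comp ?_) fun q => q.2.2 q.1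
    fun_prop
  -- The family is parametrized by the open set `V` of loops that the same `k` collapses move into
  -- the collar neighbourhood, so the nontrivial holonomy of `α` persists near `α`.
  have h6 := CircleCoords.eventually_hol_eq (c := CircleWedge.coords (letters (N + k))) (S := S) hf
    CircleWedge.isBase_base (fun γ => by
      change retract _ (collapseIter N k (γ.1 0)) = _
      rw [γ.1.source, collapseIter_base]; rfl) (fun γ => by
      change retract _ (collapseIter N k (γ.1 1)) = _
      rw [γ.1.target, collapseIter_base]; rfl) ⟨α, hαV⟩
  rw [← hV.isOpenEmbedding_subtypeVal.map_nhds_eq ⟨α, hαV⟩, mem_map]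
  filter_upwards [h6] with γ hγ hnull
  have h7 : (retractPath (iterPath k γ.1) γ.2).Homotopic (Path.refl _) :=
    homotopic_refl_of_wedgePath
      ((homotopic_wedgePath_retractPath _ _).symm.trans (iterPath_homotopic_refl k hnull))
  have h8 := CircleCoords.hol_eq_one_of_homotopic (S := S)
    (c := CircleWedge.coords (letters (N + k))) CircleWedge.isBase_base h7
  exact hS (hγ.symm.trans h8)

end Tower

/-! ### The Hawaiian Pants as the lowest level of the tower. -/

instance {J : Type*} (L : Set J) : CompactSpace (CircleWedge L) := by
  have h1 : ∀ j, IsClosed {b : J → Circle | b j = -1} := fun j =>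
    isClosed_eq (continuous_apply j) continuous_const
  have h2 : {b : J → Circle | (∀ i j, i ≠ j → b i = -1 ∨ b j = -1) ∧ ∀ j ∉ L, b j = -1} =
      (⋂ i, ⋂ j, ⋂ _ : i ≠ j, ({b | b i = -1} ∪ {b | b j = -1})) ∩ ⋂ j, ⋂ _ : j ∉ L, {b | b j = -1} := by
    ext b; simp
  have h3 : IsClosed {b : J → Circle |
      (∀ i j, i ≠ j → b i = -1 ∨ b j = -1) ∧ ∀ j ∉ L, b j = -1} := by
    rw [h2]
    exact (isClosed_iInter fun i => isClosed_iInter fun j => isClosed_iInter fun _ =>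
      (h1 i).union (h1 j)).inter (isClosed_iInter fun j => isClosed_iInter fun _ => h1 j)
  exact isCompact_iff_compactSpace.1 h3.isCompact

theorem toEarring_neg_one (n : ℕ+) : (toEarring n (-1) : ℂ) = 0 := by
  simp [toEarring]

theorem norm_toEarring_le (n : ℕ+) (u : Circle) : ‖(toEarring n u : ℂ)‖ ≤ 2 / n := by
  have h : (toEarring n u : ℂ) = (n : ℂ)⁻¹ * (1 + u) := by simp only [toEarring]; ring
  have h1 : ‖(1 : ℂ) + u‖ ≤ 2 := by
    refine (norm_add_le _ _).trans ?_
    rw [norm_one, Circle.norm_coe]; norm_num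
  rw [h, norm_mul, norm_inv, Complex.norm_natCast, inv_mul_eq_div]
  gcongr

/-- The equality says `k (1 + u) = m (1 + v)`. Since `|1 + u|² = 2 (1 + Re u)`, comparing squared
norms with real parts gives `k (k - m) (1 + Re u) = 0`. -/
theorem eq_neg_one_of_toEarring_eq {m k : ℕ+} (hmk : m ≠ k) {u v : Circle}
    (h : toEarring m u = toEarring k v) : u = -1 := by
  have hm : (m : ℝ) ≠ 0 := by exact_mod_cast m.ne_zero
  have hk : (k : ℝ) ≠ 0 := by exact_mod_cast k.ne_zero
  have hmc : (m : ℂ) ≠ 0 := by exact_mod_cast m.ne_zero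
  have hkc : (k : ℂ) ≠ 0 := by exact_mod_cast k.ne_zero
  have h1 : (m : ℂ)⁻¹ + (m : ℂ)⁻¹ * u = (k : ℂ)⁻¹ + (k : ℂ)⁻¹ * v := congrArg Subtype.val h
  have h2 : ((k : ℝ) : ℂ) * (1 + u) = ((m : ℝ) : ℂ) * (1 + v) := by
    push_cast
    field_simp at h1
    linear_combination h1
  have hre := congrArg Complex.re h2
  have him := congrArg Complex.im h2
  rw [Complex.re_ofReal_mul, Complex.re_ofReal_mul] at hre
  rw [Complex.im_ofReal_mul, Complex.im_ofReal_mul] at him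
  simp only [Complex.add_re, Complex.one_re, Complex.add_im, Complex.one_im, zero_add] at hre him
  have hu := u.re_sq_add_im_sq
  have hv := v.re_sq_add_im_sq
  set p := (u : ℂ).re
  set a := (u : ℂ).im
  set q := (v : ℂ).re
  set b := (v : ℂ).im
  have hne : (k : ℝ) - m ≠ 0 := by
    intro h0
    refine hmk (PNat.coe_injective ?_)
    have : (m : ℝ) = k := by linarith
    exact_mod_cast this
  have h3 : (k : ℝ) * ((k : ℝ) - m) * (1 + p) = 0 := by
    have e1 : (k : ℝ) ^ 2 * (2 * (1 + p)) = (m : ℝ) ^ 2 * (2 * (1 + q)) := by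
      have e2 : 2 * (1 + p) = (1 + p) ^ 2 + a ^ 2 := by linear_combination (-1 : ℝ) * hu
      have e3 : 2 * (1 + q) = (1 + q) ^ 2 + b ^ 2 := by linear_combination (-1 : ℝ) * hv
      rw [e2, e3, mul_add, mul_add, ← mul_pow, ← mul_pow, ← mul_pow, ← mul_pow, hre, him]
    linear_combination (1 / 2 : ℝ) * e1 - (m : ℝ) * hre
  have h4 : 1 + p = 0 := (mul_eq_zero.1 h3).resolve_left (mul_ne_zero hk hne)
  exact Circle.eq_neg_one_of_re (by linarith)

open Classical in
/-- The canonical map from the wedge of circles to the Hawaiian Earring. -/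
noncomputable def wedgeToEarring (b : TowerWedge 0) : hawaiianEarring :=
  if h : ∃ n : ℕ, b.1 (n, 0) ≠ -1 then toEarring h.choose.succPNat (b.1 (h.choose, 0))
  else toEarring 1 (-1)

theorem wedgeToEarring_of_ne {b : TowerWedge 0} {n : ℕ} (h : b.1 (n, 0) ≠ -1) :
    wedgeToEarring b = toEarring n.succPNat (b.1 (n, 0)) := by
  have h' : ∃ n : ℕ, b.1 (n, 0) ≠ -1 := ⟨n, h⟩
  have h1 : h'.choose = n := by
    by_contra hne
    exact h'.choose_spec ((CircleWedge.coords _).coord_eq_of_ne h (by simpa using hne))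
  rw [wedgeToEarring, dif_pos h', h1]

theorem wedgeToEarring_base : wedgeToEarring (CircleWedge.base _) = toEarring 1 (-1) := by
  rw [wedgeToEarring, dif_neg]
  rintro ⟨n, hn⟩
  exact hn rfl

theorem wedgeToEarring_circ (n : ℕ) (u : Circle) :
    wedgeToEarring (towerCirc 0 n u) = toEarring n.succPNat u := by
  have h := CircleWedge.circ_self (mem_letters_zero 0 n) u
  by_cases hu : u = -1
  · rw [hu, towerCirc, CircleWedge.circ_neg_one, wedgeToEarring_base]
    ext
    rw [toEarring_neg_one, toEarring_neg_one]
  · rw [wedgeToEarring_of_ne (n := n) (by rwa [h]), h]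

theorem eq_base_or_exists (b : TowerWedge 0) :
    b = CircleWedge.base _ ∨ ∃ n, b.1 (n, 0) ≠ -1 := by
  by_cases h : ∃ n, b.1 (n, 0) ≠ -1
  · exact Or.inr h
  · push Not at h
    refine Or.inl (CircleWedge.eq_base fun ⟨n, i⟩ => ?_)
    by_cases hi : i = 0
    · rw [hi]; exact h n
    · exact b.2.2 _ (by simp [letters, hi])

/-- The map is the sum of its restrictions to the circles, of which at most one is nonzero at each
point. The partial sums converge uniformly because the circles shrink to the origin. -/
theorem continuous_wedgeToEarring : Continuous wedgeToEarring := by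
  refine continuous_induced_rng.2 ?_
  have h1 : TendstoUniformly (fun (N : ℕ) (b : TowerWedge 0) =>
      ∑ n ∈ Finset.range N, (toEarring n.succPNat (b.1 (n, 0)) : ℂ))
      (fun b => (wedgeToEarring b : ℂ)) atTop := by
    rw [Metric.tendstoUniformly_iff]
    intro ε hε
    obtain ⟨M, hM⟩ := exists_nat_gt (2 / ε)
    filter_upwards [eventually_ge_atTop M] with N hN b
    rcases eq_base_or_exists b with rfl | ⟨n, hn⟩
    · rw [wedgeToEarring_base, toEarring_neg_one, Finset.sum_eq_zero, dist_self]
      · exact hε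
      · intro n _
        exact toEarring_neg_one _
    · have h0 : ∀ k, k ≠ n → (toEarring k.succPNat (b.1 (k, 0)) : ℂ) = 0 := by
        intro k hk
        have := (CircleWedge.coords _).coord_eq_of_ne (x := b) hn
          (j := (k, 0)) (by simpa using hk)
        change b.1 (k, 0) = -1 at this
        rw [this, toEarring_neg_one]
      rw [wedgeToEarring_of_ne hn]
      by_cases hnN : n < N
      · rw [Finset.sum_eq_single n (fun k _ hk => h0 k hk)
          (fun h => absurd (Finset.mem_range.2 hnN) h), dist_self]
        exact hε
      · rw [Finset.sum_eq_zero, dist_zero_right]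
        · refine (norm_toEarring_le _ _).trans_lt ?_
          have hM' : (M : ℝ) ≤ n := by exact_mod_cast hN.trans (not_lt.1 hnN)
          have hn1 : ((n.succPNat : ℕ) : ℝ) = n + 1 := by simp
          rw [hn1, div_lt_iff₀ (by positivity)]
          rw [div_lt_iff₀ hε] at hM
          nlinarith
        · intro k hk
          refine h0 k ?_
          rintro rfl
          exact hnN (Finset.mem_range.1 hk)
  refine h1.continuous (.of_forall fun N => ?_)
  refine continuous_finsetSum _ fun n _ => ?_
  have h2 : Continuous fun b : TowerWedge 0 => (b.1 (n, 0) : ℂ) :=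
    continuous_subtype_val.comp (CircleWedge.continuous_coord _)
  exact continuous_const.add (continuous_const.mul h2)

theorem bijective_wedgeToEarring : Function.Bijective wedgeToEarring := by
  constructor
  · have hb : ∀ b : TowerWedge 0, wedgeToEarring b = toEarring 1 (-1) → b = CircleWedge.base _ := by
      intro b hb
      rcases eq_base_or_exists b with h | ⟨n, hn⟩
      · exact h
      · rw [wedgeToEarring_of_ne hn] at hb
        exfalso
        apply hn
        -- The origin is the point `-1` of every circle; an index different from that of `b` is used
        -- so that points on two distinct circles are compared.
        have h2 : toEarring n.succPNat (b.1 (n, 0)) = toEarring (n.succPNat + 1) (-1) := by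
          rw [hb]; ext; rw [toEarring_neg_one, toEarring_neg_one]
        exact eq_neg_one_of_toEarring_eq (fun h => by simpa using congrArg PNat.val h) h2
    intro x y hxy
    rcases eq_base_or_exists x with hx | ⟨n, hn⟩
    · rw [hx, wedgeToEarring_base] at hxy
      rw [hx, hb y hxy.symm]
    rcases eq_base_or_exists y with hy | ⟨m, hm⟩
    · rw [hy, wedgeToEarring_base] at hxy
      rw [hy, hb x hxy]
    rw [wedgeToEarring_of_ne hn, wedgeToEarring_of_ne hm] at hxy
    have hnm : n = m := by
      by_contra hne
      exact hn (eq_neg_one_of_toEarring_eq (fun h => hne (Nat.succPNat_injective h)) hxy)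
    subst hnm
    rw [CircleWedge.eq_circ hn, CircleWedge.eq_circ hm]
    congr 1
    have h1 : ((n.succPNat : ℕ) : ℂ)⁻¹ + ((n.succPNat : ℕ) : ℂ)⁻¹ * (x.1 (n, 0)) =
      ((n.succPNat : ℕ) : ℂ)⁻¹ + ((n.succPNat : ℕ) : ℂ)⁻¹ * (y.1 (n, 0)) := congrArg Subtype.val hxy
    have h2 : ((n.succPNat : ℕ) : ℂ)⁻¹ ≠ 0 := inv_ne_zero (by exact_mod_cast n.succPNat.ne_zero)
    exact Circle.ext (mul_left_cancel₀ h2 (add_left_cancel h1))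
  · rintro ⟨z, hz⟩
    obtain ⟨n, hn⟩ := mem_iUnion.1 hz
    have hnc : (n : ℂ) ≠ 0 := by exact_mod_cast n.ne_zero
    have hnr : (n : ℝ) ≠ 0 := by exact_mod_cast n.ne_zero
    have h1 : ‖(n : ℂ) * z - 1‖ = 1 := by
      rw [earringCircle, mem_sphere_iff_norm] at hn
      have : (n : ℂ) * z - 1 = n * (z - (n : ℂ)⁻¹) := by field_simp
      rw [this, norm_mul, hn, Complex.norm_natCast, mul_inv_cancel₀ hnr]
    obtain ⟨u, hu⟩ : ∃ u : Circle, (u : ℂ) = n * z - 1 := ⟨⟨_, mem_sphere_zero_iff_norm.2 h1⟩, rfl⟩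
    refine ⟨towerCirc 0 n.natPred u, ?_⟩
    rw [wedgeToEarring_circ, PNat.succPNat_natPred]
    ext
    change (n : ℂ)⁻¹ + (n : ℂ)⁻¹ * u = z
    rw [hu]
    field_simp
    ring

/-- The wedge of circles is homeomorphic to the Hawaiian Earring. -/
noncomputable def wedgeHomeoEarring : TowerWedge 0 ≃ₜ hawaiianEarring :=
  Continuous.homeoOfEquivCompactToT2 (f := Equiv.ofBijective _ bijective_wedgeToEarring)
    continuous_wedgeToEarring

theorem wedgeHomeoEarring_symm_toEarring (n : ℕ+) (u : Circle) :
    wedgeHomeoEarring.symm (toEarring n u) = towerCirc 0 n.natPred u := by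
  rw [Homeomorph.symm_apply_eq]
  change _ = wedgeToEarring _
  rw [wedgeToEarring_circ, PNat.succPNat_natPred]

namespace HawaiianPants

/-- The homeomorphism from the Hawaiian Pants to the lowest level of the tower. -/
noncomputable def toTower : HawaiianPants → Tower 0 :=
  -- Indices are shifted by one to start at zero: if `n` becomes `k = n - 1`, then `2 n` becomes `2
  -- k + 1` and `2 n + 1` becomes `2 k + 2`.
  Quot.lift (Sum.elim (fun x => Tower.ofWedge (wedgeHomeoEarring.symm x))
    fun p => Tower.ofPants 0 p.1.natPred p.2) fun _ _ h => by
    cases h with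
    | outer n u =>
      simp only [Sum.elim_inr, Sum.elim_inl, wedgeHomeoEarring_symm_toEarring]
      rw [Tower.ofPants_outer, zero_add]
    | inner₁ n u =>
      simp only [Sum.elim_inr, Sum.elim_inl, wedgeHomeoEarring_symm_toEarring]
      rw [Tower.ofPants_inner₁, zero_add]
      congr 2
      have h1 := PNat.natPred_add_one n
      have h2 := PNat.natPred_add_one (2 * n)
      have h3 : ((2 * n : ℕ+) : ℕ) = 2 * n := rfl
      omega
    | inner₂ n u =>
      simp only [Sum.elim_inr, Sum.elim_inl, wedgeHomeoEarring_symm_toEarring]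
      rw [Tower.ofPants_inner₂, zero_add]
      congr 2
      have h1 := PNat.natPred_add_one n
      have h2 := PNat.natPred_add_one (2 * n + 1)
      have h3 : ((2 * n + 1 : ℕ+) : ℕ) = 2 * n + 1 := rfl
      omega

theorem continuous_toTower : Continuous toTower := by
  refine isQuotientMap_quot_mk.continuous_iff.2 ?_
  exact continuous_sum_dom.2 ⟨Tower.continuous_ofWedge.comp wedgeHomeoEarring.symm.continuous,
    continuous_sigma fun n =>
      show Continuous fun z => Tower.ofPants 0 n.natPred z from Tower.continuous_ofPants _⟩

/-- The inverse of `toTower`. -/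
noncomputable def ofTower : Tower 0 → HawaiianPants :=
  Tower.desc (fun b => Quot.mk PantsGlue (Sum.inl (wedgeToEarring b)))
    (fun k z => Quot.mk PantsGlue (Sum.inr ⟨k.succPNat, z⟩))
    (fun k u => by
      rw [wedgeToEarring_circ, zero_add]
      exact Quot.sound (PantsGlue.outer _ u))
    (fun k u => by
      rw [wedgeToEarring_circ, zero_add]
      have : (2 * k + 1).succPNat = 2 * k.succPNat := PNat.eq (by simp; ring)
      rw [this]
      exact Quot.sound (PantsGlue.inner₁ _ u))
    (fun k u => by
      rw [wedgeToEarring_circ, zero_add]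
      have : (2 * k + 2).succPNat = 2 * k.succPNat + 1 := PNat.eq (by simp; ring)
      rw [this]
      exact Quot.sound (PantsGlue.inner₂ _ u))

theorem continuous_ofTower : Continuous ofTower :=
  Tower.continuous_of (continuous_quot_mk.comp (continuous_inl.comp continuous_wedgeToEarring))
    fun k => continuous_quot_mk.comp (continuous_inr.comp
      (@continuous_sigmaMk ℕ+ (fun _ => pairOfPants) _ k.succPNat))

theorem ofTower_toTower (x : HawaiianPants) : ofTower (toTower x) = x := by
  obtain ⟨x | ⟨n, z⟩⟩ := x
  · change Quot.mk PantsGlue (Sum.inl (wedgeHomeoEarring (wedgeHomeoEarring.symm x))) = _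
    rw [Homeomorph.apply_symm_apply]
  · change Quot.mk PantsGlue (Sum.inr ⟨n.natPred.succPNat, z⟩) = _
    rw [PNat.succPNat_natPred]

/-- The common point of the circles of the Hawaiian Earring. -/
noncomputable def base : HawaiianPants := Quot.mk PantsGlue (Sum.inl (toEarring 1 (-1)))

theorem toTower_base : toTower base = Tower.base 0 := by
  change Tower.ofWedge (wedgeHomeoEarring.symm _) = _
  rw [wedgeHomeoEarring_symm_toEarring, towerCirc, CircleWedge.circ_neg_one, Tower.base]

theorem ofTower_base : ofTower (Tower.base 0) = base := by
  rw [← toTower_base, ofTower_toTower]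

theorem isClosed_homotopic_refl :
    IsClosed {γ : Path base base | γ.Homotopic (Path.refl base)} := by
  let Φ : Path base base → Path (Tower.base 0) (Tower.base 0) := fun γ =>
    (γ.map continuous_toTower).cast toTower_base.symm toTower_base.symm
  have hΦ : Continuous Φ := by
    refine continuous_induced_rng.2 ?_
    exact (ContinuousMap.continuous_postcomp ⟨toTower, continuous_toTower⟩).comp
      continuous_induced_dom
  have h : {γ : Path base base | γ.Homotopic (Path.refl base)} =
      Φ ⁻¹' {γ | γ.Homotopic (Path.refl _)} := by
    ext γ
    constructor
    · rintro ⟨F⟩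
      exact Path.homotopic_of_family (fun q => toTower (F q)) (continuous_toTower.comp F.continuous)
        (fun t => congrArg toTower (F.apply_zero t))
        (fun t => (congrArg toTower (F.apply_one t)).trans toTower_base)
        (fun s => by simp [toTower_base]) (fun s => by simp [toTower_base])
    · rintro ⟨F⟩
      exact Path.homotopic_of_family (fun q => ofTower (F q)) (continuous_ofTower.comp F.continuous)
        (fun t => (congrArg ofTower (F.apply_zero t)).trans (ofTower_toTower _))
        (fun t => (congrArg ofTower (F.apply_one t)).trans ofTower_base)
        (fun s => by simp [ofTower_base]) (fun s => by simp [ofTower_base])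
  rw [h]
  exact Tower.isClosed_homotopic_refl.preimage hΦ

theorem continuous_toEarring (n : ℕ+) : Continuous (toEarring n) :=
  (continuous_const.add (continuous_const.mul continuous_subtype_val)).subtype_mk _

theorem joined_base_toEarring (n : ℕ+) (u : Circle) :
    Joined base (Quot.mk PantsGlue (Sum.inl (toEarring n u)) : HawaiianPants) := by
  have h1 : (Quot.mk PantsGlue (Sum.inl (toEarring n (-1))) : HawaiianPants) = base := by
    have : toEarring n (-1) = toEarring 1 (-1) := by
      ext; rw [toEarring_neg_one, toEarring_neg_one]
    rw [this, base]
  rw [← h1]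
  have h2 : Continuous fun u => (Quot.mk PantsGlue (Sum.inl (toEarring n u)) : HawaiianPants) :=
    continuous_quot_mk.comp (continuous_inl.comp (continuous_toEarring n))
  obtain ⟨γ⟩ := PathConnectedSpace.joined (-1) u
  exact ⟨γ.map h2⟩

/-- The vertical segment from a point to the outer circle, on the same side of the real axis, only
increases the size of the imaginary part and therefore avoids the holes. -/
theorem joined_outerBoundary (z : pairOfPants) : ∃ u, Joined (outerBoundary u) z := by
  have hre := re_mem_of_mem_pairOfPants z.2
  let u : Circle := circleOver ((z : ℂ).re / 4) (z : ℂ).im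
  have hur : (outerBoundary u : ℂ).re = (z : ℂ).re := by
    rw [outerBoundary_re, circleOver_re_of_mem (by linarith) (by linarith)]; ring
  have hui : 0 ≤ (z : ℂ).im * (outerBoundary u : ℂ).im ∧
      |(z : ℂ).im| ≤ |(outerBoundary u : ℂ).im| := by
    have h1 := (mem_pairOfPants.1 z.2).1
    have h2 := u.re_sq_add_im_sq
    have h3 : (u : ℂ).re = (z : ℂ).re / 4 := circleOver_re_of_mem (by linarith) (by linarith) _
    rw [h3] at h2
    rw [outerBoundary_im]
    refine ⟨?_, sq_le_sq.1 (by nlinarith)⟩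
    simp only [u, circleOver_im]
    split_ifs with h
    · positivity
    · have h4 := Real.sqrt_nonneg (1 - (max (-1) (min 1 ((z : ℂ).re / 4))) ^ 2)
      nlinarith
  have hmem : ∀ s : I, (1 - (s : ℝ) : ℂ) * (outerBoundary u).1 + (s : ℝ) * z.1 ∈ pairOfPants := by
    intro s
    have hs0 := s.2.1
    have hs1 := s.2.2
    set w : ℂ := (outerBoundary u).1
    have e1 : ((1 - (s : ℝ) : ℂ) * w + (s : ℝ) * z.1).re = (z : ℂ).re := by
      simp only [Complex.add_re, Complex.mul_re, Complex.sub_re, Complex.one_re, Complex.ofReal_re,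
        Complex.sub_im, Complex.one_im, Complex.ofReal_im, hur]
      ring
    have e2 : ((1 - (s : ℝ) : ℂ) * w + (s : ℝ) * z.1).im =
        (1 - (s : ℝ)) * w.im + s * (z : ℂ).im := by
      simp
    have hz := mem_pairOfPants.1 z.2
    have hw := (mem_pairOfPants.1 (outerBoundary u).2).1
    rw [hur] at hw
    have h5 : w.im ^ 2 ≥ (z : ℂ).im ^ 2 := sq_le_sq.2 hui.2
    have h6 : 0 ≤ (s : ℝ) * (1 - s) := mul_nonneg hs0 (by linarith)
    have h7 : (z : ℂ).im ^ 2 ≤ ((1 - (s : ℝ)) * w.im + s * (z : ℂ).im) ^ 2 := by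
      have h8 : (z : ℂ).im ^ 2 ≤ (z : ℂ).im * w.im := by
        rw [← abs_of_nonneg hui.1, abs_mul, ← sq_abs, sq]
        exact mul_le_mul_of_nonneg_left hui.2 (abs_nonneg _)
      nlinarith [mul_nonneg (mul_nonneg (sub_nonneg.2 hs1) (sub_nonneg.2 hs1)) (sub_nonneg.2 h5),
        mul_nonneg h6 (sub_nonneg.2 h8)]
    have h9 : ((1 - (s : ℝ)) * w.im + s * (z : ℂ).im) ^ 2 ≤ w.im ^ 2 := by
      nlinarith [mul_nonneg h6 (sq_nonneg (w.im - (z : ℂ).im)),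
        mul_nonneg hs0 (sub_nonneg.2 h5)]
    rw [mem_pairOfPants, e1, e2]
    exact ⟨by linarith, by linarith [hz.2.1], by linarith [hz.2.2]⟩
  refine ⟨u, ⟨⟨⟨fun s => ⟨_, hmem s⟩, ?_⟩, ?_, ?_⟩⟩⟩
  · exact Continuous.subtype_mk (by fun_prop) _
  · ext; simp
  · ext; simp

instance : PathConnectedSpace HawaiianPants := by
  have key : ∀ x : HawaiianPants, Joined base x := by
    rintro ⟨x | ⟨n, z⟩⟩
    · obtain ⟨b, rfl⟩ := bijective_wedgeToEarring.2 x
      rcases eq_base_or_exists b with rfl | ⟨n, hn⟩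
      · rw [wedgeToEarring_base]; exact Joined.refl _
      · rw [wedgeToEarring_of_ne hn]; exact joined_base_toEarring _ _
    · obtain ⟨u, ⟨γ⟩⟩ := joined_outerBoundary z
      have h2 : Continuous fun z => (Quot.mk PantsGlue (Sum.inr ⟨n, z⟩) : HawaiianPants) :=
        continuous_quot_mk.comp (continuous_inr.comp
          (@continuous_sigmaMk ℕ+ (fun _ => pairOfPants) _ n))
      have h3 : Joined (Quot.mk PantsGlue (Sum.inr ⟨n, outerBoundary u⟩) : HawaiianPants)
        (Quot.mk PantsGlue (Sum.inr ⟨n, z⟩)) := ⟨γ.map h2⟩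
      rw [show (Quot.mk PantsGlue (Sum.inr ⟨n, outerBoundary u⟩) : HawaiianPants) =
        Quot.mk PantsGlue (Sum.inl (toEarring n u)) from Quot.sound (PantsGlue.outer n u)] at h3
      exact (joined_base_toEarring n u).trans h3
  exact ⟨⟨base⟩, fun x y => (key x).symm.trans (key y)⟩

end HawaiianPants

theorem mainTheorem3 :
    HomotopicallyPathHausdorff HawaiianPants ∧
      ∀ x : HawaiianPants,
        @T1Space (FundamentalGroup HawaiianPants x)
          (fundamentalGroupQuotientTopology HawaiianPants x) :=
  homotopicallyPathHausdorff_and_t1Space HawaiianPants.isClosed_homotopic_refl
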